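/- Let $\theta>-\tfrac12$ and let $\nu_0$ be a probability measure on $\mathbb N=\{1,2,\dots\}$ with $\nu_0(i)>0$ for every $i$. Let $\mathcal P_1(\mathbb N)$ be the space of probability measures on $\mathbb N$, and let $\Pi=\Pi_{1/2,\theta,\nu_0}$ be the two-parameter Dirichlet process with $\alpha=\tfrac12$, i.e. the law of $\sum_{k\ge1}P_k\delta_{\xi_k}$, where $\xi_1,\xi_2,\dots$ are i.i.d. with law $\nu_0$, and $(P_k)$ is, independently of $(\xi_k)$, the descending rearrangement of $V_n=(1-U_1)\cdots(1-U_{n-1})U_n$ with independent $U_k\sim\mathrm{Beta}(\tfrac12,\theta+\tfrac k2)$. Let $$\mathcal F=\{F(\mu)=f(\mu(1),\dots,\mu(d)) : f\in C^\infty(\mathbb R^d),\ d\ge1\}$$ be the space of cylinder functions and $$\mathcal E(F,G)=\frac12\int_{\mathcal P_1(\mathbb N)}\langle\nabla F(\mu),\nabla G(\mu)\rangle_\mu\,\Pi(d\mu),\qquad F,G\in\mathcal F,$$ where $\nabla F(\mu)$ is the function $x\mapsto\nabla_xF(\mu)=\frac{d}{ds}F(\mu+s\delta_x)\big|_{s=0}$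 and $\langle\phi,\psi\rangle_\mu=\int\phi\psi\,d\mu-\int\phi\,d\mu\int\psi\,d\mu$. The form $(\mathcal E,\mathcal F)$ is densely defined and closable on $L^2(\Pi)$. Let $(\mathcal E,D(\mathcal E))$ be its closure and $(L,D(L))$ its generator: $u\in D(L)$ with $Lu=h$ if and only if $u\in D(\mathcal E)$, $h\in L^2(\Pi)$, and $\mathcal E(u,v)=(-h,v)_{L^2(\Pi)}$ for all $v\in D(\mathcal E)$. Then: (i) $\mathcal F\subset D(L)$. (ii) For each $i\in\mathbb N$, the limit $$B_i(\mu)=\lim_{d\to\infty}\frac{(d+1)\,\frac{\nu_0(i)^2}{\mu(i)}}{\frac{\nu_0(1)^2}{\mu(1)}+\cdots+\frac{\nu_0(d)^2}{\mu(d)}+\frac{\nu_0(d+1)^2}{1-\mu(1)-\cdots-\mu(d)}}$$ exists in $L^2(\Pi)$ (the quotient is in $L^2(\Pi)$ for all sufficiently large $d$). (iii) For $F(\mu)=f(\mu(1),\dots,\mu(d))$ with $f\in C^\infty(\mathbb R^d)$ and $d\ge1$, for $\Pi$-almost every $\mu$, $$LF(\mu)=\frac12\sum_{i=1}^d\mu(i)\,\partial_i^2f-\frac12\sum_{i,j=1}^d\mu(i)\mu(j)\,\partial_i\partial_jf+\frac12\sum_{i=1}^d\Big[-\frac12-\theta\mu(i)+\frac12B_i(\mu)\Big]\partial_if,$$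 where the derivatives of $f$ are evaluated at $(\mu(1),\dots,\mu(d))$. -/

import Mathlib

open MeasureTheory ProbabilityTheory Filter Topology
open scoped ENNReal ContDiff

namespace TwoParam

noncomputable section

/-! ### The two-parameter Dirichlet process -/

/-- The joint law of independent `U 0, U 1, …` with `U k ∼ Beta(1 - α, θ + (k + 1) α)`. -/
def stickLaw (α θ : ℝ) : Measure (ℕ → ℝ) :=
  Measure.infinitePi fun k : ℕ => betaMeasure (1 - α) (θ + (k + 1) * α)

/-- The stick-breaking (GEM) weights `V n = (1 - u 0) ⋯ (1 - u (n - 1)) u n`. -/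
def stickWeight (u : ℕ → ℝ) (n : ℕ) : ℝ≥0∞ :=
  ENNReal.ofReal ((∏ j ∈ Finset.range n, (1 - u j)) * u n)

/-- The `(k + 1)`-st largest value (counted with multiplicity) of the sequence `v`: the supremum,
over all sets of `k + 1` indices, of the smallest entry on that set. For `v` tending to `0`, the
sequence `ranked v 0, ranked v 1, …` is `v` in descending order. -/
def ranked (v : ℕ → ℝ≥0∞) (k : ℕ) : ℝ≥0∞ :=
  ⨆ s : {s : Finset ℕ // s.card = k + 1}, ⨅ i ∈ s.1, v i

/-- The random measure `∑ P_k δ_{ξ k}`, where `P_k` are the ranked stick-breaking weights. -/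
def atomicMeasure {S : Type*} [MeasurableSpace S] (u : ℕ → ℝ) (ξ : ℕ → S) : Measure S :=
  Measure.sum fun k => ranked (stickWeight u) k • Measure.dirac (ξ k)

open Classical in
/-- The random measure `∑ P_k δ_{ξ k}` as a random element of the space of probability measures.
Its total mass is almost surely `1`; on the exceptional null set we use `δ_{ξ 0}`. -/
def atomicProb {S : Type*} [MeasurableSpace S] (u : ℕ → ℝ) (ξ : ℕ → S) : ProbabilityMeasure S :=
  if h : IsProbabilityMeasure (atomicMeasure u ξ) then ⟨atomicMeasure u ξ, h⟩
  else ⟨Measure.dirac (ξ 0), inferInstance⟩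

/-- The two-parameter Dirichlet process `Π_{α,θ,ν₀}`: the law of `∑ P_k δ_{ξ k}`, where `(P_k)` has
the Poisson–Dirichlet law `PD(α, θ)` and `(ξ k)` is an independent i.i.d. sequence of law `ν₀`. -/
def dirichletProcess {S : Type*} [MeasurableSpace S] (α θ : ℝ) (ν₀ : ProbabilityMeasure S) :
    Measure (ProbabilityMeasure S) :=
  ((stickLaw α θ).prod (Measure.infinitePi fun _ : ℕ => (ν₀ : Measure S))).map
    fun p => atomicProb p.1 p.2

instance (α θ : ℝ) : IsFiniteMeasure (stickLaw α θ) := by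
  by_cases h : ∀ k : ℕ, IsProbabilityMeasure (betaMeasure (1 - α) (θ + (k + 1) * α))
  · unfold stickLaw; infer_instance
  · rw [stickLaw, Measure.infinitePi, dif_neg h]; infer_instance

instance {S : Type*} [MeasurableSpace S] (α θ : ℝ) (ν₀ : ProbabilityMeasure S) :
    IsFiniteMeasure (dirichletProcess α θ ν₀) := by
  unfold dirichletProcess; infer_instance

/-! ### Cylinder functions on the probability measures on `ℕ` -/

/-- The mass `μ(i)` of the point `i`. -/
def mass (μ : ProbabilityMeasure ℕ) (i : ℕ) : ℝ := (μ : Measure ℕ).real {i}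

/-- The function `y ↦ f (y 0, …, y (d - 1))` of a sequence. -/
def cyl (d : ℕ) (f : (Fin d → ℝ) → ℝ) : (ℕ → ℝ) → ℝ := fun y => f fun i : Fin d => y i

/-- The space `𝓕` of smooth cylinder functions. They are written as functions of the sequence of
point masses, so that they can also be evaluated at `μ + s δ_x`; as a function of `μ`, the member
`Φ` of `𝓕` is `F(μ) = Φ(μ(0), μ(1), …) = f(μ(0), …, μ(d - 1))`. -/
def Cylinder : Submodule ℝ ((ℕ → ℝ) → ℝ) where
  carrier := {Φ | ∃ (d : ℕ) (f : (Fin d → ℝ) → ℝ), ContDiff ℝ ∞ f ∧ Φ = cyl d f}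
  zero_mem' := ⟨0, fun _ => 0, contDiff_const, rfl⟩
  add_mem' := by
    rintro _ _ ⟨d, f, hf, rfl⟩ ⟨e, g, hg, rfl⟩
    refine ⟨max d e, fun x => f (fun i => x (Fin.castLE (le_max_left d e) i)) +
      g (fun i => x (Fin.castLE (le_max_right d e) i)), ?_, rfl⟩
    exact (hf.comp (contDiff_pi.2 fun i => contDiff_apply ℝ ℝ _)).add
      (hg.comp (contDiff_pi.2 fun i => contDiff_apply ℝ ℝ _))
  smul_mem' := by
    rintro c _ ⟨d, f, hf, rfl⟩
    exact ⟨d, fun x => c * f x, contDiff_const.mul hf, rfl⟩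

theorem cyl_mem {d : ℕ} {f : (Fin d → ℝ) → ℝ} (hf : ContDiff ℝ ∞ f) : cyl d f ∈ Cylinder :=
  ⟨d, f, hf, rfl⟩

/-- The gradient `∇_x F = d/ds F(μ + s δ_x)` at `s = 0`, at the mass sequence `y` of `μ`. -/
def grad (Φ : (ℕ → ℝ) → ℝ) (y : ℕ → ℝ) (x : ℕ) : ℝ :=
  deriv (fun s : ℝ => Φ (y + s • Pi.single x (1 : ℝ))) 0

/-- `⟨φ, ψ⟩_μ = ∫ φ ψ dμ - (∫ φ dμ) (∫ ψ dμ)`. -/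
def covar (μ : ProbabilityMeasure ℕ) (φ ψ : ℕ → ℝ) : ℝ :=
  (∫ x, φ x * ψ x ∂(μ : Measure ℕ)) - (∫ x, φ x ∂(μ : Measure ℕ)) * ∫ x, ψ x ∂(μ : Measure ℕ)

theorem measurable_mass (i : ℕ) : Measurable fun μ : ProbabilityMeasure ℕ => mass μ i :=
  ((Measure.measurable_coe (measurableSet_singleton i)).comp measurable_subtype_coe).ennreal_toReal

theorem memLp_cylinder (P : Measure (ProbabilityMeasure ℕ)) [IsFiniteMeasure P] (Φ : Cylinder) :
    MemLp (fun μ => Φ.1 (mass μ)) 2 P := by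
  obtain ⟨d, f, hf, h⟩ := Φ.2
  obtain ⟨C, hC⟩ := (isCompact_Icc (a := (0 : Fin d → ℝ)) (b := 1)).exists_bound_of_continuousOn
    hf.continuous.continuousOn
  rw [h]
  refine MemLp.of_bound (C := C) (hf.continuous.measurable.comp
    (measurable_pi_iff.2 fun i => measurable_mass i)).aestronglyMeasurable
    (Eventually.of_forall fun μ => hC _ ⟨fun i => ?_, fun i => ?_⟩)
  · exact measureReal_nonneg
  · exact measureReal_le_one

/-! ### The form, its closure and its generator

All of this is in `L²(Π_{1/2,θ,ν₀})`. -/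

section Form

variable (θ : ℝ) (ν₀ : ProbabilityMeasure ℕ)

/-- `Π_{1/2,θ,ν₀}` on the probability measures on `ℕ`. -/
abbrev law : Measure (ProbabilityMeasure ℕ) := dirichletProcess (1 / 2) θ ν₀

/-- The real Hilbert space `L²(Π_{1/2,θ,ν₀})`. -/
abbrev L2 : Type := Lp ℝ 2 (law θ ν₀)

/-- A cylinder function as an element of `L²`. -/
def toL2 (Φ : Cylinder) : L2 θ ν₀ := (memLp_cylinder (law θ ν₀) Φ).toLp _

/-- The form `𝓔(F, G) = ½ ∫ ⟨∇F(μ), ∇G(μ)⟩_μ Π(dμ)` on cylinder functions. -/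
def form (Φ Ψ : Cylinder) : ℝ :=
  1 / 2 * ∫ μ, covar μ (grad Φ.1 (mass μ)) (grad Ψ.1 (mass μ)) ∂(law θ ν₀)

/-- `F` is an `𝓔`-Cauchy sequence of cylinder functions. -/
def FormCauchy (F : ℕ → Cylinder) : Prop :=
  Tendsto (fun n : ℕ × ℕ => form θ ν₀ (F n.1 - F n.2) (F n.1 - F n.2)) atTop (𝓝 0)

/-- Closability of `(𝓔, 𝓕)` on `L²`. -/
def Closable : Prop :=
  ∀ F : ℕ → Cylinder, FormCauchy θ ν₀ F →
    Tendsto (fun n => toL2 θ ν₀ (F n)) atTop (𝓝 0) →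
    Tendsto (fun n => form θ ν₀ (F n) (F n)) atTop (𝓝 0)

/-- `F` is an `𝓔`-Cauchy sequence of cylinder functions that converges to `u` in `L²`. -/
def Approximates (F : ℕ → Cylinder) (u : L2 θ ν₀) : Prop :=
  FormCauchy θ ν₀ F ∧ Tendsto (fun n => toL2 θ ν₀ (F n)) atTop (𝓝 u)

/-- The domain `D(𝓔)` of the closure of `(𝓔, 𝓕)`. -/
def formDomain : Set (L2 θ ν₀) := {u | ∃ F, Approximates θ ν₀ F u}

open Classical in
/-- An approximating sequence of a member of `D(𝓔)`. -/
def approxSeq (u : L2 θ ν₀) : ℕ → Cylinder :=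
  if h : u ∈ formDomain θ ν₀ then h.choose else 0

/-- The closure of `(𝓔, 𝓕)`: `𝓔(u, v) = lim 𝓔(F n, G n)` for `u, v ∈ D(𝓔)`, where `F` and `G`
approximate `u` and `v`. If `(𝓔, 𝓕)` is closable, then the limit exists and does not depend on
`F` and `G`. -/
def closedForm (u v : L2 θ ν₀) : ℝ :=
  limUnder atTop fun n => form θ ν₀ (approxSeq θ ν₀ u n) (approxSeq θ ν₀ v n)

/-- `u ∈ D(𝓔)` and `𝓔(u, v) = (-h, v)` for all `v ∈ D(𝓔)`; that is, `h = L u` for the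
generator `L`. Such an `h` is unique as soon as `𝓕` is dense in `L²`. -/
def IsGeneratorValue (u h : L2 θ ν₀) : Prop :=
  u ∈ formDomain θ ν₀ ∧ ∀ v ∈ formDomain θ ν₀, closedForm θ ν₀ u v = inner ℝ (-h) v

/-- The domain `D(L)` of the generator of the closed form `(𝓔, D(𝓔))`. -/
def generatorDomain : Set (L2 θ ν₀) := {u | ∃ h, IsGeneratorValue θ ν₀ u h}

open Classical in
/-- The generator `L` of the closed form `(𝓔, D(𝓔))` (with value `0` outside `D(L)`). -/
def generator (u : L2 θ ν₀) : L2 θ ν₀ :=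
  if h : u ∈ generatorDomain θ ν₀ then h.choose else 0

end Form

/-! ### The drift -/

/-- With points counted from `0`, the quotient
`(d + 1) (ν₀(i)² / μ(i)) / (∑_{j < d} ν₀(j)² / μ(j) + ν₀(d)² / (1 - ∑_{j < d} μ(j)))`. -/
def driftRatio (ν₀ : ProbabilityMeasure ℕ) (i d : ℕ) (μ : ProbabilityMeasure ℕ) : ℝ :=
  (d + 1) * (mass ν₀ i ^ 2 / mass μ i) /
    ((∑ j ∈ Finset.range d, mass ν₀ j ^ 2 / mass μ j) +
      mass ν₀ d ^ 2 / (1 - ∑ j ∈ Finset.range d, mass μ j))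

/-- The functions `Y d` are in `L²(P)` for all large `d` and converge to `B` in `L²(P)`. -/
def IsL2Limit {X : Type*} [MeasurableSpace X] (P : Measure X) (Y : ℕ → X → ℝ) (B : Lp ℝ 2 P) :
    Prop :=
  (∀ᶠ d in atTop, MemLp (Y d) 2 P) ∧
    Tendsto (fun d => eLpNorm (fun x => Y d x - B x) 2 P) atTop (𝓝 0)

/-- The partial derivative `∂_i f`. -/
def pderiv {d : ℕ} (i : Fin d) (f : (Fin d → ℝ) → ℝ) (x : Fin d → ℝ) : ℝ :=
  fderiv ℝ f x (Pi.single i 1)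

end

end TwoParam

/-! For `α = 1/2` the masses of the blocks of a finite partition have an explicit joint density.
With `n` blocks of base masses `p_k` it is proportional to `∏ x_k^(-3/2) * (∑ p_k²/x_k)^(-b)`, where
`b = θ + n/2`. Stick breaking proves this: removing the first stick replaces `θ` by `θ + 1/2`, so
the laws of the block masses satisfy a recursion in `θ`. The densities satisfy the same recursion,
by a beta integral (`lintegral_finLaw_recursion`), and its solution is unique because the mass left
after `N` sticks has mean of order `1/N` (`eq_of_stickStep`). Ranking the weights changes nothing,
since the atoms are i.i.d. (`map_blockVec`).

Integrating by parts against this density along the rows `x_i (δ_ij - x_j)` of the diffusion matrix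
produces the drift `-1/2 - θ x_i + S_i`, where `S_i = b (p_i²/x_i) / ∑ p_k²/x_k`
(`integral_law_parts`).

The remaining question is what happens to `S_i` when the blocks are the first `d` points and the
tail, and `d → ∞`. For a function of the first `D` masses, one side of the integration by parts does
not depend on the number `N ≥ D` of points that are singled out, so `S_i` is a martingale in `N`
(`condExp_scaledShare_sub`). It is bounded in `L²`: weighting the density with a power of a share
gives the density for a larger `θ`, times an inverse power of a single block mass, and that inverse
moment can be bounded in a partition into two blocks (`inverseMoment_le`). Hence `S_i` converges in
`L²`. The quotient of the theorem differs from `2 S_i` by `O(1/d)` in `L²`, by fourth moments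
(`integral_driftRatio_sub_sq_le`), so that `B_i = 2 lim S_i`.

In the limit, `𝓔(F, G) = (-LF, G)` for all cylinder functions `G`, with an explicit `LF` in `L²`
(`form_cyl_eq`). This identity gives closability, `𝓕 ⊂ D(L)` and the formula for the generator. -/

namespace TwoParam

noncomputable section

/-! ### A beta integral -/

theorem lintegral_Ioo_beta {a b : ℝ} (ha : 0 < a) (hb : 0 < b) :
    ∫⁻ t in Set.Ioo (0 : ℝ) 1, ENNReal.ofReal (t ^ (a - 1) * (1 - t) ^ (b - 1)) =
      ENNReal.ofReal (beta a b) := by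
  have h := lintegral_betaPDF_eq_one ha hb
  rw [lintegral_betaPDF] at h
  have hB := beta_pos ha hb
  have : ∀ t : ℝ, ENNReal.ofReal (1 / beta a b * t ^ (a - 1) * (1 - t) ^ (b - 1)) =
      ENNReal.ofReal (1 / beta a b) * ENNReal.ofReal (t ^ (a - 1) * (1 - t) ^ (b - 1)) := by
    intro t
    rw [mul_assoc, ENNReal.ofReal_mul (by positivity)]
  simp_rw [this] at h
  rw [lintegral_const_mul _ (by fun_prop)] at h
  calc _ = ENNReal.ofReal (beta a b) * (ENNReal.ofReal (1 / beta a b) * _) := by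
        rw [← mul_assoc, ← ENNReal.ofReal_mul hB.le, mul_one_div_cancel hB.ne', ENNReal.ofReal_one,
          one_mul]
    _ = _ := by rw [h, mul_one]

/-- The pull-back of the beta density in `lintegral_mobius` comes down to this identity between
powers. Writing each variable as an exponential leaves a polynomial identity between exponents. -/
theorem mobius_density_identity {u v D G p x b : ℝ} (hu : 0 < u) (hv : 0 < v) (hD : 0 < D)
    (hG : 0 < G) (hp : 0 < p) (hx : 0 < x) :
    p ^ 2 * G / D ^ 2 * ((p ^ 2 * u / (x * D)) ^ ((1 : ℝ) / 2 - 1) * (v * G / D) ^ (b - 1)) =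
      x ^ ((1 : ℝ) / 2) * p * G ^ b *
        (u ^ (-(1 : ℝ) / 2) * v ^ (-(3 : ℝ) / 2) * (D / v) ^ (-(b + 1 / 2))) := by
  obtain ⟨u, rfl⟩ : ∃ w, u = Real.exp w := ⟨_, (Real.exp_log hu).symm⟩
  obtain ⟨v, rfl⟩ : ∃ w, v = Real.exp w := ⟨_, (Real.exp_log hv).symm⟩
  obtain ⟨D, rfl⟩ : ∃ w, D = Real.exp w := ⟨_, (Real.exp_log hD).symm⟩
  obtain ⟨G, rfl⟩ : ∃ w, G = Real.exp w := ⟨_, (Real.exp_log hG).symm⟩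
  obtain ⟨p, rfl⟩ : ∃ w, p = Real.exp w := ⟨_, (Real.exp_log hp).symm⟩
  obtain ⟨x, rfl⟩ : ∃ w, x = Real.exp w := ⟨_, (Real.exp_log hx).symm⟩
  simp only [sq, ← Real.exp_add, ← Real.exp_sub, ← Real.exp_mul]
  congr 1
  ring

/-- This integral arises when the first stick, of length `u`, falls into a block of final mass `x`;
`A` stands for the sum of `p_j² / x_j` over the other blocks. The Möbius map `f` of `(0, x)` onto
`(0, 1)` turns the integrand into a `Beta(1/2, b)` density, up to a constant. -/
theorem lintegral_mobius {x A p b : ℝ} (hx : 0 < x) (hA : 0 ≤ A) (hp : 0 < p) (hb : 0 < b) :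
    ∫⁻ u in Set.Ioo (0 : ℝ) x, ENNReal.ofReal
        (u ^ (-(1 : ℝ) / 2) * (x - u) ^ (-(3 : ℝ) / 2) * (A + p ^ 2 / (x - u)) ^ (-(b + 1 / 2))) =
      ENNReal.ofReal (x ^ (-(1 : ℝ) / 2) * p⁻¹ * (A + p ^ 2 / x) ^ (-b) * beta (1 / 2) b) := by
  set G : ℝ := A + p ^ 2 / x with hGdef
  have hG : 0 < G := by positivity
  set f : ℝ → ℝ := fun u => p ^ 2 * u / (x * (A * (x - u) + p ^ 2)) with hf
  set f' : ℝ → ℝ := fun u => p ^ 2 * G / (A * (x - u) + p ^ 2) ^ 2 with hf'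
  have hD : ∀ u ∈ Set.Ioo (0 : ℝ) x, 0 < A * (x - u) + p ^ 2 := fun u hu => by
    have := mul_nonneg hA (sub_nonneg.2 hu.2.le)
    positivity
  have hsub : ∀ u ∈ Set.Ioo (0 : ℝ) x, 1 - f u = (x - u) * G / (A * (x - u) + p ^ 2) := by
    intro u hu
    have := hD u hu
    simp only [hf, hGdef]
    field_simp
    ring
  have hder : ∀ u ∈ Set.Ioo (0 : ℝ) x, HasDerivAt f (f' u) u := by
    intro u hu
    have h0 := hD u hu
    have h1 : HasDerivAt (fun u : ℝ => p ^ 2 * u) (p ^ 2) u := by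
      simpa using (hasDerivAt_id u).const_mul (p ^ 2)
    have h2 : HasDerivAt (fun u : ℝ => x * (A * (x - u) + p ^ 2)) (x * (A * (-1))) u :=
      ((((hasDerivAt_id u).const_sub x).const_mul A).add_const (p ^ 2)).const_mul x
    convert! h1.div h2 (by positivity) using 1
    simp only [hf', hGdef]
    field_simp
    ring
  have hinj : Set.InjOn f (Set.Ioo 0 x) := by
    intro u hu w hw h
    have h1 := hD u hu
    have h2 := hD w hw
    simp only [hf] at h
    rw [div_eq_div_iff (by positivity) (by positivity)] at h
    have : p ^ 2 * x * (A * x + p ^ 2) * (u - w) = 0 := by linear_combination h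
    have h3 : p ^ 2 * x * (A * x + p ^ 2) ≠ 0 := by positivity
    rcases mul_eq_zero.1 this with h | h
    · exact absurd h h3
    · linarith
  have himg : f '' Set.Ioo 0 x = Set.Ioo 0 1 := by
    ext t
    constructor
    · rintro ⟨u, hu, rfl⟩
      have h0 := hD u hu
      have hu0 := hu.1
      refine ⟨by simp only [hf]; positivity, ?_⟩
      have : 0 < 1 - f u := by
        rw [hsub u hu]
        have := sub_pos.2 hu.2
        positivity
      linarith
    · rintro ⟨h0, h1⟩
      have hE : 0 < p ^ 2 + t * x * A := by positivity
      have hxu : x - t * x * (A * x + p ^ 2) / (p ^ 2 + t * x * A) =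
          x * p ^ 2 * (1 - t) / (p ^ 2 + t * x * A) := by
        field_simp
        ring
      -- The preimage is found by solving `f u = t`, which is linear in `u`.
      refine ⟨t * x * (A * x + p ^ 2) / (p ^ 2 + t * x * A), ⟨by positivity, ?_⟩, ?_⟩
      · have := sub_pos.2 h1
        have : 0 < x * p ^ 2 * (1 - t) / (p ^ 2 + t * x * A) := by positivity
        linarith
      · simp only [hf]
        rw [hxu]
        have h2 : 0 < 1 - t := sub_pos.2 h1
        have h3 : A * (x * p ^ 2 * (1 - t) / (p ^ 2 + t * x * A)) + p ^ 2 =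
          p ^ 2 * (A * x + p ^ 2) / (p ^ 2 + t * x * A) := by field_simp; ring
        rw [h3]
        field_simp
  have key := lintegral_image_eq_lintegral_abs_deriv_mul measurableSet_Ioo
    (fun u hu => (hder u hu).hasDerivWithinAt) hinj
    (fun t => ENNReal.ofReal (t ^ ((1 : ℝ) / 2 - 1) * (1 - t) ^ (b - 1)))
  rw [himg, lintegral_Ioo_beta (by norm_num) hb] at key
  have hK : 0 < x ^ ((1 : ℝ) / 2) * p * G ^ b := by positivity
  have hcongr : ∫⁻ u in Set.Ioo (0 : ℝ) x, ENNReal.ofReal |f' u| *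
      ENNReal.ofReal (f u ^ ((1 : ℝ) / 2 - 1) * (1 - f u) ^ (b - 1)) =
      ∫⁻ u in Set.Ioo (0 : ℝ) x, ENNReal.ofReal (x ^ ((1 : ℝ) / 2) * p * G ^ b) * ENNReal.ofReal
        (u ^ (-(1 : ℝ) / 2) * (x - u) ^ (-(3 : ℝ) / 2) *
          (A + p ^ 2 / (x - u)) ^ (-(b + 1 / 2))) := by
    refine setLIntegral_congr_fun measurableSet_Ioo fun u hu => ?_
    have h0 := hD u hu
    have hv := sub_pos.2 hu.2
    have h1 : 0 < f' u := by simp only [hf']; positivity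
    rw [abs_of_pos h1, ← ENNReal.ofReal_mul h1.le, ← ENNReal.ofReal_mul hK.le, hsub u hu]
    congr 1
    have h2 : A + p ^ 2 / (x - u) = (A * (x - u) + p ^ 2) / (x - u) := by field_simp
    rw [h2]
    exact mobius_density_identity hu.1 hv h0 hG hp hx
  rw [hcongr, lintegral_const_mul _ (by fun_prop)] at key
  calc _ = ENNReal.ofReal ((x ^ ((1 : ℝ) / 2) * p * G ^ b)⁻¹) *
        (ENNReal.ofReal (x ^ ((1 : ℝ) / 2) * p * G ^ b) * _) := by
        rw [← mul_assoc, ← ENNReal.ofReal_mul (by positivity), inv_mul_cancel₀ hK.ne',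
          ENNReal.ofReal_one, one_mul]
    _ = _ := by
        rw [← key, ← ENNReal.ofReal_mul (by positivity)]
        congr 2
        rw [mul_inv, mul_inv, ← Real.rpow_neg hx.le, ← Real.rpow_neg hG.le]
        norm_num

end

end TwoParam

namespace TwoParam

noncomputable section

/-! ### The finite-dimensional densities

A point of the simplex with vertex set `Option ι` is recorded by its coordinates `x : ι → ℝ`; the
coordinate at `none` is `1 - ∑ i, x i`. -/

section Simplex

variable {ι : Type*} [Fintype ι]

/-- All coordinates of a point of the hyperplane `∑ = 1`. -/
def full (x : ι → ℝ) : Option ι → ℝ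
  | none => 1 - ∑ i, x i
  | some i => x i

/-- The vertices of the simplex. -/
def vertex [DecidableEq ι] (k : Option ι) : ι → ℝ := fun i => if k = some i then 1 else 0

/-- The open simplex. -/
def simplex (ι : Type*) [Fintype ι] : Set (ι → ℝ) := {x | ∀ k, 0 < full x k}

/-- The sum `∑ p_k² / x_k`. -/
def sig (p : Option ι → ℝ) (x : ι → ℝ) : ℝ := ∑ k, p k ^ 2 / full x k

open Classical in
/-- The unnormalised density of the finite-dimensional distributions. -/
def dens (p : Option ι → ℝ) (b : ℝ) (x : ι → ℝ) : ℝ :=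
  if x ∈ simplex ι then (∏ k, full x k ^ (-(3 : ℝ) / 2)) * sig p x ^ (-b) else 0

theorem sum_full (x : ι → ℝ) : ∑ k, full x k = 1 := by
  simp [Fintype.sum_option, full]

theorem full_combo [DecidableEq ι] (u : ℝ) (k : Option ι) (y : ι → ℝ) (j : Option ι) :
    full (u • vertex k + (1 - u) • y) j = u * (if j = k then 1 else 0) + (1 - u) * full y j := by
  cases j with
  | some i => simp [full, vertex, eq_comm]
  | none =>
    have : ∑ i, vertex k i = if none = k then 0 else 1 := by
      cases k <;> simp [vertex]
    simp only [full, Pi.add_apply, Pi.smul_apply, smul_eq_mul, Finset.sum_add_distrib,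
      ← Finset.mul_sum, this]
    split_ifs <;> ring

@[fun_prop]
theorem continuous_full (k : Option ι) : Continuous fun x : ι → ℝ => full x k := by
  cases k with
  | none => simp only [full]; fun_prop
  | some i => simp only [full]; fun_prop

theorem isOpen_simplex : IsOpen (simplex ι) := by
  simp only [simplex, Set.ofPred_forall]
  exact isOpen_iInter_of_finite fun k => isOpen_lt continuous_const (continuous_full k)

theorem full_le_one {x : ι → ℝ} (hx : x ∈ simplex ι) (k : Option ι) : full x k ≤ 1 := by
  rw [← sum_full x]
  exact Finset.single_le_sum (fun j _ => (hx j).le) (Finset.mem_univ k)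

theorem sig_pos {p : Option ι → ℝ} (hp : ∀ k, 0 < p k) {x : ι → ℝ} (hx : x ∈ simplex ι) :
    0 < sig p x :=
  Finset.sum_pos (fun k _ => div_pos (pow_pos (hp k) 2) (hx k)) ⟨none, Finset.mem_univ _⟩

theorem dens_pos {p : Option ι → ℝ} (hp : ∀ k, 0 < p k) (b : ℝ) {x : ι → ℝ}
    (hx : x ∈ simplex ι) : 0 < dens p b x := by
  rw [dens, if_pos hx]
  exact mul_pos (Finset.prod_pos fun k _ => Real.rpow_pos_of_pos (hx k) _)
    (Real.rpow_pos_of_pos (sig_pos hp hx) _)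

theorem dens_nonneg {p : Option ι → ℝ} (hp : ∀ k, 0 < p k) (b : ℝ) (x : ι → ℝ) :
    0 ≤ dens p b x := by
  by_cases hx : x ∈ simplex ι
  · exact (dens_pos hp b hx).le
  · rw [dens, if_neg hx]

@[fun_prop]
theorem measurable_sig (p : Option ι → ℝ) : Measurable (sig p) := by
  unfold sig
  exact Finset.measurable_fun_sum _ fun k _ => by fun_prop

@[fun_prop]
theorem measurable_dens (p : Option ι → ℝ) (b : ℝ) : Measurable (dens p b) := by
  classical
  unfold dens
  refine Measurable.ite isOpen_simplex.measurableSet (Measurable.mul ?_ ?_) measurable_const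
  · exact Finset.measurable_fun_prod _ fun k _ => by fun_prop
  · fun_prop

theorem lintegral_comp_affine (r : ℝ) (hr : 0 < r) (w : ι → ℝ) {F : (ι → ℝ) → ℝ≥0∞}
    (hF : Measurable F) :
    ∫⁻ y, F (w + r • y) = ENNReal.ofReal (r ^ (-(Fintype.card ι : ℝ))) * ∫⁻ x, F x := by
  have h1 : ∫⁻ y, F (w + r • y) = ∫⁻ z, F (w + z) ∂(Measure.map (r • ·) volume) := by
    rw [lintegral_map (f := fun z => F (w + z)) (hF.comp (measurable_const_add w))
      (measurable_const_smul r)]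
  rw [h1, Measure.map_addHaar_smul _ hr.ne', lintegral_smul_measure, lintegral_add_left_eq_self]
  rw [abs_of_pos (by positivity), Module.finrank_fintype_fun_eq_card, Real.rpow_neg hr.le,
    Real.rpow_natCast, smul_eq_mul]

/-! ### The density under one step of stick breaking -/

variable [DecidableEq ι]

theorem full_shift {u : ℝ} (hu : u ≠ 1) (k : Option ι) (x : ι → ℝ) (j : Option ι) :
    full ((1 - u)⁻¹ • (x - u • vertex k)) j = (full x j - u * (if j = k then 1 else 0)) / (1 - u) := by
  have h1 : 1 - u ≠ 0 := sub_ne_zero.2 hu.symm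
  have h := full_combo u k ((1 - u)⁻¹ • (x - u • vertex k)) j
  rw [smul_inv_smul₀ h1, add_sub_cancel] at h
  rw [h]
  field_simp
  ring

theorem prod_option_ite {g : Option ι → ℝ} (k : Option ι) (a : ℝ) :
    ∏ j, (if j = k then a else g j) = a * ∏ j ∈ Finset.univ.erase k, g j := by
  rw [← Finset.mul_prod_erase _ _ (Finset.mem_univ k), if_pos rfl]
  congr 1
  exact Finset.prod_congr rfl fun j hj => if_neg (Finset.ne_of_mem_erase hj)

/-- The argument of `dens` is the point `y` with `x = u v_k + (1 - u) y`. Rescaling gives a power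
`3/2` of `1 - u` for each of the `card ι + 1` coordinates and `-(b + 1/2)` from `sig`; apart from
that only the coordinate `k` changes. -/
theorem dens_shift {p : Option ι → ℝ} (hp : ∀ k, 0 < p k) (b : ℝ) (k : Option ι) {x : ι → ℝ}
    (hx : x ∈ simplex ι) {u : ℝ} (hu : u ∈ Set.Ioo 0 (full x k)) :
    dens p (b + 1 / 2) ((1 - u)⁻¹ • (x - u • vertex k)) =
      (1 - u) ^ (3 / 2 * ((Fintype.card ι : ℝ) + 1) - (b + 1 / 2)) *
        (∏ j ∈ Finset.univ.erase k, full x j ^ (-(3 : ℝ) / 2)) *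
        ((full x k - u) ^ (-(3 : ℝ) / 2) *
          ((∑ j ∈ Finset.univ.erase k, p j ^ 2 / full x j) + p k ^ 2 / (full x k - u)) ^
            (-(b + 1 / 2))) := by
  have hu1 : u < 1 := hu.2.trans_le (full_le_one hx k)
  have h1 : 0 < 1 - u := sub_pos.2 hu1
  have hk : 0 < full x k - u := sub_pos.2 hu.2
  have hfull : ∀ j, full ((1 - u)⁻¹ • (x - u • vertex k)) j =
      if j = k then (full x k - u) / (1 - u) else full x j / (1 - u) := by
    intro j
    rw [full_shift hu1.ne]
    split_ifs with h
    · rw [h, mul_one]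
    · rw [mul_zero, sub_zero]
  have hmem : (1 - u)⁻¹ • (x - u • vertex k) ∈ simplex ι := by
    intro j
    rw [hfull]
    split_ifs
    · positivity
    · exact div_pos (hx j) h1
  have hA : 0 ≤ ∑ j ∈ Finset.univ.erase k, p j ^ 2 / full x j :=
    Finset.sum_nonneg fun j _ => by have := hx j; positivity
  have hpk := hp k
  have hsig : sig p ((1 - u)⁻¹ • (x - u • vertex k)) = (1 - u) *
      ((∑ j ∈ Finset.univ.erase k, p j ^ 2 / full x j) + p k ^ 2 / (full x k - u)) := by
    rw [sig, ← Finset.add_sum_erase _ _ (Finset.mem_univ k), hfull k, if_pos rfl, mul_add,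
      add_comm, Finset.mul_sum]
    congr 1
    · refine Finset.sum_congr rfl fun j hj => ?_
      rw [hfull, if_neg (Finset.ne_of_mem_erase hj)]
      have := hx j
      field_simp
    · field_simp
  have hprod : ∏ j, full ((1 - u)⁻¹ • (x - u • vertex k)) j ^ (-(3 : ℝ) / 2) =
      (1 - u) ^ (3 / 2 * ((Fintype.card ι : ℝ) + 1)) *
        ((full x k - u) ^ (-(3 : ℝ) / 2) *
          ∏ j ∈ Finset.univ.erase k, full x j ^ (-(3 : ℝ) / 2)) := by
    have : ∀ j, full ((1 - u)⁻¹ • (x - u • vertex k)) j ^ (-(3 : ℝ) / 2) =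
        (1 - u) ^ ((3 : ℝ) / 2) *
          if j = k then (full x k - u) ^ (-(3 : ℝ) / 2) else full x j ^ (-(3 : ℝ) / 2) := by
      intro j
      rw [hfull]
      have e : (1 - u) ^ ((3 : ℝ) / 2) = ((1 - u) ^ (-(3 : ℝ) / 2))⁻¹ := by
        rw [← Real.rpow_neg h1.le]; norm_num
      rw [e]
      split_ifs
      · rw [Real.div_rpow hk.le h1.le, div_eq_inv_mul]
      · rw [Real.div_rpow (hx j).le h1.le, div_eq_inv_mul]
    simp_rw [this]
    rw [Finset.prod_mul_distrib, prod_option_ite]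
    congr 1
    rw [Finset.prod_const, Finset.card_univ, Fintype.card_option, ← Real.rpow_natCast,
      ← Real.rpow_mul h1.le]
    push_cast
    ring_nf
  have hq : 0 < (∑ j ∈ Finset.univ.erase k, p j ^ 2 / full x j) + p k ^ 2 / (full x k - u) := by
    positivity
  rw [dens, if_pos hmem, hprod, hsig, Real.mul_rpow h1.le hq.le, sub_eq_add_neg (3 / 2 * _),
    Real.rpow_add h1]
  ring

theorem dens_shift_eq_zero (p : Option ι → ℝ) (b : ℝ) (k : Option ι) {x : ι → ℝ} {u : ℝ}
    (hu : u ∈ Set.Ioo 0 1) (h : ¬ (x ∈ simplex ι ∧ u < full x k)) :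
    dens p b ((1 - u)⁻¹ • (x - u • vertex k)) = 0 := by
  rw [dens, if_neg]
  intro hmem
  have h1 : 0 < 1 - u := sub_pos.2 hu.2
  have hj : ∀ j, 0 < full x j - u * (if j = k then 1 else 0) := by
    intro j
    have := hmem j
    rw [full_shift hu.2.ne] at this
    exact (div_pos_iff_of_pos_right h1).1 this
  refine h ⟨fun j => ?_, ?_⟩
  · have := hj j
    split_ifs at this <;> linarith [hu.1]
  · have := hj k
    rw [if_pos rfl] at this
    linarith

/-- Up to normalisation, this is the density at `x` of `U v_k + (1 - U) Y`; the factor `(1 - u) ^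
(-card ι)` is the Jacobian of `y ↦ x`. The power `x_k^(-1/2)` left by `lintegral_mobius` is `x_k *
x_k^(-3/2)`, so `dens p b` comes back, size-biased by `x_k`. -/
theorem lintegral_beta_dens_shift {p : Option ι → ℝ} (hp : ∀ k, 0 < p k) {b c : ℝ} (hb : 0 < b)
    (hc : 0 < c) (hbc : b = c + Fintype.card ι / 2) (k : Option ι) (x : ι → ℝ) :
    ∫⁻ u, betaPDF (1 / 2) c u * (ENNReal.ofReal ((1 - u) ^ (-(Fintype.card ι : ℝ))) *
        ENNReal.ofReal (dens p (b + 1 / 2) ((1 - u)⁻¹ • (x - u • vertex k)))) =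
      ENNReal.ofReal (beta (1 / 2) b / beta (1 / 2) c * (p k)⁻¹ * (full x k * dens p b x)) := by
  have hB : 0 < beta (1 / 2) c := beta_pos (by norm_num) hc
  by_cases hx : x ∈ simplex ι
  · have hxk := hx k
    set A := ∑ j ∈ Finset.univ.erase k, p j ^ 2 / full x j with hAdef
    have hA : 0 ≤ A := Finset.sum_nonneg fun j _ => by have := hx j; positivity
    set Q := ∏ j ∈ Finset.univ.erase k, full x j ^ (-(3 : ℝ) / 2) with hQdef
    have hQ : 0 < Q := Finset.prod_pos fun j _ => Real.rpow_pos_of_pos (hx j) _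
    have hint : ∀ u, betaPDF (1 / 2) c u * (ENNReal.ofReal ((1 - u) ^ (-(Fintype.card ι : ℝ))) *
        ENNReal.ofReal (dens p (b + 1 / 2) ((1 - u)⁻¹ • (x - u • vertex k)))) =
        (Set.Ioo 0 (full x k)).indicator (fun u => ENNReal.ofReal ((beta (1 / 2) c)⁻¹ * Q) *
          ENNReal.ofReal (u ^ (-(1 : ℝ) / 2) * (full x k - u) ^ (-(3 : ℝ) / 2) *
            (A + p k ^ 2 / (full x k - u)) ^ (-(b + 1 / 2)))) u := by
      intro u
      by_cases hu : u ∈ Set.Ioo 0 (full x k)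
      · have hu1 : u < 1 := hu.2.trans_le (full_le_one hx k)
        have h1 : 0 < 1 - u := sub_pos.2 hu1
        have hk : 0 < full x k - u := sub_pos.2 hu.2
        have hu0 := hu.1
        have hpk := hp k
        rw [Set.indicator_of_mem hu, betaPDF_of_pos_lt_one hu.1 hu1, dens_shift hp b k hx hu,
          ← ENNReal.ofReal_mul (by positivity), ← ENNReal.ofReal_mul (by positivity),
          ← ENNReal.ofReal_mul (by positivity)]
        congr 1
        -- The powers of `1 - u` from the beta density, the Jacobian and the scaling of `dens`
        -- cancel exactly when `b = c + card ι / 2`.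
        have hcancel : (1 - u) ^ (c - 1) * ((1 - u) ^ (-(Fintype.card ι : ℝ)) *
            (1 - u) ^ (3 / 2 * ((Fintype.card ι : ℝ) + 1) - (b + 1 / 2))) = 1 := by
          rw [← Real.rpow_add h1, ← Real.rpow_add h1, hbc]
          ring_nf
          exact Real.rpow_zero _
        have hexp : (1 : ℝ) / 2 - 1 = -1 / 2 := by norm_num
        rw [hexp]
        simp only [← hAdef, ← hQdef]
        rw [one_div (beta (1 / 2) c)]
        linear_combination ((beta (1 / 2) c)⁻¹ * Q * (u ^ (-(1 : ℝ) / 2) *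
          (full x k - u) ^ (-(3 : ℝ) / 2) * (A + p k ^ 2 / (full x k - u)) ^ (-(b + 1 / 2)))) *
          hcancel
      · rw [Set.indicator_of_notMem hu]
        by_cases hu' : u ∈ Set.Ioo 0 1
        · rw [dens_shift_eq_zero p _ k hu' fun h => hu ⟨hu'.1, h.2⟩]
          simp
        · rw [betaPDF_eq, if_neg (show ¬(0 < u ∧ u < 1) from hu')]
          simp
    simp_rw [hint]
    rw [lintegral_indicator measurableSet_Ioo, lintegral_const_mul _ (by fun_prop),
      lintegral_mobius hxk hA (hp k) hb, ← ENNReal.ofReal_mul (by positivity)]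
    congr 1
    rw [dens, if_pos hx, ← Finset.mul_prod_erase _ _ (Finset.mem_univ k), ← hQdef, sig,
      ← Finset.add_sum_erase _ _ (Finset.mem_univ k), ← hAdef, add_comm (p k ^ 2 / full x k)]
    have : full x k ^ (-(1 : ℝ) / 2) = full x k * full x k ^ (-(3 : ℝ) / 2) := by
      conv_rhs => enter [1]; rw [← Real.rpow_one (full x k)]
      rw [← Real.rpow_add hxk]
      norm_num
    rw [this]
    ring
  · have hint : ∀ u, betaPDF (1 / 2) c u * (ENNReal.ofReal ((1 - u) ^ (-(Fintype.card ι : ℝ))) *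
        ENNReal.ofReal (dens p (b + 1 / 2) ((1 - u)⁻¹ • (x - u • vertex k)))) = 0 := by
      intro u
      by_cases hu' : u ∈ Set.Ioo 0 1
      · rw [dens_shift_eq_zero p _ k hu' fun h => hx h.1]
        simp
      · rw [betaPDF_eq, if_neg (show ¬(0 < u ∧ u < 1) from hu')]
        simp
    simp_rw [hint]
    rw [dens, if_neg hx]
    simp

/-- A change of variables for fixed `u`, followed by Tonelli, leaves the integral over `u` at fixed
`x` computed in `lintegral_beta_dens_shift`. -/
theorem kernel_identity {p : Option ι → ℝ} (hp : ∀ k, 0 < p k) {b c : ℝ} (hb : 0 < b)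
    (hc : 0 < c) (hbc : b = c + Fintype.card ι / 2) (k : Option ι) {φ : (ι → ℝ) → ℝ≥0∞}
    (hφ : Measurable φ) :
    ∫⁻ u, (∫⁻ y, φ (u • vertex k + (1 - u) • y) * ENNReal.ofReal (dens p (b + 1 / 2) y))
        ∂betaMeasure (1 / 2) c =
      ∫⁻ x, φ x * ENNReal.ofReal
        (beta (1 / 2) b / beta (1 / 2) c * (p k)⁻¹ * (full x k * dens p b x)) := by
  have hmeas : Measurable fun q : ℝ × (ι → ℝ) =>
      φ (q.1 • vertex k + (1 - q.1) • q.2) * ENNReal.ofReal (dens p (b + 1 / 2) q.2) := by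
    refine (hφ.comp ?_).mul ?_ <;> fun_prop
  have hmeas2 : Measurable fun q : ℝ × (ι → ℝ) =>
      dens p (b + 1 / 2) ((1 - q.1)⁻¹ • (q.2 - q.1 • vertex k)) :=
    (measurable_dens p _).comp (by fun_prop)
  have hbeta : Measurable (betaPDF (1 / 2) c) :=
    (measurable_betaPDFReal _ _).ennreal_ofReal
  rw [betaMeasure, lintegral_withDensity_eq_lintegral_mul _ hbeta hmeas.lintegral_prod_right']
  have hstep : ∀ u, (betaPDF (1 / 2) c * (fun u => ∫⁻ y, φ (u • vertex k + (1 - u) • y) *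
      ENNReal.ofReal (dens p (b + 1 / 2) y)) : ℝ → ℝ≥0∞) u =
      ∫⁻ x, φ x * (betaPDF (1 / 2) c u * (ENNReal.ofReal ((1 - u) ^ (-(Fintype.card ι : ℝ))) *
        ENNReal.ofReal (dens p (b + 1 / 2) ((1 - u)⁻¹ • (x - u • vertex k))))) := by
    intro u
    rw [Pi.mul_apply]
    by_cases hu : u ∈ Set.Ioo 0 1
    · have h1 : 0 < 1 - u := sub_pos.2 hu.2
      have hm : Measurable fun x => φ x *
          ENNReal.ofReal (dens p (b + 1 / 2) ((1 - u)⁻¹ • (x - u • vertex k))) :=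
        hφ.mul (hmeas2.comp (measurable_const.prodMk measurable_id)).ennreal_ofReal
      have h2 := lintegral_comp_affine (1 - u) h1 (u • vertex k) hm
      have h3 : ∀ y : ι → ℝ, (1 - u)⁻¹ • (u • vertex k + (1 - u) • y - u • vertex k) = y := by
        intro y
        rw [add_sub_cancel_left, inv_smul_smul₀ h1.ne']
      simp_rw [h3] at h2
      rw [h2, ← mul_assoc, ← lintegral_const_mul _ hm]
      refine lintegral_congr fun x => ?_
      ring
    · rw [betaPDF_eq, if_neg (show ¬(0 < u ∧ u < 1) from hu)]
      simp
  simp_rw [hstep]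
  rw [lintegral_lintegral_swap]
  · refine lintegral_congr fun x => ?_
    rw [← lintegral_beta_dens_shift hp hb hc hbc k x, lintegral_const_mul]
    have hm1 : Measurable fun u : ℝ => ENNReal.ofReal ((1 - u) ^ (-(Fintype.card ι : ℝ))) := by
      fun_prop
    refine hbeta.mul (hm1.mul ?_)
    exact (hmeas2.comp (measurable_id.prodMk measurable_const)).ennreal_ofReal
  · refine Measurable.aemeasurable ?_
    refine (hφ.comp measurable_snd).mul ((hbeta.comp measurable_fst).mul
      (Measurable.mul ?_ hmeas2.ennreal_ofReal))
    fun_prop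

end Simplex

end

end TwoParam

namespace TwoParam

noncomputable section

/-! ### The normalising constants and the finite-dimensional laws -/

section FiniteDim

variable {ι : Type*} [Fintype ι]

/-- The normalising constant of `dens`. -/
def normConst (p : Option ι → ℝ) (b : ℝ) : ℝ≥0∞ := ∫⁻ x, ENNReal.ofReal (dens p b x)

/-- The probability measure with density proportional to `dens`. -/
def finLaw (p : Option ι → ℝ) (b : ℝ) : Measure (ι → ℝ) :=
  (normConst p b)⁻¹ • volume.withDensity fun x => ENNReal.ofReal (dens p b x)

theorem lintegral_finLaw (p : Option ι → ℝ) (b : ℝ) {φ : (ι → ℝ) → ℝ≥0∞} (hφ : Measurable φ) :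
    ∫⁻ x, φ x ∂finLaw p b = (normConst p b)⁻¹ * ∫⁻ x, φ x * ENNReal.ofReal (dens p b x) := by
  rw [finLaw, lintegral_smul_measure, lintegral_withDensity_eq_lintegral_mul _ (by fun_prop) hφ,
    smul_eq_mul]
  congr 1
  exact lintegral_congr fun x => mul_comm _ _

theorem sum_ofReal_eq_one {p : Option ι → ℝ} (hp : ∀ k, 0 < p k) (hp1 : ∑ k, p k = 1) :
    ∑ k, ENNReal.ofReal (p k) = 1 := by
  rw [← ENNReal.ofReal_sum_of_nonneg fun k _ => (hp k).le, hp1, ENNReal.ofReal_one]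

/-- Choosing the vertex with probability `p k` cancels `(p k)⁻¹`, and the size-biasing factors `full
x k` add up to `1`. The mixture is therefore again of the form `dens`, with the exponent lowered by
`1/2`. -/
theorem kernel_identity_sum [DecidableEq ι] {p : Option ι → ℝ} (hp : ∀ k, 0 < p k) {b c : ℝ}
    (hb : 0 < b) (hc : 0 < c) (hbc : b = c + Fintype.card ι / 2) {φ : (ι → ℝ) → ℝ≥0∞}
    (hφ : Measurable φ) :
    ∑ k, ENNReal.ofReal (p k) *
      ∫⁻ u, (∫⁻ y, φ (u • vertex k + (1 - u) • y) * ENNReal.ofReal (dens p (b + 1 / 2) y))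
        ∂betaMeasure (1 / 2) c =
      ENNReal.ofReal (beta (1 / 2) b / beta (1 / 2) c) *
        ∫⁻ x, φ x * ENNReal.ofReal (dens p b x) := by
  have hK : 0 < beta (1 / 2) b / beta (1 / 2) c :=
    div_pos (beta_pos (by norm_num) hb) (beta_pos (by norm_num) hc)
  simp_rw [kernel_identity hp hb hc hbc _ hφ]
  have hm : ∀ k, Measurable fun x => φ x * ENNReal.ofReal
      (beta (1 / 2) b / beta (1 / 2) c * (p k)⁻¹ * (full x k * dens p b x)) :=
    fun k => hφ.mul (by fun_prop)
  simp_rw [← lintegral_const_mul _ (hm _)]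
  rw [← lintegral_finsetSum _ fun k _ => (hm k).const_mul _,
    ← lintegral_const_mul _ (f := fun x => φ x * ENNReal.ofReal (dens p b x))
      (hφ.mul (by fun_prop))]
  refine lintegral_congr fun x => ?_
  by_cases hx : x ∈ simplex ι
  · have hd := dens_pos hp b hx
    have : ∀ k, ENNReal.ofReal (p k) * (φ x * ENNReal.ofReal
        (beta (1 / 2) b / beta (1 / 2) c * (p k)⁻¹ * (full x k * dens p b x))) =
        φ x * ENNReal.ofReal (beta (1 / 2) b / beta (1 / 2) c * dens p b x * full x k) := by
      intro k
      have := hp k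
      rw [mul_left_comm, ← ENNReal.ofReal_mul this.le]
      congr 2
      field_simp
    simp_rw [this]
    rw [← Finset.mul_sum, ← ENNReal.ofReal_sum_of_nonneg fun k _ =>
      mul_nonneg (mul_nonneg hK.le hd.le) (hx k).le, ← Finset.mul_sum, sum_full, mul_one,
      ENNReal.ofReal_mul hK.le]
    ring
  · simp [dens, hx]

/-- The test function `1` in `kernel_identity_sum`. The identity lives in `ℝ≥0∞`, so it is available
before the constants are known to be finite. -/
theorem normConst_add_half {p : Option ι → ℝ} (hp : ∀ k, 0 < p k) (hp1 : ∑ k, p k = 1) {b c : ℝ}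
    (hb : 0 < b) (hc : 0 < c) (hbc : b = c + Fintype.card ι / 2) :
    normConst p (b + 1 / 2) =
      ENNReal.ofReal (beta (1 / 2) b / beta (1 / 2) c) * normConst p b := by
  classical
  have := isProbabilityMeasureBeta (α := 1 / 2) (β := c) (by norm_num) hc
  have h := kernel_identity_sum hp hb hc hbc (φ := fun _ => 1) measurable_const
  simp only [one_mul, lintegral_const, measure_univ, mul_one] at h
  rw [← Finset.sum_mul, sum_ofReal_eq_one hp hp1, one_mul] at h
  exact h

/-! ### Positivity and finiteness of the normalising constants -/

theorem normConst_ne_zero {p : Option ι → ℝ} (hp : ∀ k, 0 < p k) (b : ℝ) : normConst p b ≠ 0 := by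
  have hne : (simplex ι).Nonempty := by
    refine ⟨fun _ => ((Fintype.card ι : ℝ) + 1)⁻¹, fun k => ?_⟩
    cases k with
    | none =>
      simp only [full, Finset.sum_const, Finset.card_univ, nsmul_eq_mul]
      have : (1 : ℝ) - Fintype.card ι * ((Fintype.card ι : ℝ) + 1)⁻¹ =
        ((Fintype.card ι : ℝ) + 1)⁻¹ := by field_simp; ring
      rw [this]
      positivity
    | some i => simp only [full]; positivity
  intro h
  rw [normConst, lintegral_eq_zero_iff (by fun_prop)] at h
  have hz : volume (simplex ι) = 0 := by
    refine measure_mono_null (fun x hx => ?_) (ae_iff.1 h)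
    simpa using dens_pos hp b hx
  exact (isOpen_simplex.measure_pos volume hne).ne' hz

/-- Put `n = card ι + 1`, distribute `sig ^ (-b)` evenly over the `n` coordinates and use `sig ≥
p_k² / x_k` in each factor. The power `x_k^(b/n)` so gained beats the singularity `x_k^(-3/2)` once
`b ≥ 3n/2`. -/
theorem dens_le_of_large {p : Option ι → ℝ} (hp : ∀ k, 0 < p k) {b : ℝ}
    (hb : 3 / 2 * ((Fintype.card ι : ℝ) + 1) ≤ b) {x : ι → ℝ} (hx : x ∈ simplex ι) :
    dens p b x ≤ ∏ k, (p k ^ 2) ^ (-(b / ((Fintype.card ι : ℝ) + 1))) := by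
  set n : ℝ := (Fintype.card ι : ℝ) + 1 with hn
  have hn0 : 0 < n := by positivity
  have hs := sig_pos hp hx
  have hbn : 3 / 2 ≤ b / n := (le_div_iff₀ hn0).2 hb
  have h1 : sig p x ^ (-b) = ∏ _k : Option ι, sig p x ^ (-(b / n)) := by
    rw [Finset.prod_const, Finset.card_univ, Fintype.card_option, ← Real.rpow_natCast,
      ← Real.rpow_mul hs.le]
    congr 1
    push_cast
    rw [← hn]
    field_simp
  rw [dens, if_pos hx, h1, ← Finset.prod_mul_distrib]
  refine Finset.prod_le_prod (fun k _ => ?_) fun k _ => ?_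
  · have := hx k
    positivity
  · have hk := hx k
    have hpk := hp k
    have hle : p k ^ 2 / full x k ≤ sig p x :=
      Finset.single_le_sum (f := fun k => p k ^ 2 / full x k)
        (fun j _ => (div_pos (pow_pos (hp j) 2) (hx j)).le) (Finset.mem_univ k)
    have h2 : sig p x ^ (-(b / n)) ≤ (p k ^ 2 / full x k) ^ (-(b / n)) :=
      Real.rpow_le_rpow_of_nonpos (by positivity) hle (by linarith)
    calc full x k ^ (-(3 : ℝ) / 2) * sig p x ^ (-(b / n))
        ≤ full x k ^ (-(3 : ℝ) / 2) * (p k ^ 2 / full x k) ^ (-(b / n)) := by gcongr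
      _ = (p k ^ 2) ^ (-(b / n)) * full x k ^ (b / n - 3 / 2) := by
        rw [Real.div_rpow (by positivity) hk.le, Real.rpow_neg hk.le (b / n), div_inv_eq_mul,
          mul_left_comm, ← Real.rpow_add hk]
        congr 2
        ring
      _ ≤ (p k ^ 2) ^ (-(b / n)) * 1 := by
        gcongr
        exact Real.rpow_le_one hk.le (full_le_one hx k) (by linarith)
      _ = _ := mul_one _

theorem simplex_subset_Icc : simplex ι ⊆ Set.Icc 0 1 := fun _ hx =>
  ⟨fun i => (hx (some i)).le, fun i => full_le_one hx (some i)⟩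

theorem normConst_lt_top_of_large {p : Option ι → ℝ} (hp : ∀ k, 0 < p k) {b : ℝ}
    (hb : 3 / 2 * ((Fintype.card ι : ℝ) + 1) ≤ b) : normConst p b < ⊤ := by
  set C := ∏ k, (p k ^ 2) ^ (-(b / ((Fintype.card ι : ℝ) + 1)))
  calc normConst p b
      ≤ ∫⁻ x, (Set.Icc (0 : ι → ℝ) 1).indicator (fun _ => ENNReal.ofReal C) x := by
        refine lintegral_mono fun x => ?_
        by_cases hx : x ∈ simplex ι
        · rw [Set.indicator_of_mem (simplex_subset_Icc hx)]
          exact ENNReal.ofReal_le_ofReal (dens_le_of_large hp hb hx)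
        · simp [dens, hx]
    _ = ENNReal.ofReal C * volume (Set.Icc (0 : ι → ℝ) 1) :=
        lintegral_indicator_const measurableSet_Icc _
    _ < ⊤ := ENNReal.mul_lt_top ENNReal.ofReal_lt_top isCompact_Icc.measure_lt_top

/-- For large `b` the density is bounded with bounded support. Finiteness then descends in steps of
`1/2` through `normConst_add_half`, as long as `b` stays above `card ι / 2`. -/
theorem normConst_lt_top {p : Option ι → ℝ} (hp : ∀ k, 0 < p k) (hp1 : ∑ k, p k = 1) {b : ℝ}
    (hb : (Fintype.card ι : ℝ) / 2 < b) : normConst p b < ⊤ := by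
  suffices h : ∀ N : ℕ, ∀ b : ℝ, (Fintype.card ι : ℝ) / 2 < b →
      3 / 2 * ((Fintype.card ι : ℝ) + 1) ≤ b + N / 2 → normConst p b < ⊤ by
    obtain ⟨N, hN⟩ := exists_nat_ge (2 * (3 / 2 * ((Fintype.card ι : ℝ) + 1) - b))
    exact h N b hb (by linarith)
  intro N
  induction N with
  | zero => exact fun b _ h => normConst_lt_top_of_large hp (by simpa using h)
  | succ N ih =>
    intro b hb h
    have hb0 : 0 < b := lt_of_le_of_lt (by positivity) hb
    have hc : 0 < b - (Fintype.card ι : ℝ) / 2 := sub_pos.2 hb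
    have h1 := ih (b + 1 / 2) (by linarith) (by push_cast at h; linarith)
    rw [normConst_add_half hp hp1 hb0 hc (by ring)] at h1
    have hK := div_pos (beta_pos (α := 1 / 2) (by norm_num) hb0)
      (beta_pos (α := 1 / 2) (by norm_num) hc)
    exact ENNReal.lt_top_of_mul_ne_top_right h1.ne (ENNReal.ofReal_pos.2 hK).ne'

/-- Two half steps. The Gamma values cancel through `Γ(a + 1) = a Γ(a)`, and a rational factor
remains. -/
theorem normConst_add_one {p : Option ι → ℝ} (hp : ∀ k, 0 < p k) (hp1 : ∑ k, p k = 1) {b : ℝ}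
    (hb : (Fintype.card ι : ℝ) / 2 < b) :
    normConst p (b + 1) =
      ENNReal.ofReal ((b - (Fintype.card ι : ℝ) / 2) / b) * normConst p b := by
  have hb0 : 0 < b := lt_of_le_of_lt (by positivity) hb
  set c := b - (Fintype.card ι : ℝ) / 2 with hcdef
  have hc : 0 < c := sub_pos.2 hb
  have h : b + 1 = b + 1 / 2 + 1 / 2 := by ring
  rw [h, normConst_add_half hp hp1 (b := b + 1 / 2) (c := c + 1 / 2) (by positivity) (by positivity)
      (by rw [hcdef]; ring),
    normConst_add_half hp hp1 (b := b) (c := c) hb0 hc (by rw [hcdef]; ring), ← mul_assoc,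
    ← ENNReal.ofReal_mul]
  · congr 2
    have e1 : ∀ a : ℝ, 0 < a → beta (1 / 2) (a + 1 / 2) * beta (1 / 2) a =
        Real.Gamma (1 / 2) ^ 2 / a := by
      intro a ha
      have g1 := (Real.Gamma_pos_of_pos ha).ne'
      have g2 := (Real.Gamma_pos_of_pos (show 0 < a + 1 / 2 by positivity)).ne'
      have e : (1 : ℝ) / 2 + (a + 1 / 2) = a + 1 := by ring
      rw [beta, beta, e, Real.Gamma_add_one ha.ne', add_comm (1 / 2) a]
      field_simp
    have g := (Real.Gamma_pos_of_pos (show (0 : ℝ) < 1 / 2 by norm_num)).ne'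
    rw [div_mul_div_comm, e1 b hb0, e1 c hc]
    field_simp
  · exact (div_pos (beta_pos (by norm_num) (by positivity))
      (beta_pos (by norm_num) (by positivity))).le

theorem isProbabilityMeasure_finLaw {p : Option ι → ℝ} (hp : ∀ k, 0 < p k) (hp1 : ∑ k, p k = 1)
    {b : ℝ} (hb : (Fintype.card ι : ℝ) / 2 < b) : IsProbabilityMeasure (finLaw p b) where
  measure_univ := by
    rw [finLaw, Measure.smul_apply, withDensity_apply _ MeasurableSet.univ, Measure.restrict_univ,
      smul_eq_mul]
    exact ENNReal.inv_mul_cancel (normConst_ne_zero hp b) (normConst_lt_top hp hp1 hb).ne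

theorem finLaw_simplex (p : Option ι → ℝ) (b : ℝ) : ∀ᵐ x ∂finLaw p b, x ∈ simplex ι := by
  refine Measure.ae_smul_measure ?_ _
  rw [ae_withDensity_iff (by fun_prop)]
  refine Eventually.of_forall fun x hx => ?_
  by_contra h
  simp [dens, h] at hx

/-- The factor in `kernel_identity_sum` is exactly the quotient of the two normalising constants, so
the normalised laws satisfy the recursion without any constant. -/
theorem lintegral_finLaw_recursion [DecidableEq ι] {p : Option ι → ℝ} (hp : ∀ k, 0 < p k)
    (hp1 : ∑ k, p k = 1) {b c : ℝ} (hc : 0 < c) (hbc : b = c + Fintype.card ι / 2)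
    {φ : (ι → ℝ) → ℝ≥0∞} (hφ : Measurable φ) :
    ∫⁻ x, φ x ∂finLaw p b = ∑ k, ENNReal.ofReal (p k) *
      ∫⁻ u, (∫⁻ y, φ (u • vertex k + (1 - u) • y) ∂finLaw p (b + 1 / 2))
        ∂betaMeasure (1 / 2) c := by
  have hb : (Fintype.card ι : ℝ) / 2 < b := by linarith
  have hb0 : 0 < b := lt_of_le_of_lt (by positivity) hb
  have hK := ENNReal.ofReal_pos.2 (div_pos (beta_pos (α := 1 / 2) (by norm_num) hb0)
      (beta_pos (α := 1 / 2) (by norm_num) hc))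
  have h0 := normConst_ne_zero hp b
  have h1 := (normConst_lt_top hp hp1 hb).ne
  have hm : ∀ (u : ℝ) (k : Option ι), Measurable fun y => φ (u • vertex k + (1 - u) • y) :=
    fun u k => hφ.comp (by fun_prop)
  simp_rw [lintegral_finLaw _ _ hφ, lintegral_finLaw _ _ (hm _ _)]
  have hm2 : ∀ k : Option ι, Measurable fun u : ℝ => ∫⁻ y, φ (u • vertex k + (1 - u) • y) *
      ENNReal.ofReal (dens p (b + 1 / 2) y) := by
    intro k
    refine Measurable.lintegral_prod_right' (f := fun q : ℝ × (ι → ℝ) =>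
      φ (q.1 • vertex k + (1 - q.1) • q.2) * ENNReal.ofReal (dens p (b + 1 / 2) q.2)) ?_
    refine (hφ.comp ?_).mul ?_ <;> fun_prop
  simp_rw [lintegral_const_mul _ (hm2 _)]
  simp_rw [mul_left_comm _ (normConst p (b + 1 / 2))⁻¹]
  rw [← Finset.mul_sum, kernel_identity_sum hp hb0 hc hbc hφ, normConst_add_half hp hp1 hb0 hc hbc,
    ENNReal.mul_inv (Or.inl hK.ne') (Or.inl ENNReal.ofReal_ne_top), mul_mul_mul_comm,
    ENNReal.inv_mul_cancel hK.ne' ENNReal.ofReal_ne_top, one_mul]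

end FiniteDim

end

end TwoParam

namespace TwoParam

noncomputable section

/-! ### Splitting off the first term of an independent sequence -/

section Cons

variable {X : Type*} [MeasurableSpace X]

/-- The sequence `a, b 0, b 1, …`. -/
def consSeq (a : X) (b : ℕ → X) : ℕ → X
  | 0 => a
  | n + 1 => b n

theorem measurable_consSeq : Measurable fun q : X × (ℕ → X) => consSeq q.1 q.2 := by
  refine measurable_pi_iff.2 fun n => ?_
  cases n with
  | zero => exact measurable_fst
  | succ n => exact (measurable_pi_apply n).comp measurable_snd

theorem infinitePi_eq_map_consSeq (μ : ℕ → Measure X) [∀ n, IsProbabilityMeasure (μ n)] :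
    Measure.infinitePi μ = ((μ 0).prod (Measure.infinitePi fun n => μ (n + 1))).map
      fun q => consSeq q.1 q.2 := by
  classical
  refine (Measure.eq_infinitePi μ fun s t ht => ?_).symm
  obtain ⟨N, hN⟩ : ∃ N, s ⊆ Finset.range (N + 1) :=
    ⟨s.sup id, fun i hi => Finset.mem_range_succ_iff.2 (Finset.le_sup (f := id) hi)⟩
  -- A box over a finite set of indices is rewritten as a box over an initial segment, with `univ`
  -- as extra factors, so that the index `0` can be split off.
  set t' : ℕ → Set X := fun i => if i ∈ s then t i else Set.univ with ht'
  have hm : ∀ i, MeasurableSet (t' i) := by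
    intro i
    simp only [ht']
    split_ifs
    exacts [ht i, MeasurableSet.univ]
  have hset : (fun q : X × (ℕ → X) => consSeq q.1 q.2) ⁻¹' (Set.pi s t) =
      t' 0 ×ˢ Set.pi (Finset.range N) fun n => t' (n + 1) := by
    ext ⟨a, b⟩
    simp only [Set.mem_preimage, Set.mem_pi, Finset.mem_coe, Set.mem_prod, Finset.mem_range, ht']
    constructor
    · intro h
      refine ⟨?_, fun n _ => ?_⟩
      · split_ifs with h0
        exacts [h 0 h0, Set.mem_univ _]
      · split_ifs with h0
        exacts [h (n + 1) h0, Set.mem_univ _]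
    · rintro ⟨h0, h1⟩ i hi
      cases i with
      | zero => simpa [hi, consSeq] using h0
      | succ n =>
        have := h1 n (by have := Finset.mem_range.1 (hN hi); omega)
        simpa [hi, consSeq] using this
  rw [Measure.map_apply measurable_consSeq
    (MeasurableSet.pi s.countable_toSet fun i _ => ht i), hset, Measure.prod_prod,
    Measure.infinitePi_pi _ fun i _ => hm _, mul_comm,
    ← Finset.prod_range_succ' fun i => μ i (t' i), ← Finset.prod_subset hN]
  · refine Finset.prod_congr rfl fun i hi => ?_
    simp [ht', hi]
  · intro i _ hi
    simp [ht', hi]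

theorem lintegral_infinitePi_consSeq (μ : ℕ → Measure X) [∀ n, IsProbabilityMeasure (μ n)]
    {f : (ℕ → X) → ℝ≥0∞} (hf : Measurable f) :
    ∫⁻ x, f x ∂Measure.infinitePi μ =
      ∫⁻ a, ∫⁻ b, f (consSeq a b) ∂(Measure.infinitePi fun n => μ (n + 1)) ∂μ 0 := by
  conv_lhs => rw [infinitePi_eq_map_consSeq μ]
  rw [lintegral_map hf measurable_consSeq,
    lintegral_prod (fun q : X × (ℕ → X) => f (consSeq q.1 q.2))
      (hf.comp measurable_consSeq).aemeasurable]

end Cons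

/-! ### The stick-breaking weights -/

section Stick

theorem isProbabilityMeasure_stick {θ : ℝ} (hθ : -1 / 2 < θ) (k : ℕ) :
    IsProbabilityMeasure (betaMeasure (1 - 1 / 2) (θ + (k + 1) * (1 / 2))) := by
  refine isProbabilityMeasureBeta (by norm_num) ?_
  have : (0 : ℝ) ≤ k := k.cast_nonneg
  linarith

theorem isProbabilityMeasure_stickLaw {θ : ℝ} (hθ : -1 / 2 < θ) :
    IsProbabilityMeasure (stickLaw (1 / 2) θ) := by
  have := isProbabilityMeasure_stick hθ
  unfold stickLaw
  infer_instance

/-- After the first stick is removed, the parameters `θ + (k + 2)/2` are those of the stick-breaking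
sequence for `θ + 1/2`. -/
theorem lintegral_stickLaw {θ : ℝ} (hθ : -1 / 2 < θ) {f : (ℕ → ℝ) → ℝ≥0∞} (hf : Measurable f) :
    ∫⁻ u, f u ∂stickLaw (1 / 2) θ =
      ∫⁻ a, (∫⁻ b, f (consSeq a b) ∂stickLaw (1 / 2) (θ + 1 / 2))
        ∂betaMeasure (1 / 2) (θ + 1 / 2) := by
  have := isProbabilityMeasure_stick hθ
  have h1 := lintegral_infinitePi_consSeq
    (fun k : ℕ => betaMeasure (1 - 1 / 2) (θ + (k + 1) * (1 / 2))) hf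
  have e0 : betaMeasure (1 - 1 / 2) (θ + (((0 : ℕ) : ℝ) + 1) * (1 / 2)) =
      betaMeasure (1 / 2) (θ + 1 / 2) := by norm_num
  have e1 : ∀ n : ℕ, betaMeasure (1 - 1 / 2) (θ + (((n + 1 : ℕ) : ℝ) + 1) * (1 / 2)) =
      betaMeasure (1 - 1 / 2) (θ + 1 / 2 + ((n : ℝ) + 1) * (1 / 2)) := by
    intro n
    congr 1
    push_cast
    ring
  simp only [e0, e1] at h1
  exact h1

theorem ae_betaMeasure (a b : ℝ) : ∀ᵐ u ∂betaMeasure a b, u ∈ Set.Ioo (0 : ℝ) 1 := by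
  have hm : Measurable (betaPDF a b) := (measurable_betaPDFReal _ _).ennreal_ofReal
  rw [betaMeasure, ae_withDensity_iff hm]
  refine Eventually.of_forall fun u hu => ?_
  by_contra h
  rw [betaPDF_eq, if_neg (show ¬(0 < u ∧ u < 1) from h)] at hu
  simp at hu

theorem ae_stickLaw {θ : ℝ} (hθ : -1 / 2 < θ) :
    ∀ᵐ u ∂stickLaw (1 / 2) θ, ∀ k, u k ∈ Set.Ioo (0 : ℝ) 1 := by
  have := isProbabilityMeasure_stick hθ
  refine ae_all_iff.2 fun k => ?_
  have h := measurePreserving_eval_infinitePi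
    (fun k : ℕ => betaMeasure (1 - 1 / 2) (θ + (k + 1) * (1 / 2))) k
  exact h.quasiMeasurePreserving.ae (ae_betaMeasure _ _)

theorem lintegral_one_sub_beta {c : ℝ} (hc : 0 < c) :
    ∫⁻ u, ENNReal.ofReal (1 - u) ∂betaMeasure (1 / 2) c = ENNReal.ofReal (c / (c + 1 / 2)) := by
  have hm : ∀ c, Measurable (betaPDF (1 / 2) c) := fun c =>
    (measurable_betaPDFReal _ _).ennreal_ofReal
  have hB := beta_pos (α := 1 / 2) (by norm_num) hc
  have hB1 := beta_pos (α := 1 / 2) (β := c + 1) (by norm_num) (by positivity)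
  have hratio : beta (1 / 2) (c + 1) / beta (1 / 2) c = c / (c + 1 / 2) := by
    have g1 := (Real.Gamma_pos_of_pos hc).ne'
    have g2 := (Real.Gamma_pos_of_pos (show 0 < c + 1 / 2 by positivity)).ne'
    have g := (Real.Gamma_pos_of_pos (show (0 : ℝ) < 1 / 2 by norm_num)).ne'
    have e : (1 : ℝ) / 2 + (c + 1) = (c + 1 / 2) + 1 := by ring
    rw [beta, beta, e, Real.Gamma_add_one hc.ne', Real.Gamma_add_one (by positivity),
      add_comm (1 / 2) c]
    field_simp
  rw [betaMeasure, lintegral_withDensity_eq_lintegral_mul _ (hm c) (by fun_prop)]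
  have : ∀ u, (betaPDF (1 / 2) c * (fun u => ENNReal.ofReal (1 - u)) : ℝ → ℝ≥0∞) u =
      ENNReal.ofReal (c / (c + 1 / 2)) * betaPDF (1 / 2) (c + 1) u := by
    intro u
    rw [Pi.mul_apply]
    by_cases hu : 0 < u ∧ u < 1
    · have h1 : 0 < 1 - u := sub_pos.2 hu.2
      have h0 := hu.1
      rw [betaPDF_eq, betaPDF_eq, if_pos hu, if_pos hu, ← ENNReal.ofReal_mul (by positivity),
        ← ENNReal.ofReal_mul (by positivity), ← hratio]
      congr 1
      have : (1 - u) ^ (c + 1 - 1) = (1 - u) ^ (c - 1) * (1 - u) := by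
        rw [← Real.rpow_add_one h1.ne']
        ring_nf
      rw [this]
      field_simp
    · rw [betaPDF_eq, betaPDF_eq, if_neg hu, if_neg hu]
      simp
  simp_rw [this]
  rw [lintegral_const_mul _ (hm _), lintegral_betaPDF_eq_one (by norm_num) (by positivity), mul_one]

/-- With `c = θ + 1/2`, the first factor has mean `c / (c + 1/2)` and the remaining ones belong to
`c + 1/2`, so the product telescopes. -/
theorem lintegral_prod_one_sub {θ : ℝ} (hθ : -1 / 2 < θ) (N : ℕ) :
    ∫⁻ u, ∏ j ∈ Finset.range N, ENNReal.ofReal (1 - u j) ∂stickLaw (1 / 2) θ =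
      ENNReal.ofReal ((θ + 1 / 2) / (θ + 1 / 2 + N / 2)) := by
  induction N generalizing θ with
  | zero =>
    have := isProbabilityMeasure_stickLaw hθ
    have : θ + 1 / 2 ≠ 0 := by linarith
    simp only [Finset.range_zero, Finset.prod_empty, lintegral_const, measure_univ, mul_one,
      Nat.cast_zero, zero_div, add_zero, div_self this, ENNReal.ofReal_one]
  | succ N ih =>
    have hc : 0 < θ + 1 / 2 := by linarith
    rw [lintegral_stickLaw hθ (Finset.measurable_fun_prod _ fun j _ => by fun_prop)]
    have : ∀ a : ℝ, ∀ b : ℕ → ℝ, ∏ j ∈ Finset.range (N + 1), ENNReal.ofReal (1 - consSeq a b j) =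
        ENNReal.ofReal (1 - a) * ∏ j ∈ Finset.range N, ENNReal.ofReal (1 - b j) := by
      intro a b
      rw [Finset.prod_range_succ', mul_comm]
      rfl
    simp_rw [this]
    have hm : Measurable fun b : ℕ → ℝ => ∏ j ∈ Finset.range N, ENNReal.ofReal (1 - b j) :=
      Finset.measurable_fun_prod _ fun j _ => by fun_prop
    simp_rw [lintegral_const_mul _ hm]
    rw [lintegral_mul_const _ (by fun_prop), lintegral_one_sub_beta hc,
      ih (by linarith), ← ENNReal.ofReal_mul (by positivity)]
    congr 1
    push_cast
    rw [div_mul_div_cancel₀ (by positivity)]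
    ring_nf

/-- The products decrease and their means tend to `0`. This is what makes the weights sum to `1`
almost surely. -/
theorem ae_tendsto_prod_one_sub {θ : ℝ} (hθ : -1 / 2 < θ) :
    ∀ᵐ u ∂stickLaw (1 / 2) θ,
      Tendsto (fun N => ∏ j ∈ Finset.range N, (1 - u j)) atTop (𝓝 0) := by
  set g : ℕ → (ℕ → ℝ) → ℝ≥0∞ := fun N u => ∏ j ∈ Finset.range N, ENNReal.ofReal (1 - u j) with hg
  have hgm : ∀ N, Measurable (g N) := fun N =>
    Finset.measurable_fun_prod _ fun j _ => by fun_prop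
  have hinf : ∫⁻ u, ⨅ N, g N u ∂stickLaw (1 / 2) θ = 0 := by
    have hlim : Tendsto (fun N : ℕ => ENNReal.ofReal ((θ + 1 / 2) / (θ + 1 / 2 + N / 2))) atTop
        (𝓝 0) := by
      rw [← ENNReal.ofReal_zero]
      refine ENNReal.tendsto_ofReal (Tendsto.const_div_atTop ?_ _)
      exact tendsto_atTop_add_const_left _ _
        (tendsto_natCast_atTop_atTop.atTop_div_const (by norm_num))
    refine le_antisymm (ge_of_tendsto' hlim fun N => ?_) zero_le
    rw [← lintegral_prod_one_sub hθ]
    exact lintegral_mono fun u => iInf_le _ N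
  rw [lintegral_eq_zero_iff (Measurable.iInf hgm)] at hinf
  filter_upwards [hinf, ae_stickLaw hθ] with u hu h01
  have hanti : Antitone fun N => g N u := by
    refine antitone_nat_of_succ_le fun N => ?_
    simp only [hg, Finset.prod_range_succ]
    refine mul_le_of_le_one_right' ?_
    rw [← ENNReal.ofReal_one]
    exact ENNReal.ofReal_le_ofReal (by linarith [(h01 N).1])
  have h1 : Tendsto (fun N => g N u) atTop (𝓝 0) := by
    have := tendsto_atTop_iInf hanti
    rwa [show ⨅ N, g N u = 0 from hu] at this
  have h2 := (ENNReal.tendsto_toReal ENNReal.zero_ne_top).comp h1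
  rw [ENNReal.toReal_zero] at h2
  refine h2.congr fun N => ?_
  simp only [hg, Function.comp_apply, ENNReal.toReal_prod]
  exact Finset.prod_congr rfl fun j _ => ENNReal.toReal_ofReal (by linarith [(h01 j).2])

/-- The real stick-breaking weights. -/
def weight (u : ℕ → ℝ) (n : ℕ) : ℝ := (∏ j ∈ Finset.range n, (1 - u j)) * u n

theorem weight_pos {u : ℕ → ℝ} (hu : ∀ k, u k ∈ Set.Ioo (0 : ℝ) 1) (n : ℕ) : 0 < weight u n :=
  mul_pos (Finset.prod_pos fun j _ => sub_pos.2 (hu j).2) (hu n).1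

theorem sum_weight (u : ℕ → ℝ) (N : ℕ) :
    ∑ n ∈ Finset.range N, weight u n = 1 - ∏ j ∈ Finset.range N, (1 - u j) := by
  induction N with
  | zero => simp
  | succ N ih => rw [Finset.sum_range_succ, ih, Finset.prod_range_succ, weight]; ring

theorem hasSum_weight {u : ℕ → ℝ} (hu : ∀ k, u k ∈ Set.Ioo (0 : ℝ) 1)
    (h : Tendsto (fun N => ∏ j ∈ Finset.range N, (1 - u j)) atTop (𝓝 0)) :
    HasSum (weight u) 1 := by
  rw [hasSum_iff_tendsto_nat_of_nonneg fun n => (weight_pos hu n).le]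
  simp_rw [sum_weight]
  simpa using h.const_sub 1

theorem weight_consSeq_zero (a : ℝ) (b : ℕ → ℝ) : weight (consSeq a b) 0 = a := by
  simp [weight, consSeq]

theorem weight_consSeq_succ (a : ℝ) (b : ℕ → ℝ) (n : ℕ) :
    weight (consSeq a b) (n + 1) = (1 - a) * weight b n := by
  rw [weight, Finset.prod_range_succ', weight]
  simp only [consSeq]
  ring

end Stick

end

end TwoParam

namespace TwoParam

noncomputable section

/-! ### Uniqueness of the solution of the stick-breaking recursion -/

section Uniqueness

/-- The indicator of a closed set is the limit of its thickened indicators, which are Lipschitz. -/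
theorem ext_of_forall_lintegral_lipschitz {E : Type*} [PseudoEMetricSpace E] [MeasurableSpace E]
    [BorelSpace E] {μ ν : Measure E} [IsProbabilityMeasure μ] [IsProbabilityMeasure ν]
    (h : ∀ (φ : E → ℝ≥0∞) (K : ℝ≥0∞), K ≠ ⊤ → Measurable φ → (∀ x y, φ x ≤ φ y + K * edist x y) →
      ∫⁻ x, φ x ∂μ = ∫⁻ x, φ x ∂ν) : μ = ν := by
  have hclosed : ∀ F : Set E, IsClosed F → μ F = ν F := by
    intro F hF
    have hpos : ∀ n : ℕ, (0 : ℝ) < 1 / ((n : ℝ) + 1) := fun n => by positivity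
    have h1 := tendsto_lintegral_thickenedIndicator_of_isClosed μ hF hpos
      tendsto_one_div_add_atTop_nhds_zero_nat
    have h2 := tendsto_lintegral_thickenedIndicator_of_isClosed ν hF hpos
      tendsto_one_div_add_atTop_nhds_zero_nat
    refine tendsto_nhds_unique h1 (h2.congr fun n => (h _
      ((1 / ((n : ℝ) + 1)).toNNReal⁻¹ : NNReal) ENNReal.coe_ne_top
      (thickenedIndicator (hpos n) F).continuous.measurable.coe_nnreal_ennreal
      fun x y => ?_).symm)
    have hl := lipschitzWith_thickenedIndicator (hpos n) F x y
    refine le_trans ?_ (add_le_add_right hl _)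
    rw [edist_nndist, ← ENNReal.coe_add, ENNReal.coe_le_coe]
    have := NNReal.le_add_nndist (thickenedIndicator (hpos n) F x) (thickenedIndicator (hpos n) F y)
    exact this
  refine ext_of_generate_finite _ ?_ isPiSystem_isClosed (fun F hF => hclosed F hF) (by simp)
  rw [BorelSpace.measurable_eq (α := E), borel_eq_generateFrom_isClosed]

variable {ι : Type*} [Fintype ι] [DecidableEq ι]

/-- One step of stick breaking: `μ` is the law of `U v + (1 - U) Y`, where `U` is
`Beta(1/2, c)`, the vertex `v` has law `p`, and `Y` has law `μ'`. -/
def StickStep (p : Option ι → ℝ) (c : ℝ) (μ μ' : Measure (ι → ℝ)) : Prop :=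
  ∀ φ : (ι → ℝ) → ℝ≥0∞, Measurable φ → ∫⁻ x, φ x ∂μ = ∑ k, ENNReal.ofReal (p k) *
    ∫⁻ u, (∫⁻ y, φ (u • vertex k + (1 - u) • y) ∂μ') ∂betaMeasure (1 / 2) c

/-- A step with stick length `u` multiplies the Lipschitz constant by `1 - u`, and both sequences of
laws use the same sticks and vertices. After `N` steps the discrepancy is at most `K` times the mean
of `∏ (1 - U)`, a telescoping product. The induction starts from the fact that the unit cube has
diameter at most `1` in the sup metric. -/
theorem lintegral_le_of_stickStep {p : Option ι → ℝ} (hp : ∀ k, 0 < p k) (hp1 : ∑ k, p k = 1)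
    {c : ℝ} (hc : 0 < c) {ρ σ : ℕ → Measure (ι → ℝ)} [∀ N, IsProbabilityMeasure (ρ N)]
    [∀ N, IsProbabilityMeasure (σ N)] (hR : ∀ N, ∀ᵐ x ∂ρ N, x ∈ Set.Icc 0 1)
    (hS : ∀ N, ∀ᵐ x ∂σ N, x ∈ Set.Icc 0 1)
    (hRs : ∀ N : ℕ, StickStep p (c + N / 2) (ρ N) (ρ (N + 1)))
    (hSs : ∀ N : ℕ, StickStep p (c + N / 2) (σ N) (σ (N + 1))) (N : ℕ) :
    ∀ (k : ℕ) (φ : (ι → ℝ) → ℝ≥0∞) (K : ℝ≥0∞), Measurable φ →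
      (∀ x y, φ x ≤ φ y + K * edist x y) →
      ∫⁻ x, φ x ∂ρ k ≤ ∫⁻ x, φ x ∂σ k +
        K * ENNReal.ofReal ((c + k / 2) / (c + (k + N : ℕ) / 2)) := by
  induction N with
  | zero =>
    intro k φ K hφ hK
    have hck : c + (k : ℝ) / 2 ≠ 0 := by positivity
    rw [add_zero, div_self hck, ENNReal.ofReal_one, mul_one]
    have h1 : ∀ᵐ x ∂ρ k, φ x ≤ ∫⁻ y, φ y ∂σ k + K := by
      filter_upwards [hR k] with x hx
      calc φ x = ∫⁻ _, φ x ∂σ k := by simp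
        _ ≤ ∫⁻ y, (φ y + K) ∂σ k := by
          refine lintegral_mono_ae ?_
          filter_upwards [hS k] with y hy
          refine (hK x y).trans (add_le_add_right (mul_le_of_le_one_right' ?_) _)
          refine edist_pi_le_iff.2 fun i => ?_
          rw [edist_dist, ← ENNReal.ofReal_one]
          refine ENNReal.ofReal_le_ofReal ?_
          rw [Real.dist_eq, abs_le]
          have h1 := hx.1 i
          have h2 := hx.2 i
          have h3 := hy.1 i
          have h4 := hy.2 i
          simp only [Pi.zero_apply, Pi.one_apply] at h1 h2 h3 h4
          constructor <;> linarith
        _ = _ := by rw [lintegral_add_right _ measurable_const]; simp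
    calc ∫⁻ x, φ x ∂ρ k ≤ ∫⁻ _, (∫⁻ y, φ y ∂σ k + K) ∂ρ k := lintegral_mono_ae h1
      _ = _ := by simp
  | succ N ih =>
    intro k φ K hφ hK
    rw [hRs k φ hφ, hSs k φ hφ]
    set D := ENNReal.ofReal ((c + (k + 1 : ℕ) / 2) / (c + (k + 1 + N : ℕ) / 2)) with hD
    have hck : 0 < c + (k : ℝ) / 2 := by positivity
    have hstep : ∀ j : Option ι,
        ∫⁻ u, (∫⁻ y, φ (u • vertex j + (1 - u) • y) ∂ρ (k + 1)) ∂betaMeasure (1 / 2) (c + k / 2) ≤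
        ∫⁻ u, (∫⁻ y, φ (u • vertex j + (1 - u) • y) ∂σ (k + 1)) ∂betaMeasure (1 / 2) (c + k / 2) +
          K * ENNReal.ofReal ((c + k / 2) / (c + (k + (N + 1) : ℕ) / 2)) := by
      intro j
      calc _ ≤ ∫⁻ u, (∫⁻ y, φ (u • vertex j + (1 - u) • y) ∂σ (k + 1) +
            K * D * ENNReal.ofReal (1 - u)) ∂betaMeasure (1 / 2) (c + k / 2) := by
            refine lintegral_mono_ae ?_
            filter_upwards [ae_betaMeasure (1 / 2) (c + k / 2)] with u hu
            have := ih (k + 1) (fun y => φ (u • vertex j + (1 - u) • y))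
              (K * ENNReal.ofReal (1 - u)) (hφ.comp (by fun_prop)) fun x y => by
                have h1 : 0 ≤ 1 - u := by linarith [hu.2]
                have := hK (u • vertex j + (1 - u) • x) (u • vertex j + (1 - u) • y)
                rwa [edist_add_left, edist_smul₀, Real.nnnorm_of_nonneg h1, ENNReal.smul_def,
                  smul_eq_mul, ← ENNReal.ofReal_eq_coe_nnreal h1, ← mul_assoc] at this
            rw [mul_right_comm] at this
            exact this
        _ = _ := by
            rw [lintegral_add_right _ (by fun_prop), lintegral_const_mul _ (by fun_prop),
              lintegral_one_sub_beta hck, mul_assoc, hD, ← ENNReal.ofReal_mul (by positivity)]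
            congr 3
            push_cast
            field_simp
            ring
    calc _ ≤ ∑ j, ENNReal.ofReal (p j) *
          (∫⁻ u, (∫⁻ y, φ (u • vertex j + (1 - u) • y) ∂σ (k + 1))
            ∂betaMeasure (1 / 2) (c + k / 2) +
            K * ENNReal.ofReal ((c + k / 2) / (c + (k + (N + 1) : ℕ) / 2))) :=
          Finset.sum_le_sum fun j _ => mul_le_mul_right (hstep j) _
      _ = _ := by
          simp_rw [mul_add]
          rw [Finset.sum_add_distrib, ← Finset.sum_mul, sum_ofReal_eq_one hp hp1, one_mul]

theorem eq_of_stickStep {p : Option ι → ℝ} (hp : ∀ k, 0 < p k) (hp1 : ∑ k, p k = 1)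
    {c : ℝ} (hc : 0 < c) {ρ σ : ℕ → Measure (ι → ℝ)} [∀ N, IsProbabilityMeasure (ρ N)]
    [∀ N, IsProbabilityMeasure (σ N)] (hR : ∀ N, ∀ᵐ x ∂ρ N, x ∈ Set.Icc 0 1)
    (hS : ∀ N, ∀ᵐ x ∂σ N, x ∈ Set.Icc 0 1)
    (hRs : ∀ N : ℕ, StickStep p (c + N / 2) (ρ N) (ρ (N + 1)))
    (hSs : ∀ N : ℕ, StickStep p (c + N / 2) (σ N) (σ (N + 1))) : ρ 0 = σ 0 := by
  refine ext_of_forall_lintegral_lipschitz fun φ K hKt hφ hK => ?_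
  have hlim : Tendsto (fun N : ℕ => K *
      ENNReal.ofReal ((c + (0 : ℕ) / 2) / (c + (0 + N : ℕ) / 2))) atTop (𝓝 0) := by
    rw [← mul_zero K, ← ENNReal.ofReal_zero]
    refine ENNReal.Tendsto.const_mul (ENNReal.tendsto_ofReal (Tendsto.const_div_atTop ?_ _))
      (Or.inr hKt)
    simp only [zero_add]
    exact tendsto_atTop_add_const_left _ _
      (tendsto_natCast_atTop_atTop.atTop_div_const (by norm_num))
  refine le_antisymm ?_ ?_
  · refine ge_of_tendsto' (f := fun N : ℕ => ∫⁻ x, φ x ∂σ 0 + K *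
      ENNReal.ofReal ((c + (0 : ℕ) / 2) / (c + (0 + N : ℕ) / 2))) (x := atTop) ?_
      fun N => lintegral_le_of_stickStep hp hp1 hc hR hS hRs hSs N 0 φ K hφ hK
    simpa using hlim.const_add (∫⁻ x, φ x ∂σ 0)
  · refine ge_of_tendsto' (f := fun N : ℕ => ∫⁻ x, φ x ∂ρ 0 + K *
      ENNReal.ofReal ((c + (0 : ℕ) / 2) / (c + (0 + N : ℕ) / 2))) (x := atTop) ?_
      fun N => lintegral_le_of_stickStep hp hp1 hc hS hR hSs hRs N 0 φ K hφ hK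
    simpa using hlim.const_add (∫⁻ x, φ x ∂ρ 0)

end Uniqueness

/-! ### The block masses of the stick-breaking measure -/

section StickVec

variable {ι : Type*} [Fintype ι] [DecidableEq ι]

omit [Fintype ι] in
theorem vertex_mem_Icc (k : Option ι) (i : ι) : vertex k i ∈ Set.Icc (0 : ℝ) 1 := by
  unfold vertex
  split_ifs <;> norm_num

/-- The masses of the blocks `κ = some i` under `∑ V_m δ_{ξ m}`. -/
def stickVec (κ : ℕ → Option ι) (u : ℕ → ℝ) (ξ : ℕ → ℕ) (i : ι) : ℝ :=
  (∑' m, ENNReal.ofReal (weight u m) * ENNReal.ofReal (vertex (κ (ξ m)) i)).toReal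

theorem measurable_weight (m : ℕ) : Measurable fun u : ℕ → ℝ => weight u m := by
  unfold weight
  exact (Finset.measurable_fun_prod _ fun j _ => by fun_prop).mul (by fun_prop)

omit [Fintype ι] in
theorem measurable_stickVec (κ : ℕ → Option ι) :
    Measurable fun q : (ℕ → ℝ) × (ℕ → ℕ) => stickVec κ q.1 q.2 := by
  refine measurable_pi_iff.2 fun i => Measurable.ennreal_toReal (Measurable.tsum fun m => ?_)
  refine ((measurable_weight m).comp measurable_fst).ennreal_ofReal.mul ?_
  exact (measurable_of_countable fun j : ℕ => ENNReal.ofReal (vertex (κ j) i)).comp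
    ((measurable_pi_apply m).comp measurable_snd)

omit [Fintype ι] in
theorem tsum_weight_mul_le {u : ℕ → ℝ} (hu : ∀ k, u k ∈ Set.Ioo (0 : ℝ) 1)
    (h : HasSum (weight u) 1) (κ : ℕ → Option ι) (ξ : ℕ → ℕ) (i : ι) :
    ∑' m, ENNReal.ofReal (weight u m) * ENNReal.ofReal (vertex (κ (ξ m)) i) ≤ 1 := by
  calc _ ≤ ∑' m, ENNReal.ofReal (weight u m) := ENNReal.tsum_le_tsum fun m => by
        refine mul_le_of_le_one_right' ?_
        rw [← ENNReal.ofReal_one]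
        exact ENNReal.ofReal_le_ofReal (vertex_mem_Icc _ _).2
    _ = 1 := by
      rw [← ENNReal.ofReal_tsum_of_nonneg (fun m => (weight_pos hu m).le) h.summable, h.tsum_eq,
        ENNReal.ofReal_one]

omit [Fintype ι] in
theorem stickVec_mem_Icc {u : ℕ → ℝ} (hu : ∀ k, u k ∈ Set.Ioo (0 : ℝ) 1)
    (h : HasSum (weight u) 1) (κ : ℕ → Option ι) (ξ : ℕ → ℕ) :
    stickVec κ u ξ ∈ Set.Icc (0 : ι → ℝ) 1 := by
  refine ⟨fun i => ENNReal.toReal_nonneg, fun i => ?_⟩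
  have := ENNReal.toReal_mono ENNReal.one_ne_top (tsum_weight_mul_le hu h κ ξ i)
  exact this.trans_eq ENNReal.toReal_one

omit [Fintype ι] in
theorem stickVec_consSeq {a : ℝ} (ha : a ∈ Set.Ioo (0 : ℝ) 1) {b : ℕ → ℝ}
    (hb : ∀ k, b k ∈ Set.Ioo (0 : ℝ) 1) (h : HasSum (weight b) 1) (κ : ℕ → Option ι) (j : ℕ)
    (ξ : ℕ → ℕ) :
    stickVec κ (consSeq a b) (consSeq j ξ) = a • vertex (κ j) + (1 - a) • stickVec κ b ξ := by
  funext i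
  have h1 : 0 ≤ 1 - a := by linarith [ha.2]
  have hne : ∑' m, ENNReal.ofReal (weight b m) * ENNReal.ofReal (vertex (κ (ξ m)) i) ≠ ⊤ :=
    ne_top_of_le_ne_top ENNReal.one_ne_top (tsum_weight_mul_le hb h κ ξ i)
  simp only [stickVec, Pi.add_apply, Pi.smul_apply, smul_eq_mul]
  rw [tsum_eq_zero_add' ENNReal.summable]
  simp_rw [weight_consSeq_succ, weight_consSeq_zero, ENNReal.ofReal_mul h1, mul_assoc]
  rw [ENNReal.tsum_mul_left]
  simp only [consSeq]
  rw [ENNReal.toReal_add, ENNReal.toReal_mul, ENNReal.toReal_mul, ENNReal.toReal_ofReal ha.1.le,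
    ENNReal.toReal_ofReal h1, ENNReal.toReal_ofReal (vertex_mem_Icc _ _).1]
  · exact ENNReal.mul_ne_top ENNReal.ofReal_ne_top ENNReal.ofReal_ne_top
  · exact ENNReal.mul_ne_top ENNReal.ofReal_ne_top hne

/-- The law of `stickVec`. -/
def stickVecLaw (κ : ℕ → Option ι) (ν₀ : Measure ℕ) (θ : ℝ) : Measure (ι → ℝ) :=
  ((stickLaw (1 / 2) θ).prod (Measure.infinitePi fun _ : ℕ => ν₀)).map
    fun q => stickVec κ q.1 q.2

omit [Fintype ι] in
theorem lintegral_stickVecLaw (κ : ℕ → Option ι) (ν₀ : Measure ℕ) [IsProbabilityMeasure ν₀]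
    (θ : ℝ) {φ : (ι → ℝ) → ℝ≥0∞} (hφ : Measurable φ) :
    ∫⁻ x, φ x ∂stickVecLaw κ ν₀ θ = ∫⁻ u, (∫⁻ ξ, φ (stickVec κ u ξ)
      ∂(Measure.infinitePi fun _ : ℕ => ν₀)) ∂stickLaw (1 / 2) θ := by
  rw [stickVecLaw, lintegral_map hφ (measurable_stickVec κ),
    lintegral_prod (fun q : (ℕ → ℝ) × (ℕ → ℕ) => φ (stickVec κ q.1 q.2))
      (hφ.comp (measurable_stickVec κ)).aemeasurable]

theorem ae_stickLaw_hasSum {θ : ℝ} (hθ : -1 / 2 < θ) :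
    ∀ᵐ u ∂stickLaw (1 / 2) θ, (∀ k, u k ∈ Set.Ioo (0 : ℝ) 1) ∧ HasSum (weight u) 1 := by
  filter_upwards [ae_stickLaw hθ, ae_tendsto_prod_one_sub hθ] with u hu h
  exact ⟨hu, hasSum_weight hu h⟩

omit [DecidableEq ι] in
theorem lintegral_blocks (κ : ℕ → Option ι) (ν₀ : Measure ℕ) [IsProbabilityMeasure ν₀]
    (g : Option ι → ℝ≥0∞) :
    ∫⁻ j, g (κ j) ∂ν₀ = ∑ k, ENNReal.ofReal (ν₀.real (κ ⁻¹' {k})) * g k := by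
  let _ : MeasurableSpace (Option ι) := ⊤
  have hκ : Measurable κ := measurable_of_countable κ
  rw [← lintegral_map (measurable_of_finite g) hκ, lintegral_fintype]
  refine Finset.sum_congr rfl fun k _ => ?_
  rw [Measure.map_apply hκ (measurableSet_singleton k), mul_comm, ofReal_measureReal]

/-- Splits off the first stick and the first atom. The atom falls into block `k` with the base
probability of that block, and the rest is a stick-breaking measure for `θ + 1/2`, rescaled by `1 -
U` and independent of both. -/
theorem stickStep_stickVecLaw (κ : ℕ → Option ι) (ν₀ : Measure ℕ) [IsProbabilityMeasure ν₀]
    {θ : ℝ} (hθ : -1 / 2 < θ) :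
    StickStep (fun k => ν₀.real (κ ⁻¹' {k})) (θ + 1 / 2) (stickVecLaw κ ν₀ θ)
      (stickVecLaw κ ν₀ (θ + 1 / 2)) := by
  intro φ hφ
  have hθ' : -1 / 2 < θ + 1 / 2 := by linarith
  have hs : ∀ κ : ℕ → Option ι, Measurable fun q : (ℕ → ℝ) × (ℕ → ℕ) => φ (stickVec κ q.1 q.2) :=
    fun κ => hφ.comp (measurable_stickVec κ)
  rw [lintegral_stickVecLaw κ ν₀ θ hφ, lintegral_stickLaw hθ (hs κ).lintegral_prod_right']
  have hm : ∀ k, Measurable fun q : ℝ × ((ℕ → ℝ) × (ℕ → ℕ)) =>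
      φ (q.1 • vertex k + (1 - q.1) • stickVec κ q.2.1 q.2.2) := fun k => by
    have := measurable_stickVec κ
    refine hφ.comp ?_
    fun_prop
  have hmap : ∀ (a : ℝ) (k : Option ι), Measurable fun y => φ (a • vertex k + (1 - a) • y) :=
    fun a k => hφ.comp (by fun_prop)
  have hm1 : ∀ (a : ℝ) (k : Option ι), Measurable fun b : ℕ → ℝ => ∫⁻ ξ,
      φ (a • vertex k + (1 - a) • stickVec κ b ξ) ∂(Measure.infinitePi fun _ : ℕ => ν₀) :=
    fun a k => Measurable.lintegral_prod_right' (f := fun q : (ℕ → ℝ) × (ℕ → ℕ) =>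
      φ (a • vertex k + (1 - a) • stickVec κ q.1 q.2))
      ((hmap a k).comp (measurable_stickVec κ))
  have hprob := isProbabilityMeasure_stickLaw hθ'
  have hm2 : ∀ k : Option ι, Measurable fun a : ℝ => ∫⁻ y, φ (a • vertex k + (1 - a) • y)
      ∂stickVecLaw κ ν₀ (θ + 1 / 2) := fun k => by
    have : SFinite (stickVecLaw κ ν₀ (θ + 1 / 2)) := by unfold stickVecLaw; infer_instance
    refine Measurable.lintegral_prod_right' (f := fun q : ℝ × (ι → ℝ) =>
      φ (q.1 • vertex k + (1 - q.1) • q.2)) (hφ.comp (by fun_prop))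
  have hinner : ∀ᵐ a ∂betaMeasure (1 / 2) (θ + 1 / 2),
      ∫⁻ b, (∫⁻ ξ, φ (stickVec κ (consSeq a b) ξ) ∂(Measure.infinitePi fun _ : ℕ => ν₀))
        ∂stickLaw (1 / 2) (θ + 1 / 2) =
      ∑ k, ENNReal.ofReal (ν₀.real (κ ⁻¹' {k})) *
        ∫⁻ y, φ (a • vertex k + (1 - a) • y) ∂stickVecLaw κ ν₀ (θ + 1 / 2) := by
    filter_upwards [ae_betaMeasure (1 / 2) (θ + 1 / 2)] with a ha
    simp_rw [lintegral_stickVecLaw κ ν₀ (θ + 1 / 2) (hmap a _)]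
    simp_rw [← lintegral_const_mul _ (hm1 a _)]
    rw [← lintegral_finsetSum _ fun k _ => (hm1 a k).const_mul _]
    refine lintegral_congr_ae ?_
    filter_upwards [ae_stickLaw_hasSum hθ'] with b hb
    have hξ := (hs κ).comp (measurable_prodMk_left (x := consSeq a b))
    simp only [Function.comp_def] at hξ
    rw [lintegral_infinitePi_consSeq (fun _ => ν₀) hξ]
    simp_rw [stickVec_consSeq ha hb.1 hb.2]
    exact (lintegral_blocks κ ν₀ fun k => ∫⁻ ξ, φ (a • vertex k + (1 - a) • stickVec κ b ξ)
      ∂(Measure.infinitePi fun _ : ℕ => ν₀))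
  rw [lintegral_congr_ae hinner, lintegral_finsetSum _ fun k _ => (hm2 k).const_mul _]
  simp_rw [lintegral_const_mul _ (hm2 _)]

/-- Along the parameters `θ + N/2` both families solve the recursion with `c = θ + 1/2`, so
uniqueness identifies them at `N = 0`. The exponent is the one required by `b = c + card ι / 2`. -/
theorem stickVecLaw_eq_finLaw (κ : ℕ → Option ι) (ν₀ : Measure ℕ) [IsProbabilityMeasure ν₀]
    (hp : ∀ k, 0 < ν₀.real (κ ⁻¹' {k})) {θ : ℝ} (hθ : -1 / 2 < θ) :
    stickVecLaw κ ν₀ θ =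
      finLaw (fun k => ν₀.real (κ ⁻¹' {k})) (θ + ((Fintype.card ι : ℝ) + 1) / 2) := by
  set p : Option ι → ℝ := fun k => ν₀.real (κ ⁻¹' {k}) with hpdef
  have hp1 : ∑ k, p k = 1 := by
    have h := lintegral_blocks κ ν₀ fun _ => 1
    simp only [lintegral_const, measure_univ, mul_one] at h
    rw [← ENNReal.ofReal_sum_of_nonneg fun k _ => (hp k).le] at h
    have := congrArg ENNReal.toReal h
    rwa [ENNReal.toReal_one, ENNReal.toReal_ofReal (Finset.sum_nonneg fun k _ => (hp k).le),
      eq_comm] at this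
  have hθN : ∀ N : ℕ, -1 / 2 < θ + (N : ℝ) / 2 := fun N => by
    have : (0 : ℝ) ≤ (N : ℝ) / 2 := by positivity
    linarith
  have hbN : ∀ N : ℕ, (Fintype.card ι : ℝ) / 2 < θ + (N : ℝ) / 2 + ((Fintype.card ι : ℝ) + 1) / 2 :=
    fun N => by linarith [hθN N]
  have hR : ∀ N : ℕ, IsProbabilityMeasure (stickVecLaw κ ν₀ (θ + (N : ℝ) / 2)) := fun N => by
    have := isProbabilityMeasure_stickLaw (hθN N)
    exact Measure.isProbabilityMeasure_map (measurable_stickVec κ).aemeasurable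
  have hS : ∀ N : ℕ, IsProbabilityMeasure
      (finLaw p (θ + (N : ℝ) / 2 + ((Fintype.card ι : ℝ) + 1) / 2)) := fun N =>
    isProbabilityMeasure_finLaw hp hp1 (hbN N)
  have key := eq_of_stickStep (p := p) hp hp1 (c := θ + 1 / 2) (by linarith)
    (ρ := fun N : ℕ => stickVecLaw κ ν₀ (θ + (N : ℝ) / 2))
    (σ := fun N : ℕ => finLaw p (θ + (N : ℝ) / 2 + ((Fintype.card ι : ℝ) + 1) / 2))
    (fun N => ?_) (fun N => ?_) (fun N => ?_) (fun N => ?_)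
  · simpa using key
  · refine (ae_map_iff (measurable_stickVec κ).aemeasurable measurableSet_Icc).2 ?_
    have hprob := isProbabilityMeasure_stickLaw (hθN N)
    have h := ae_stickLaw_hasSum (hθN N)
    have h2 := (Measure.quasiMeasurePreserving_fst
      (μ := stickLaw (1 / 2) (θ + (N : ℝ) / 2))
      (ν := Measure.infinitePi fun _ : ℕ => ν₀)).ae h
    filter_upwards [h2] with q hq
    exact stickVec_mem_Icc hq.1 hq.2 κ q.2
  · filter_upwards [finLaw_simplex p (θ + (N : ℝ) / 2 + ((Fintype.card ι : ℝ) + 1) / 2)] with x hx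
    exact simplex_subset_Icc hx
  · have := stickStep_stickVecLaw κ ν₀ (hθN N)
    have e1 : θ + 1 / 2 + (N : ℝ) / 2 = θ + (N : ℝ) / 2 + 1 / 2 := by ring
    have e2 : θ + ((N + 1 : ℕ) : ℝ) / 2 = θ + (N : ℝ) / 2 + 1 / 2 := by push_cast; ring
    simp only [e1, e2]
    exact this
  · intro φ hφ
    have e2 : θ + ((N + 1 : ℕ) : ℝ) / 2 + ((Fintype.card ι : ℝ) + 1) / 2 =
      θ + (N : ℝ) / 2 + ((Fintype.card ι : ℝ) + 1) / 2 + 1 / 2 := by push_cast; ring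
    have e1 : θ + 1 / 2 + (N : ℝ) / 2 = θ + (N : ℝ) / 2 + 1 / 2 := by ring
    simp only [e1, e2]
    exact lintegral_finLaw_recursion hp hp1 (by linarith [hθN N]) (by ring) hφ

end StickVec

end

end TwoParam

namespace TwoParam

noncomputable section

/-! ### Ranked sequences are rearrangements -/

section Ranked

/-- `j` comes before `m` in the descending rearrangement of `v`. -/
def RankedBefore (v : ℕ → ℝ≥0∞) (j m : ℕ) : Prop := v m < v j ∨ (v j = v m ∧ j < m)

variable {v : ℕ → ℝ≥0∞}

theorem RankedBefore.trans {a b c : ℕ} (h1 : RankedBefore v a b) (h2 : RankedBefore v b c) :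
    RankedBefore v a c := by
  rcases h1 with h1 | ⟨h1, h1'⟩ <;> rcases h2 with h2 | ⟨h2, h2'⟩
  · exact Or.inl (h2.trans h1)
  · exact Or.inl (h2 ▸ h1)
  · exact Or.inl (h1 ▸ h2)
  · exact Or.inr ⟨h1.trans h2, h1'.trans h2'⟩

theorem not_rankedBefore_self (a : ℕ) : ¬RankedBefore v a a := by
  rintro (h | ⟨_, h⟩) <;> exact lt_irrefl _ h

theorem rankedBefore_trichotomy (a b : ℕ) : RankedBefore v a b ∨ a = b ∨ RankedBefore v b a := by
  rcases lt_trichotomy (v a) (v b) with h | h | h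
  · exact Or.inr (Or.inr (Or.inl h))
  · rcases lt_trichotomy a b with h' | h' | h'
    · exact Or.inl (Or.inr ⟨h, h'⟩)
    · exact Or.inr (Or.inl h')
    · exact Or.inr (Or.inr (Or.inr ⟨h.symm, h'⟩))
  · exact Or.inl (Or.inl h)

/-- The position of `m` in the descending rearrangement of `v`. -/
def rankIndex (v : ℕ → ℝ≥0∞) (m : ℕ) : ℕ := {j | RankedBefore v j m}.ncard

/-- A positive value is equalled or exceeded only finitely often by a sequence that tends to `0`.
Without positivity a zero entry could have infinitely many predecessors. -/
theorem finite_rankedBefore (hpos : ∀ m, 0 < v m) (hlim : Tendsto v atTop (𝓝 0)) (m : ℕ) :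
    {j | RankedBefore v j m}.Finite := by
  obtain ⟨N, hN⟩ := eventually_atTop.1 (hlim.eventually_lt_const (hpos m))
  refine (Set.finite_lt_nat N).subset fun j hj => ?_
  by_contra h
  have := hN j (not_lt.1 h)
  rcases hj with hj | ⟨hj, _⟩
  · exact lt_asymm this hj
  · exact this.ne hj

theorem rankIndex_lt (hpos : ∀ m, 0 < v m) (hlim : Tendsto v atTop (𝓝 0)) {a b : ℕ}
    (h : RankedBefore v a b) : rankIndex v a < rankIndex v b :=
  Set.ncard_lt_ncard ⟨fun _ hj => RankedBefore.trans hj h, fun hsub =>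
    not_rankedBefore_self a (hsub h)⟩ (finite_rankedBefore hpos hlim b)

theorem rankIndex_injective (hpos : ∀ m, 0 < v m) (hlim : Tendsto v atTop (𝓝 0)) :
    Function.Injective (rankIndex v) := by
  intro a b hab
  rcases rankedBefore_trichotomy (v := v) a b with h | h | h
  · exact absurd hab (rankIndex_lt hpos hlim h).ne
  · exact h
  · exact absurd hab (rankIndex_lt hpos hlim h).ne'

/-- The positions form an infinite set, by injectivity, and it is closed downwards: among the
predecessors of `m`, the one of largest position comes immediately before `m`. -/
theorem rankIndex_surjective (hpos : ∀ m, 0 < v m) (hlim : Tendsto v atTop (𝓝 0)) :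
    Function.Surjective (rankIndex v) := by
  have hdown : ∀ k, (∃ m, rankIndex v m = k + 1) → ∃ m, rankIndex v m = k := by
    rintro k ⟨m, hm⟩
    have hfin := finite_rankedBefore hpos hlim m
    have hne : {j | RankedBefore v j m}.Nonempty := by
      refine Set.nonempty_of_ncard_ne_zero ?_
      change rankIndex v m ≠ 0
      omega
    obtain ⟨a, ha, hmax⟩ := Set.exists_max_image _ (rankIndex v) hfin hne
    refine ⟨a, ?_⟩
    have hset : {j | RankedBefore v j a} = {j | RankedBefore v j m} \ {a} := by
      ext j
      constructor
      · intro hj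
        refine ⟨RankedBefore.trans hj ha, ?_⟩
        rintro rfl
        exact not_rankedBefore_self _ hj
      · rintro ⟨hj, hja⟩
        rcases rankedBefore_trichotomy (v := v) j a with h | h | h
        · exact h
        · exact absurd h hja
        · exact absurd (rankIndex_lt hpos hlim h) (not_lt.2 (hmax j hj))
    rw [rankIndex, hset, Set.ncard_sdiff_singleton_of_mem ha]
    change rankIndex v m - 1 = k
    omega
  intro k
  have hfin : {m | rankIndex v m ≤ k}.Finite :=
    (Set.finite_le_nat k).preimage (rankIndex_injective hpos hlim).injOn
  obtain ⟨m, hm⟩ := hfin.exists_notMem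
  have hle : k ≤ rankIndex v m := le_of_lt (not_le.1 hm)
  obtain ⟨n, hn⟩ := Nat.exists_eq_add_of_le hle
  clear hm hle
  induction n generalizing m with
  | zero => exact ⟨m, hn⟩
  | succ n ih =>
    obtain ⟨m', hm'⟩ := hdown (k + n) ⟨m, hn⟩
    exact ih m' hm'

/-- The permutation is the inverse of `rankIndex`. Among any `k + 1` indices one has position at
least `k`, which bounds the supremum in `ranked`; the first `k + 1` positions attain it. -/
theorem exists_equiv_ranked (hpos : ∀ m, 0 < v m) (hlim : Tendsto v atTop (𝓝 0)) :
    ∃ σ : ℕ ≃ ℕ, ∀ k, ranked v k = v (σ k) := by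
  set e : ℕ ≃ ℕ := Equiv.ofBijective (rankIndex v)
    ⟨rankIndex_injective hpos hlim, rankIndex_surjective hpos hlim⟩ with he
  have hanti : ∀ i j, i ≤ j → v (e.symm j) ≤ v (e.symm i) := by
    intro i j hij
    by_contra h
    have h1 : e (e.symm j) < e (e.symm i) := rankIndex_lt hpos hlim (Or.inl (not_le.1 h))
    rw [e.apply_symm_apply, e.apply_symm_apply] at h1
    omega
  refine ⟨e.symm, fun k => le_antisymm (iSup_le fun s => ?_) ?_⟩
  · obtain ⟨i, hi, hk⟩ : ∃ i ∈ s.1, k ≤ e i := by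
      by_contra! h
      have h1 : (s.1.map e.toEmbedding) ⊆ Finset.range k := by
        intro j hj
        obtain ⟨i, hi, rfl⟩ := Finset.mem_map.1 hj
        exact Finset.mem_range.2 (h i hi)
      have h2 := Finset.card_le_card h1
      rw [Finset.card_map, Finset.card_range, s.2] at h2
      omega
    refine (iInf₂_le i hi).trans ?_
    simpa using hanti k (e i) hk
  · refine le_iSup_of_le ⟨(Finset.range (k + 1)).map e.symm.toEmbedding, by simp⟩ ?_
    refine le_iInf₂ fun i hi => ?_
    obtain ⟨j, hj, rfl⟩ := Finset.mem_map.1 hi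
    exact hanti j k (Finset.mem_range_succ_iff.1 hj)

theorem measurable_ranked (k : ℕ) : Measurable fun v : ℕ → ℝ≥0∞ => ranked v k := by
  unfold ranked
  refine Measurable.iSup fun s => ?_
  exact Measurable.biInf _ s.1.countable_toSet fun i _ => measurable_pi_apply i

end Ranked

/-! ### Measurability of the random measure -/

section Atomic

theorem measurable_stickWeight : Measurable stickWeight :=
  measurable_pi_iff.2 fun m => (measurable_weight m).ennreal_ofReal

theorem measurable_atomicMeasure :
    Measurable fun q : (ℕ → ℝ) × (ℕ → ℕ) => atomicMeasure q.1 q.2 := by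
  refine Measure.measurable_of_measurable_coe _ fun s hs => ?_
  have : ∀ q : (ℕ → ℝ) × (ℕ → ℕ), atomicMeasure q.1 q.2 s =
      ∑' k, ranked (stickWeight q.1) k * s.indicator 1 (q.2 k) := by
    intro q
    rw [atomicMeasure, Measure.sum_apply _ hs]
    simp only [Measure.smul_apply, smul_eq_mul, Measure.dirac_apply' _ hs]
  simp_rw [this]
  refine Measurable.tsum fun k => Measurable.mul ?_ ?_
  · exact (measurable_ranked k).comp (measurable_stickWeight.comp measurable_fst)
  · exact (measurable_of_countable (s.indicator (1 : ℕ → ℝ≥0∞))).comp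
      ((measurable_pi_apply k).comp measurable_snd)

/-- `Measure.map` is zero along a map that is not a.e. measurable, so every statement about `law`
depends on this. -/
theorem measurable_atomicProb :
    Measurable fun q : (ℕ → ℝ) × (ℕ → ℕ) => atomicProb q.1 q.2 := by
  classical
  have hval : (fun q : (ℕ → ℝ) × (ℕ → ℕ) => (atomicProb q.1 q.2 : Measure ℕ)) = fun q =>
      if IsProbabilityMeasure (atomicMeasure q.1 q.2) then atomicMeasure q.1 q.2
      else Measure.dirac (q.2 0) := by
    funext q
    by_cases h : IsProbabilityMeasure (atomicMeasure q.1 q.2)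
    · rw [if_pos h]
      exact congrArg Subtype.val (dif_pos h)
    · rw [if_neg h]
      exact congrArg Subtype.val (dif_neg h)
  have hset : MeasurableSet {q : (ℕ → ℝ) × (ℕ → ℕ) |
      IsProbabilityMeasure (atomicMeasure q.1 q.2)} := by
    simp_rw [isProbabilityMeasure_iff]
    exact ((Measure.measurable_coe MeasurableSet.univ).comp measurable_atomicMeasure)
      (measurableSet_singleton 1)
  have h : Measurable fun q : (ℕ → ℝ) × (ℕ → ℕ) => (atomicProb q.1 q.2 : Measure ℕ) := by
    rw [hval]
    exact Measurable.ite hset measurable_atomicMeasure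
      (Measure.measurable_dirac.comp ((measurable_pi_apply 0).comp measurable_snd))
  exact Measurable.subtype_mk (h := fun q => (atomicProb q.1 q.2).2) h

variable {ι : Type*}

/-- The masses of the blocks `κ = some i`. -/
def blockVec (κ : ℕ → Option ι) (μ : ProbabilityMeasure ℕ) (i : ι) : ℝ :=
  (μ : Measure ℕ).real (κ ⁻¹' {some i})

theorem measurable_blockVec (κ : ℕ → Option ι) : Measurable (blockVec κ) :=
  measurable_pi_iff.2 fun i =>
    ((Measure.measurable_coe (MeasurableSet.of_discrete (s := κ ⁻¹' {some i}))).comp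
      measurable_subtype_coe).ennreal_toReal

variable [DecidableEq ι]

/-- The permutation is chosen from `u` alone, before `ξ`, so that for fixed `u` it only relabels the
atoms. -/
theorem exists_blockVec_atomicProb {u : ℕ → ℝ} (hu : ∀ k, u k ∈ Set.Ioo (0 : ℝ) 1)
    (h : HasSum (weight u) 1) : ∃ σ : ℕ ≃ ℕ, ∀ (κ : ℕ → Option ι) (ξ : ℕ → ℕ),
      blockVec κ (atomicProb u ξ) = stickVec κ u (ξ ∘ σ.symm) := by
  have hlim : Tendsto (stickWeight u) atTop (𝓝 0) := by
    rw [← ENNReal.ofReal_zero]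
    exact ENNReal.tendsto_ofReal h.summable.tendsto_atTop_zero
  obtain ⟨σ, hσ⟩ := exists_equiv_ranked (v := stickWeight u)
    (fun m => ENNReal.ofReal_pos.2 (weight_pos hu m)) hlim
  refine ⟨σ, fun κ ξ => ?_⟩
  have happly : ∀ s : Set ℕ, atomicMeasure u ξ s =
      ∑' m, ENNReal.ofReal (weight u m) * s.indicator 1 (ξ (σ.symm m)) := by
    intro s
    rw [atomicMeasure, Measure.sum_apply _ MeasurableSet.of_discrete,
      ← σ.tsum_eq fun m => ENNReal.ofReal (weight u m) * s.indicator 1 (ξ (σ.symm m))]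
    refine tsum_congr fun k => ?_
    rw [Measure.smul_apply, Measure.dirac_apply, hσ, σ.symm_apply_apply]
    rfl
  have hprob : IsProbabilityMeasure (atomicMeasure u ξ) := by
    refine ⟨?_⟩
    rw [happly]
    simp only [Set.indicator_univ, Pi.one_apply, mul_one]
    rw [← ENNReal.ofReal_tsum_of_nonneg (fun m => (weight_pos hu m).le) h.summable, h.tsum_eq,
      ENNReal.ofReal_one]
  have hval : (atomicProb u ξ : Measure ℕ) = atomicMeasure u ξ :=
    congrArg Subtype.val (dif_pos hprob)
  funext i
  rw [blockVec, hval, measureReal_def, happly, stickVec]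
  congr 1
  refine tsum_congr fun m => ?_
  congr 1
  by_cases hm : κ (ξ (σ.symm m)) = some i
  · rw [Set.indicator_of_mem (by simpa using hm)]
    simp [vertex, hm]
  · rw [Set.indicator_of_notMem (by simpa using hm)]
    simp [vertex, hm]

theorem infinitePi_const_map_comp (ν₀ : Measure ℕ) [IsProbabilityMeasure ν₀] (σ : ℕ ≃ ℕ) :
    (Measure.infinitePi fun _ : ℕ => ν₀).map (fun ξ => ξ ∘ σ.symm) =
      Measure.infinitePi fun _ : ℕ => ν₀ := by
  have h := Measure.infinitePi_map_piCongrLeft (μ := fun _ : ℕ => ν₀) σ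
  have he : ⇑(MeasurableEquiv.piCongrLeft (fun _ : ℕ => ℕ) σ) = fun ξ => ξ ∘ σ.symm := by
    funext ξ m
    obtain ⟨k, rfl⟩ := σ.surjective m
    rw [Function.comp_apply, σ.symm_apply_apply]
    exact Equiv.piCongrLeft_apply_apply (fun _ : ℕ => ℕ) σ ξ k
  rwa [he] at h

/-- Given the sticks, a fixed permutation of i.i.d. atoms preserves their law, so ranked and
unranked weights give the same law of block masses. -/
theorem map_blockVec (κ : ℕ → Option ι) (θ : ℝ) (hθ : -1 / 2 < θ) (ν₀ : ProbabilityMeasure ℕ) :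
    (law θ ν₀).map (blockVec κ) = stickVecLaw κ (ν₀ : Measure ℕ) θ := by
  refine Measure.ext_of_lintegral _ fun φ hφ => ?_
  rw [lintegral_stickVecLaw _ _ _ hφ, lintegral_map hφ (measurable_blockVec κ)]
  have hm : Measurable fun μ => φ (blockVec κ μ) := hφ.comp (measurable_blockVec κ)
  rw [law, dirichletProcess, lintegral_map hm measurable_atomicProb,
    lintegral_prod (fun q : (ℕ → ℝ) × (ℕ → ℕ) => φ (blockVec κ (atomicProb q.1 q.2)))
      (hm.comp measurable_atomicProb).aemeasurable]
  refine lintegral_congr_ae ?_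
  filter_upwards [ae_stickLaw_hasSum hθ] with u hu
  obtain ⟨σ, hσ⟩ := exists_blockVec_atomicProb (ι := ι) hu.1 hu.2
  simp_rw [hσ]
  have hs := (hφ.comp (measurable_stickVec κ)).comp (measurable_prodMk_left (x := u))
  simp only [Function.comp_def] at hs
  conv_rhs => rw [← infinitePi_const_map_comp (ν₀ : Measure ℕ) σ]
  rw [lintegral_map hs (by fun_prop)]

theorem isProbabilityMeasure_law {θ : ℝ} (hθ : -1 / 2 < θ) (ν₀ : ProbabilityMeasure ℕ) :
    IsProbabilityMeasure (law θ ν₀) := by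
  have := isProbabilityMeasure_stickLaw hθ
  exact Measure.isProbabilityMeasure_map measurable_atomicProb.aemeasurable

/-- The finite-dimensional distributions of the Dirichlet process. -/
theorem map_blockVec_eq_finLaw [Fintype ι] (κ : ℕ → Option ι) {θ : ℝ} (hθ : -1 / 2 < θ)
    (ν₀ : ProbabilityMeasure ℕ) (hp : ∀ k, 0 < (ν₀ : Measure ℕ).real (κ ⁻¹' {k})) :
    (law θ ν₀).map (blockVec κ) = finLaw (fun k => (ν₀ : Measure ℕ).real (κ ⁻¹' {k}))
      (θ + ((Fintype.card ι : ℝ) + 1) / 2) :=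
  (map_blockVec κ θ hθ ν₀).trans (stickVecLaw_eq_finLaw κ (ν₀ : Measure ℕ) hp hθ)

end Atomic

end

end TwoParam

namespace TwoParam

noncomputable section

/-! ### Integration by parts on the simplex -/

section Parts

variable {ι : Type*} [Fintype ι] [DecidableEq ι]

/-- The `i`-th row `x_i (δ_{ij} - x_j)` of the diffusion matrix. -/
def diffRow (i : ι) (x : ι → ℝ) : ι → ℝ := fun j => x i * ((if j = i then 1 else 0) - x j)

/-- The drift coefficient `-1/2 - θ x_i + b (p_i² / x_i) / ∑ p_k² / x_k` with
`θ = b - n/2` for `n` blocks. -/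
def driftCoeff (p : Option ι → ℝ) (b : ℝ) (i : ι) (x : ι → ℝ) : ℝ :=
  -1 / 2 - (b - ((Fintype.card ι : ℝ) + 1) / 2) * x i + b * (p (some i) ^ 2 / x i / sig p x)

theorem sum_delta_sub (i : ι) (x : ι → ℝ) (g : Option ι → ℝ) :
    ∑ k, ((if k = some i then 1 else 0) - full x k) * g k =
      g (some i) - ∑ k, full x k * g k := by
  simp [sub_mul, Finset.sum_sub_distrib]

/-- The coordinate at `none` moves by the same rule as the others, which keeps the derivatives of
`sig` and of the product symmetric in all blocks. -/
theorem full_add_smul_diffRow (i : ι) (x : ι → ℝ) (t : ℝ) (k : Option ι) :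
    full (x + t • diffRow i x) k =
      full x k + t * (x i * ((if k = some i then 1 else 0) - full x k)) := by
  cases k with
  | some j => simp [full, diffRow]
  | none =>
    simp only [full, diffRow, Pi.add_apply, Pi.smul_apply, smul_eq_mul, Finset.sum_add_distrib,
      ← Finset.mul_sum, Finset.sum_sub_distrib, Finset.sum_ite_eq', Finset.mem_univ, if_true,
      reduceCtorEq, if_false]
    ring

theorem hasDerivAt_full (i : ι) (x : ι → ℝ) (k : Option ι) :
    HasDerivAt (fun t : ℝ => full (x + t • diffRow i x) k)
      (x i * ((if k = some i then 1 else 0) - full x k)) 0 := by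
  simp_rw [full_add_smul_diffRow]
  simpa using ((hasDerivAt_id (0 : ℝ)).mul_const
    (x i * ((if k = some i then 1 else 0) - full x k))).const_add (full x k)

theorem hasDerivAt_sig (p : Option ι → ℝ) (i : ι) {x : ι → ℝ} (hx : x ∈ simplex ι) :
    HasDerivAt (fun t : ℝ => sig p (x + t • diffRow i x))
      (-(p (some i) ^ 2 / x i - x i * sig p x)) 0 := by
  have h : ∀ k ∈ (Finset.univ : Finset (Option ι)), HasDerivAt
      (fun t : ℝ => p k ^ 2 / full (x + t • diffRow i x) k)
      (x i * (((if k = some i then 1 else 0) - full x k) * (-(p k ^ 2) / full x k ^ 2))) 0 := by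
    intro k _
    have h0 : full (x + (0 : ℝ) • diffRow i x) k ≠ 0 := by simpa using (hx k).ne'
    convert! (hasDerivAt_const (0 : ℝ) (p k ^ 2)).div (hasDerivAt_full i x k) h0 using 1
    simp only [zero_smul, add_zero, zero_mul, zero_sub]
    ring
  have h2 := HasDerivAt.fun_sum h
  unfold sig
  convert! h2 using 1
  rw [← Finset.mul_sum, sum_delta_sub]
  have hxi : x i ≠ 0 := (hx (some i)).ne'
  have : ∀ k, full x k * (-(p k ^ 2) / full x k ^ 2) = -(p k ^ 2 / full x k) := by
    intro k
    have := (hx k).ne'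
    field_simp
  simp_rw [this, Finset.sum_neg_distrib]
  simp only [full]
  field_simp
  ring

theorem hasDerivAt_prod_full (i : ι) {x : ι → ℝ} (hx : x ∈ simplex ι) :
    HasDerivAt (fun t : ℝ => ∏ k, full (x + t • diffRow i x) k ^ (-(3 : ℝ) / 2))
      ((∏ k, full x k ^ (-(3 : ℝ) / 2)) *
        (-(3 : ℝ) / 2 * (1 - ((Fintype.card ι : ℝ) + 1) * x i))) 0 := by
  have h : ∀ k ∈ (Finset.univ : Finset (Option ι)), HasDerivAt
      (fun t : ℝ => full (x + t • diffRow i x) k ^ (-(3 : ℝ) / 2))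
      (full x k ^ (-(3 : ℝ) / 2) *
        (-(3 : ℝ) / 2 * x i * (((if k = some i then 1 else 0) - full x k) * (full x k)⁻¹))) 0 := by
    intro k _
    have hk := hx k
    have h0 : full (x + (0 : ℝ) • diffRow i x) k ≠ 0 := by simpa using hk.ne'
    convert! (hasDerivAt_full i x k).rpow_const (p := -(3 : ℝ) / 2) (Or.inl h0) using 1
    simp only [zero_smul, add_zero]
    rw [Real.rpow_sub_one hk.ne']
    ring
  have h2 := HasDerivAt.fun_finsetProd h
  convert! h2 using 1
  simp only [zero_smul, add_zero, smul_eq_mul]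
  have : ∀ k ∈ (Finset.univ : Finset (Option ι)),
      (∏ j ∈ Finset.univ.erase k, full x j ^ (-(3 : ℝ) / 2)) * (full x k ^ (-(3 : ℝ) / 2) *
        (-(3 : ℝ) / 2 * x i * (((if k = some i then 1 else 0) - full x k) * (full x k)⁻¹))) =
      (∏ j, full x j ^ (-(3 : ℝ) / 2)) * (-(3 : ℝ) / 2 * x i) *
        (((if k = some i then 1 else 0) - full x k) * (full x k)⁻¹) := by
    intro k hk
    rw [← Finset.mul_prod_erase _ _ hk]
    ring
  rw [Finset.sum_congr rfl this, ← Finset.mul_sum, sum_delta_sub]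
  have hone : ∀ k, full x k * (full x k)⁻¹ = 1 := fun k => mul_inv_cancel₀ (hx k).ne'
  simp_rw [hone]
  rw [Finset.sum_const, Finset.card_univ, Fintype.card_option]
  have hxi : x i ≠ 0 := (hx (some i)).ne'
  simp only [full, nsmul_eq_mul]
  push_cast
  field_simp

/-- The density cut off near the boundary. -/
def cutDens (p : Option ι → ℝ) (b ε : ℝ) (x : ι → ℝ) : ℝ :=
  dens p b x * Real.smoothTransition (2 - ε * sig p x)

-- The cut-off factor is `1` where `ε * sig ≤ 1` and `0` where `ε * sig ≥ 2`. Since `sig ≥ p_k² /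
-- x_k`, the second case applies as soon as some `x_k < p_k² ε / 2`, so the support stays away from
-- the boundary.
omit [DecidableEq ι] in
theorem cutDens_eq_zero {p : Option ι → ℝ} (hp : ∀ k, 0 < p k) (b : ℝ) {ε : ℝ} (hε : 0 < ε)
    {x : ι → ℝ} (hx : ¬∀ k, p k ^ 2 * ε / 2 ≤ full x k) : cutDens p b ε x = 0 := by
  by_cases hs : x ∈ simplex ι
  · obtain ⟨k, hk⟩ := not_forall.1 hx
    have hk := not_le.1 hk
    have hfk := hs k
    have hle : p k ^ 2 / full x k ≤ sig p x :=
      Finset.single_le_sum (f := fun k => p k ^ 2 / full x k)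
        (fun j _ => (div_pos (pow_pos (hp j) 2) (hs j)).le) (Finset.mem_univ k)
    rw [cutDens, Real.smoothTransition.zero_of_nonpos, mul_zero]
    rw [div_le_iff₀ hfk] at hle
    have h1 : full x k * 2 < full x k * (ε * sig p x) := by nlinarith
    linarith [lt_of_mul_lt_mul_left h1 hfk.le]
  · rw [cutDens, dens, if_neg hs, zero_mul]

omit [DecidableEq ι] in
theorem isCompact_inner (p : Option ι → ℝ) (hp : ∀ k, 0 < p k) {ε : ℝ} (hε : 0 < ε) :
    IsCompact {x : ι → ℝ | ∀ k, p k ^ 2 * ε / 2 ≤ full x k} := by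
  refine (isCompact_Icc (a := (0 : ι → ℝ)) (b := 1)).of_isClosed_subset ?_ ?_
  · simp only [Set.ofPred_forall]
    exact isClosed_iInter fun k => isClosed_le continuous_const (continuous_full k)
  · intro x hx
    refine simplex_subset_Icc fun k => lt_of_lt_of_le ?_ (hx k)
    have := hp k
    positivity

omit [DecidableEq ι] in
theorem tsupport_cutDens_subset {p : Option ι → ℝ} (hp : ∀ k, 0 < p k) (b : ℝ) {ε : ℝ}
    (hε : 0 < ε) : tsupport (cutDens p b ε) ⊆ {x : ι → ℝ | ∀ k, p k ^ 2 * ε / 2 ≤ full x k} := by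
  refine closure_minimal (fun x hx => ?_) (isCompact_inner p hp hε).isClosed
  by_contra h
  exact hx (cutDens_eq_zero hp b hε h)

omit [DecidableEq ι] in
theorem hasCompactSupport_cutDens {p : Option ι → ℝ} (hp : ∀ k, 0 < p k) (b : ℝ) {ε : ℝ}
    (hε : 0 < ε) : HasCompactSupport (cutDens p b ε) :=
  (isCompact_inner p hp hε).of_isClosed_subset (isClosed_tsupport _)
    (tsupport_cutDens_subset hp b hε)

omit [DecidableEq ι] in
theorem tsupport_cutDens_subset_simplex {p : Option ι → ℝ} (hp : ∀ k, 0 < p k) (b : ℝ) {ε : ℝ}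
    (hε : 0 < ε) : tsupport (cutDens p b ε) ⊆ simplex ι := fun x hx k => by
  have := hp k
  exact lt_of_lt_of_le (by positivity) (tsupport_cutDens_subset hp b hε hx k)

omit [DecidableEq ι] in
theorem contDiff_full (k : Option ι) : ContDiff ℝ 1 fun x : ι → ℝ => full x k := by
  cases k with
  | none => simp only [full]; fun_prop
  | some i => simp only [full]; fun_prop

omit [DecidableEq ι] in
theorem dens_eventuallyEq (p : Option ι → ℝ) (b : ℝ) {x : ι → ℝ} (hx : x ∈ simplex ι) :
    dens p b =ᶠ[𝓝 x] fun y => (∏ k, full y k ^ (-(3 : ℝ) / 2)) * sig p y ^ (-b) := by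
  filter_upwards [isOpen_simplex.mem_nhds hx] with y hy
  rw [dens, if_pos hy]

omit [DecidableEq ι] in
theorem contDiff_cutDens {p : Option ι → ℝ} (hp : ∀ k, 0 < p k) (b : ℝ) {ε : ℝ} (hε : 0 < ε) :
    ContDiff ℝ 1 (cutDens p b ε) := by
  refine contDiff_iff_contDiffAt.2 fun x => ?_
  by_cases hx : x ∈ tsupport (cutDens p b ε)
  swap
  · exact contDiffAt_const.congr_of_eventuallyEq (notMem_tsupport_iff_eventuallyEq.1 hx)
  have hx' := tsupport_cutDens_subset_simplex hp b hε hx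
  have hsig : ContDiffAt ℝ 1 (sig p) x := by
    unfold sig
    exact ContDiffAt.sum fun k _ => contDiffAt_const.div (contDiff_full k).contDiffAt (hx' k).ne'
  have hprod : ContDiffAt ℝ 1 (fun y : ι → ℝ => ∏ k, full y k ^ (-(3 : ℝ) / 2)) x :=
    contDiffAt_prod fun k _ => (contDiff_full k).contDiffAt.rpow_const_of_ne (hx' k).ne'
  have hdens : ContDiffAt ℝ 1 (dens p b) x :=
    (hprod.mul (hsig.rpow_const_of_ne (sig_pos hp hx').ne')).congr_of_eventuallyEq
      (dens_eventuallyEq p b hx')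
  exact hdens.mul ((Real.smoothTransition.contDiff (n := 1)).contDiffAt.comp x
    (contDiffAt_const.sub (contDiffAt_const.mul hsig)))

/-- The terms are the logarithmic derivatives of the product and of `sig ^ (-b)` along the row, and
the derivative of the cut-off, which alone carries an explicit factor `ε`. -/
theorem fderiv_cutDens {p : Option ι → ℝ} (hp : ∀ k, 0 < p k) (b : ℝ) {ε : ℝ} (hε : 0 < ε)
    (i : ι) (x : ι → ℝ) :
    fderiv ℝ (cutDens p b ε) x (diffRow i x) =
      dens p b x * (Real.smoothTransition (2 - ε * sig p x) *
        (-(3 : ℝ) / 2 * (1 - ((Fintype.card ι : ℝ) + 1) * x i) +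
          b * (p (some i) ^ 2 / x i / sig p x) - b * x i) +
        ε * deriv Real.smoothTransition (2 - ε * sig p x) *
          (p (some i) ^ 2 / x i - x i * sig p x)) := by
  by_cases hx : x ∈ simplex ι
  · have hs := sig_pos hp hx
    have hdiff : DifferentiableAt ℝ (cutDens p b ε) x :=
      (contDiff_cutDens hp b hε).differentiable (by norm_num) x
    rw [← hdiff.lineDeriv_eq_fderiv, lineDeriv]
    have e0 : x + (0 : ℝ) • diffRow i x = x := by simp
    have h1 := hasDerivAt_prod_full i hx
    have h2 := hasDerivAt_sig p i hx
    have h3 : HasDerivAt (fun t : ℝ => sig p (x + t • diffRow i x) ^ (-b))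
        (sig p x ^ (-b) * (b * (p (some i) ^ 2 / x i / sig p x) - b * x i)) 0 := by
      convert! h2.rpow_const (p := -b) (Or.inl (by rw [e0]; exact hs.ne')) using 1
      rw [e0, Real.rpow_sub_one hs.ne']
      field_simp
    have hT : HasDerivAt Real.smoothTransition
        (deriv Real.smoothTransition (2 - ε * sig p x))
        (2 - ε * sig p (x + (0 : ℝ) • diffRow i x)) := by
      rw [e0]
      exact ((Real.smoothTransition.contDiff (n := 1)).differentiable (by norm_num) _).hasDerivAt
    have h4 := hT.comp (0 : ℝ) ((h2.const_mul ε).const_sub 2)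
    have h5 := (h1.mul h3).mul h4
    have heq : (fun t : ℝ => cutDens p b ε (x + t • diffRow i x)) =ᶠ[𝓝 0]
        fun t => (∏ k, full (x + t • diffRow i x) k ^ (-(3 : ℝ) / 2)) *
          sig p (x + t • diffRow i x) ^ (-b) *
            Real.smoothTransition (2 - ε * sig p (x + t • diffRow i x)) := by
      have hc : ContinuousAt (fun t : ℝ => x + t • diffRow i x) 0 := by fun_prop
      have hd : ∀ᶠ y in 𝓝 (x + (0 : ℝ) • diffRow i x), dens p b y =
          (∏ k, full y k ^ (-(3 : ℝ) / 2)) * sig p y ^ (-b) := by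
        rw [e0]
        exact dens_eventuallyEq p b hx
      filter_upwards [hc.eventually hd] with t ht
      rw [cutDens, ht]
    rw [heq.deriv_eq]
    refine h5.deriv.trans ?_
    simp only [Pi.mul_apply, Function.comp_apply, e0]
    rw [dens, if_pos hx]
    ring
  · have h1 : fderiv ℝ (cutDens p b ε) x = 0 := by
      have : x ∉ tsupport (cutDens p b ε) :=
        fun h => hx (tsupport_cutDens_subset_simplex hp b hε h)
      exact (notMem_tsupport_iff_eventuallyEq.1 this).fderiv_eq.trans (fderiv_const_apply 0)
    rw [h1, dens, if_neg hx]
    simp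

end Parts

end

end TwoParam

namespace TwoParam

noncomputable section

/-! ### Divergence theorem for the cut-off density and removal of the cut-off -/

section PartsIntegral

variable {ι : Type*} [Fintype ι]

theorem integral_fderiv_eq_zero {G : (ι → ℝ) → ℝ} (hG : ContDiff ℝ 1 G)
    (hc : HasCompactSupport G) (v : ι → ℝ) : ∫ x, fderiv ℝ G x v = 0 := by
  have h1 : Integrable fun x => fderiv ℝ G x v :=
    ((hG.continuous_fderiv (by norm_num)).clm_apply continuous_const).integrable_of_hasCompactSupport
      (hc.fderiv_apply ℝ v)
  have h2 : Integrable G := hG.continuous.integrable_of_hasCompactSupport hc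
  have h := integral_mul_fderiv_eq_neg_fderiv_mul_of_integrable (μ := volume) (f := fun _ => (1 : ℝ))
    (g := G) (v := v) (by simp) (by simpa using h1) (by simpa using h2)
    (fun x _ => differentiableAt_const _) (fun x _ => hG.differentiable (by norm_num) x)
  simpa using h

variable [DecidableEq ι]

/-- The field `diffRow i` has divergence `1 - (card ι + 1) x_i`, so the integrand is the divergence
of the compactly supported field `G * diffRow i`. -/
theorem integral_divergence_diffRow (i : ι) {G : (ι → ℝ) → ℝ} (hG : ContDiff ℝ 1 G)
    (hc : HasCompactSupport G) :
    ∫ x, ((1 - ((Fintype.card ι : ℝ) + 1) * x i) * G x + fderiv ℝ G x (diffRow i x)) = 0 := by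
  have hrow : ∀ j, ContDiff ℝ 1 fun x : ι → ℝ => diffRow i x j := fun j => by
    unfold diffRow
    fun_prop
  have hK : ∀ j, ContDiff ℝ 1 fun x => diffRow i x j * G x := fun j => (hrow j).mul hG
  have hKc : ∀ j, HasCompactSupport fun x => diffRow i x j * G x := fun j => hc.mul_left
  have hder : ∀ (j : ι) (x : ι → ℝ), fderiv ℝ (fun x => diffRow i x j * G x) x (Pi.single j 1) =
      diffRow i x j * fderiv ℝ G x (Pi.single j 1) +
        ((if j = i then (1 - x i) else 0) - x i) * G x := by
    intro j x
    have e1 : HasDerivAt (fun t : ℝ => (x + t • Pi.single (M := fun _ => ℝ) j 1) i)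
        (if j = i then 1 else 0) 0 := by
      have : ∀ t : ℝ, (x + t • Pi.single (M := fun _ => ℝ) j 1) i =
          x i + t * (if j = i then 1 else 0) := fun t => by
        simp [Pi.single_apply, eq_comm]
      simp_rw [this]
      simpa using ((hasDerivAt_id (0 : ℝ)).mul_const (if j = i then (1 : ℝ) else 0)).const_add (x i)
    have e2 : HasDerivAt (fun t : ℝ => (x + t • Pi.single (M := fun _ => ℝ) j 1) j) 1 0 := by
      have : ∀ t : ℝ, (x + t • Pi.single (M := fun _ => ℝ) j 1) j = x j + t := fun t => by simp
      simp_rw [this]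
      simpa using (hasDerivAt_id (0 : ℝ)).const_add (x j)
    have e3 := e1.mul (e2.const_sub (if j = i then (1 : ℝ) else 0))
    have h1 : fderiv ℝ (fun x : ι → ℝ => diffRow i x j) x (Pi.single j 1) =
        (if j = i then (1 - x i) else 0) - x i := by
      rw [← ((hrow j).differentiable (by norm_num) x).lineDeriv_eq_fderiv, lineDeriv]
      refine e3.deriv.trans ?_
      by_cases h : j = i
      · subst h; simp; ring
      · simp [h]
    rw [fderiv_fun_mul ((hrow j).differentiable (by norm_num) x)
      (hG.differentiable (by norm_num) x)]
    simp only [add_apply, smul_apply, smul_eq_mul, h1]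
    ring
  have hint : ∀ j, Integrable fun x => fderiv ℝ (fun x => diffRow i x j * G x) x (Pi.single j 1) :=
    fun j => (((hK j).continuous_fderiv (by norm_num)).clm_apply
      continuous_const).integrable_of_hasCompactSupport ((hKc j).fderiv_apply ℝ _)
  have hsum : ∀ x, (1 - ((Fintype.card ι : ℝ) + 1) * x i) * G x + fderiv ℝ G x (diffRow i x) =
      ∑ j, fderiv ℝ (fun x => diffRow i x j * G x) x (Pi.single j 1) := by
    intro x
    simp_rw [hder]
    rw [Finset.sum_add_distrib, ← Finset.sum_mul, Finset.sum_sub_distrib,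
      Finset.sum_ite_eq' Finset.univ i, if_pos (Finset.mem_univ i), Finset.sum_const,
      Finset.card_univ, nsmul_eq_mul]
    have : fderiv ℝ G x (diffRow i x) = ∑ j, diffRow i x j * fderiv ℝ G x (Pi.single j 1) := by
      conv_lhs => rw [← Finset.univ_sum_single (diffRow i x)]
      rw [map_sum]
      refine Finset.sum_congr rfl fun j _ => ?_
      rw [← smul_eq_mul, ← map_smul, ← Pi.single_smul, smul_eq_mul, mul_one]
    rw [this]
    ring
  simp_rw [hsum]
  rw [integral_finsetSum _ fun j _ => hint j]
  exact Finset.sum_eq_zero fun j _ => integral_fderiv_eq_zero (hK j) (hKc j) _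

/-- Used with `t = ε * sig`: it bounds the contribution of the cut-off uniformly in `ε`, although
`sig` is unbounded. -/
theorem exists_bound_deriv_smoothTransition :
    ∃ M : ℝ, 0 ≤ M ∧ ∀ t : ℝ, 0 ≤ t → |deriv Real.smoothTransition (2 - t)| * t ≤ M := by
  have hcont : Continuous (deriv Real.smoothTransition) :=
    (Real.smoothTransition.contDiff (n := 1)).continuous_deriv (by norm_num)
  obtain ⟨C, hC⟩ := (isCompact_Icc (a := (0 : ℝ)) (b := 2)).exists_bound_of_continuousOn
    hcont.continuousOn
  have hC0 : 0 ≤ C := (norm_nonneg _).trans (hC 0 (by norm_num))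
  refine ⟨C * 2, by positivity, fun t ht => ?_⟩
  by_cases h : t ≤ 2
  · have := hC (2 - t) ⟨by linarith, by linarith⟩
    rw [Real.norm_eq_abs] at this
    gcongr
  · have hz : Real.smoothTransition =ᶠ[𝓝 (2 - t)] fun _ => 0 := by
      filter_upwards [Iio_mem_nhds (show 2 - t < 0 by linarith)] with y hy
      exact Real.smoothTransition.zero_of_nonpos (le_of_lt hy)
    rw [hz.deriv_eq, deriv_const, abs_zero, zero_mul]
    positivity

theorem deriv_smoothTransition_of_one_lt {t : ℝ} (ht : 1 < t) :
    deriv Real.smoothTransition t = 0 := by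
  have hz : Real.smoothTransition =ᶠ[𝓝 t] fun _ => 1 := by
    filter_upwards [Ioi_mem_nhds ht] with y hy
    exact Real.smoothTransition.one_of_one_le (le_of_lt hy)
  rw [hz.deriv_eq, deriv_const]

omit [DecidableEq ι] in
theorem integrable_dens {p : Option ι → ℝ} (hp : ∀ k, 0 < p k) (hp1 : ∑ k, p k = 1) {b : ℝ}
    (hb : (Fintype.card ι : ℝ) / 2 < b) : Integrable (dens p b) := by
  refine ⟨(measurable_dens p b).aestronglyMeasurable, ?_⟩
  rw [hasFiniteIntegral_iff_ofReal (Eventually.of_forall (dens_nonneg hp b))]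
  exact normConst_lt_top hp hp1 hb

omit [DecidableEq ι] in
theorem share_mem_Icc {p : Option ι → ℝ} (hp : ∀ k, 0 < p k) {x : ι → ℝ} (hx : x ∈ simplex ι)
    (k : Option ι) : p k ^ 2 / full x k / sig p x ∈ Set.Icc (0 : ℝ) 1 := by
  have hk := hx k
  have hs := sig_pos hp hx
  refine ⟨by positivity, (div_le_one hs).2 ?_⟩
  exact Finset.single_le_sum (f := fun k => p k ^ 2 / full x k)
    (fun j _ => (div_pos (pow_pos (hp j) 2) (hx j)).le) (Finset.mem_univ k)

omit [DecidableEq ι] in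
theorem abs_driftCoeff_le {p : Option ι → ℝ} (hp : ∀ k, 0 < p k) (b : ℝ) (i : ι) {x : ι → ℝ}
    (hx : x ∈ simplex ι) :
    |driftCoeff p b i x| ≤ 1 / 2 + |b - ((Fintype.card ι : ℝ) + 1) / 2| + |b| := by
  have h1 := share_mem_Icc hp hx (some i)
  have h2 : |x i| ≤ 1 := by
    rw [abs_of_pos (show 0 < x i from hx (some i))]
    exact full_le_one hx (some i)
  have h3 : |p (some i) ^ 2 / x i / sig p x| ≤ 1 := by
    rw [abs_of_nonneg (show 0 ≤ p (some i) ^ 2 / x i / sig p x from h1.1)]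
    exact h1.2
  unfold driftCoeff
  refine (abs_add_le _ _).trans (add_le_add ((abs_sub _ _).trans (add_le_add ?_ ?_)) ?_)
  · norm_num [abs_div]
  · rw [abs_mul]
    exact mul_le_of_le_one_right (abs_nonneg _) h2
  · rw [abs_mul]
    exact mul_le_of_le_one_right (abs_nonneg _) h3

omit [DecidableEq ι] in
@[fun_prop]
theorem measurable_driftCoeff (p : Option ι → ℝ) (b : ℝ) (i : ι) :
    Measurable (driftCoeff p b i) := by
  unfold driftCoeff
  fun_prop

omit [Fintype ι] in
theorem continuous_diffRow (i : ι) : Continuous (diffRow i) := by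
  refine continuous_pi fun j => ?_
  unfold diffRow
  fun_prop

/-- The divergence of the row and the logarithmic derivative of the density add up to `driftCoeff`:
`1 - n x_i` and `-3/2 (1 - n x_i)` combine to `-1/2 (1 - n x_i)`, with `n = card ι + 1`. The cut-off
is removed by dominated convergence. -/
theorem integral_dens_mul_eq_zero {p : Option ι → ℝ} (hp : ∀ k, 0 < p k) (hp1 : ∑ k, p k = 1)
    {b : ℝ} (hb : (Fintype.card ι : ℝ) / 2 < b) (i : ι) {g : (ι → ℝ) → ℝ} (hg : ContDiff ℝ 1 g) :
    ∫ x, dens p b x * (fderiv ℝ g x (diffRow i x) + driftCoeff p b i x * g x) = 0 := by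
  obtain ⟨M, hM0, hM⟩ := exists_bound_deriv_smoothTransition
  have hfd : Continuous fun x => fderiv ℝ g x (diffRow i x) :=
    (hg.continuous_fderiv (by norm_num)).clm_apply (continuous_diffRow i)
  obtain ⟨C₁, hC₁⟩ := (isCompact_Icc (a := (0 : ι → ℝ)) (b := 1)).exists_bound_of_continuousOn
    hfd.continuousOn
  obtain ⟨C₂, hC₂⟩ := (isCompact_Icc (a := (0 : ι → ℝ)) (b := 1)).exists_bound_of_continuousOn
    hg.continuous.continuousOn
  set D : ℝ := 1 / 2 + |b - ((Fintype.card ι : ℝ) + 1) / 2| + |b| with hD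
  set ε : ℕ → ℝ := fun m => 1 / ((m : ℝ) + 1) with hεdef
  have hε : ∀ m, 0 < ε m := fun m => by simp only [hεdef]; positivity
  set F : ℕ → (ι → ℝ) → ℝ := fun m x => dens p b x *
    (Real.smoothTransition (2 - ε m * sig p x) *
      (fderiv ℝ g x (diffRow i x) + driftCoeff p b i x * g x) +
      g x * (ε m * deriv Real.smoothTransition (2 - ε m * sig p x) *
        (p (some i) ^ 2 / x i - x i * sig p x))) with hF
  have hFint : ∀ m, ∫ x, F m x = 0 := by
    intro m
    have hcd := contDiff_cutDens hp b (hε m)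
    rw [← integral_divergence_diffRow i (hcd.mul hg) ((hasCompactSupport_cutDens hp b (hε m)).mul_right
      (f' := g))]
    refine integral_congr_ae (Eventually.of_forall fun x => ?_)
    have h1 : fderiv ℝ (cutDens p b (ε m) * g) x = _ :=
      fderiv_mul (hcd.differentiable (by norm_num) x) (hg.differentiable (by norm_num) x)
    have h2 := fderiv_cutDens hp b (hε m) i x
    have h3 : fderiv ℝ (cutDens p b (ε m) * g) x (diffRow i x) =
        cutDens p b (ε m) x * fderiv ℝ g x (diffRow i x) +
          g x * fderiv ℝ (cutDens p b (ε m)) x (diffRow i x) := by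
      rw [h1]
      simp only [add_apply, smul_apply, smul_eq_mul]
    change F m x = (1 - ((Fintype.card ι : ℝ) + 1) * x i) * (cutDens p b (ε m) x * g x) +
      fderiv ℝ (cutDens p b (ε m) * g) x (diffRow i x)
    rw [h3, h2]
    simp only [hF, driftCoeff, cutDens]
    ring
  have hcT : Continuous Real.smoothTransition := Real.smoothTransition.continuous
  have hcT' : Continuous (deriv Real.smoothTransition) :=
    (Real.smoothTransition.contDiff (n := 1)).continuous_deriv (by norm_num)
  have hFmeas : ∀ m, Measurable (F m) := by
    intro m
    have m1 := measurable_dens p b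
    have m2 := hfd.measurable
    have m3 := measurable_driftCoeff p b i
    have m4 := hg.continuous.measurable
    have m5 := measurable_sig p
    have m6 : Measurable fun x => Real.smoothTransition (2 - ε m * sig p x) :=
      hcT.measurable.comp (by fun_prop)
    have m7 : Measurable fun x => deriv Real.smoothTransition (2 - ε m * sig p x) :=
      hcT'.measurable.comp (by fun_prop)
    simp only [hF]
    fun_prop
  have hlim : Tendsto (fun m => ∫ x, F m x) atTop
      (𝓝 (∫ x, dens p b x * (fderiv ℝ g x (diffRow i x) + driftCoeff p b i x * g x))) := by
    refine tendsto_integral_of_dominated_convergence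
      (fun x => dens p b x * (C₁ + D * C₂ + C₂ * M)) (fun m => (hFmeas m).aestronglyMeasurable)
      ((integrable_dens hp hp1 hb).mul_const _) (fun m => Eventually.of_forall fun x => ?_)
      (Eventually.of_forall fun x => ?_)
    · by_cases hx : x ∈ simplex ι
      · have hd := dens_pos hp b hx
        have hs := sig_pos hp hx
        have h1 : |fderiv ℝ g x (diffRow i x)| ≤ C₁ := hC₁ x (simplex_subset_Icc hx)
        have h2 : |g x| ≤ C₂ := hC₂ x (simplex_subset_Icc hx)
        have h3 := abs_driftCoeff_le hp b i hx
        have hC2 : 0 ≤ C₂ := (abs_nonneg _).trans h2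
        have hx0 : 0 < x i := hx (some i)
        have hx1 : x i ≤ 1 := full_le_one hx (some i)
        have hsh : p (some i) ^ 2 / x i ≤ sig p x :=
          (div_le_one hs).1 (share_mem_Icc hp hx (some i)).2
        have h4 : |p (some i) ^ 2 / x i - x i * sig p x| ≤ sig p x := by
          have : 0 ≤ p (some i) ^ 2 / x i := by positivity
          rw [abs_le]
          constructor <;> nlinarith
        -- This is why the cut-off is a function of `sig`: along the row the derivative of `sig` is
        -- at most `sig` in absolute value, so the cut-off term stays bounded up to the boundary.
        have h5 : |ε m * deriv Real.smoothTransition (2 - ε m * sig p x) *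
            (p (some i) ^ 2 / x i - x i * sig p x)| ≤ M := by
          rw [abs_mul, abs_mul, abs_of_pos (hε m)]
          calc _ ≤ ε m * |deriv Real.smoothTransition (2 - ε m * sig p x)| * sig p x := by
                have := hε m
                gcongr
            _ = |deriv Real.smoothTransition (2 - ε m * sig p x)| * (ε m * sig p x) := by ring
            _ ≤ M := hM _ (mul_nonneg (hε m).le hs.le)
        have hT0 := Real.smoothTransition.nonneg (2 - ε m * sig p x)
        have hT1 := Real.smoothTransition.le_one (2 - ε m * sig p x)
        rw [Real.norm_eq_abs]
        simp only [hF]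
        rw [abs_mul, abs_of_pos hd]
        refine mul_le_mul_of_nonneg_left ?_ hd.le
        refine (abs_add_le _ _).trans (add_le_add ?_ ?_)
        · rw [abs_mul, abs_of_nonneg hT0]
          refine (mul_le_of_le_one_left (abs_nonneg _) hT1).trans ((abs_add_le _ _).trans
            (add_le_add h1 ?_))
          rw [abs_mul]
          exact mul_le_mul h3 h2 (abs_nonneg _) (by positivity)
        · rw [abs_mul]
          exact mul_le_mul h2 h5 (abs_nonneg _) hC2
      · simp [hF, dens, hx]
    · by_cases hx : x ∈ simplex ι
      · have hs := sig_pos hp hx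
        have hε0 : Tendsto (fun m => ε m * sig p x) atTop (𝓝 0) := by
          have : Tendsto ε atTop (𝓝 0) := tendsto_one_div_add_atTop_nhds_zero_nat
          simpa using this.mul_const (sig p x)
        refine tendsto_const_nhds.congr' ?_
        filter_upwards [hε0.eventually_lt_const one_pos] with m hm
        simp only [hF]
        rw [deriv_smoothTransition_of_one_lt (by linarith),
          Real.smoothTransition.one_of_one_le (by linarith)]
        ring
      · simp [hF, dens, hx]
  simp_rw [hFint] at hlim
  exact (tendsto_nhds_unique hlim tendsto_const_nhds)

end PartsIntegral

end

end TwoParam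

namespace TwoParam

noncomputable section

/-! ### Integration by parts and moments under the Dirichlet process -/

section LawIdentities

variable {ι : Type*} [Fintype ι]

/-- The masses of the blocks under the base measure. -/
def blockProb (κ : ℕ → Option ι) (ν₀ : ProbabilityMeasure ℕ) (k : Option ι) : ℝ :=
  (ν₀ : Measure ℕ).real (κ ⁻¹' {k})

/-- The exponent `θ + n/2` for `n` blocks. -/
def expo (ι : Type*) [Fintype ι] (θ : ℝ) : ℝ := θ + ((Fintype.card ι : ℝ) + 1) / 2

/-- The share `(p_k² / x_k) / ∑ p_j² / x_j` of the block `k`. -/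
def share (p : Option ι → ℝ) (k : Option ι) (x : ι → ℝ) : ℝ := p k ^ 2 / full x k / sig p x

theorem sum_blockProb (κ : ℕ → Option ι) (ν₀ : ProbabilityMeasure ℕ) :
    ∑ k, blockProb κ ν₀ k = 1 := by
  have h := lintegral_blocks κ (ν₀ : Measure ℕ) fun _ => 1
  simp only [lintegral_const, measure_univ, mul_one] at h
  rw [← ENNReal.ofReal_sum_of_nonneg fun k _ => measureReal_nonneg] at h
  have := congrArg ENNReal.toReal h
  rwa [ENNReal.toReal_one, ENNReal.toReal_ofReal (Finset.sum_nonneg fun k _ => measureReal_nonneg),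
    eq_comm] at this

theorem full_blockVec (κ : ℕ → Option ι) (μ : ProbabilityMeasure ℕ) (k : Option ι) :
    full (blockVec κ μ) k = (μ : Measure ℕ).real (κ ⁻¹' {k}) := by
  cases k with
  | some i => rfl
  | none =>
    have := sum_blockProb κ μ
    rw [Fintype.sum_option] at this
    simp only [full, blockVec]
    simp only [blockProb] at this
    linarith

theorem map_blockVec_law [DecidableEq ι] (κ : ℕ → Option ι) {θ : ℝ} (hθ : -1 / 2 < θ)
    (ν₀ : ProbabilityMeasure ℕ) (hp : ∀ k, 0 < blockProb κ ν₀ k) :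
    (law θ ν₀).map (blockVec κ) = finLaw (blockProb κ ν₀) (expo ι θ) :=
  map_blockVec_eq_finLaw κ hθ ν₀ hp

theorem card_div_two_lt_expo {θ : ℝ} (hθ : -1 / 2 < θ) :
    (Fintype.card ι : ℝ) / 2 < expo ι θ := by
  unfold expo
  linarith

theorem expo_pos {θ : ℝ} (hθ : -1 / 2 < θ) : 0 < expo ι θ :=
  lt_of_le_of_lt (by positivity) (card_div_two_lt_expo hθ)

theorem ae_blockVec_mem_simplex [DecidableEq ι] (κ : ℕ → Option ι) {θ : ℝ} (hθ : -1 / 2 < θ)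
    (ν₀ : ProbabilityMeasure ℕ) (hp : ∀ k, 0 < blockProb κ ν₀ k) :
    ∀ᵐ μ ∂law θ ν₀, blockVec κ μ ∈ simplex ι := by
  have h := finLaw_simplex (blockProb κ ν₀) (expo ι θ)
  rw [← map_blockVec_law κ hθ ν₀ hp] at h
  exact ae_of_ae_map (measurable_blockVec κ).aemeasurable h

theorem integral_law_parts [DecidableEq ι] (κ : ℕ → Option ι) {θ : ℝ} (hθ : -1 / 2 < θ)
    (ν₀ : ProbabilityMeasure ℕ) (hp : ∀ k, 0 < blockProb κ ν₀ k) (i : ι) {g : (ι → ℝ) → ℝ}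
    (hg : ContDiff ℝ 1 g) :
    ∫ μ, (fderiv ℝ g (blockVec κ μ) (diffRow i (blockVec κ μ)) +
      driftCoeff (blockProb κ ν₀) (expo ι θ) i (blockVec κ μ) * g (blockVec κ μ)) ∂law θ ν₀ = 0 := by
  have hfd : Continuous fun x => fderiv ℝ g x (diffRow i x) :=
    (hg.continuous_fderiv (by norm_num)).clm_apply (continuous_diffRow i)
  have hm : Measurable fun x => fderiv ℝ g x (diffRow i x) +
      driftCoeff (blockProb κ ν₀) (expo ι θ) i x * g x :=
    hfd.measurable.add ((measurable_driftCoeff _ _ i).mul hg.continuous.measurable)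
  have h := integral_map (μ := law θ ν₀) (measurable_blockVec κ).aemeasurable hm.aestronglyMeasurable
  rw [← h, map_blockVec_law κ hθ ν₀ hp, finLaw, integral_smul_measure,
    integral_withDensity_eq_integral_toReal_smul (by fun_prop)
      (Eventually.of_forall fun x => ENNReal.ofReal_lt_top)]
  simp_rw [ENNReal.toReal_ofReal (dens_nonneg hp _ _), smul_eq_mul]
  rw [integral_dens_mul_eq_zero hp (sum_blockProb κ ν₀) (card_div_two_lt_expo hθ) i hg, mul_zero]

/-! ### Moments of the shares, uniformly in the number of blocks -/

theorem normConst_add_nat {p : Option ι → ℝ} (hp : ∀ k, 0 < p k) (hp1 : ∑ k, p k = 1) {b : ℝ}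
    (hb : (Fintype.card ι : ℝ) / 2 < b) (r : ℕ) :
    normConst p (b + r) = ENNReal.ofReal (∏ j ∈ Finset.range r,
      ((b - (Fintype.card ι : ℝ) / 2 + j) / (b + j))) * normConst p b := by
  have hb0 : 0 < b := lt_of_le_of_lt (by positivity) hb
  have hc := sub_pos.2 hb
  induction r with
  | zero => simp
  | succ r ih =>
    have h1 := normConst_add_one hp hp1 (b := b + r) (by
      have : (0 : ℝ) ≤ r := r.cast_nonneg
      linarith)
    have e : b + ((r + 1 : ℕ) : ℝ) = b + r + 1 := by push_cast; ring
    rw [e, h1, ih, ← mul_assoc, Finset.prod_range_succ, mul_comm (Finset.prod _ _),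
      ENNReal.ofReal_mul (by positivity)]
    congr 4
    ring

/-- The factor `sig ^ (-r)` raises the exponent to `b + r`, which amounts to replacing `θ` by `θ +
r`. What remains is an inverse power of the single coordinate `k`. -/
theorem share_pow_mul_dens {p : Option ι → ℝ} (hp : ∀ k, 0 < p k) (b : ℝ) (k : Option ι) (r : ℕ)
    (x : ι → ℝ) :
    share p k x ^ r * dens p b x = p k ^ (2 * r) * ((full x k ^ r)⁻¹ * dens p (b + r) x) := by
  by_cases hx : x ∈ simplex ι
  · have hs := sig_pos hp hx
    rw [dens, dens, if_pos hx, if_pos hx, share, neg_add, Real.rpow_add hs, Real.rpow_neg hs.le r,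
      Real.rpow_natCast, div_pow, div_pow, pow_mul]
    field_simp
  · simp [dens, hx]

@[fun_prop]
theorem measurable_share (p : Option ι → ℝ) (k : Option ι) : Measurable (share p k) := by
  unfold share
  fun_prop

theorem lintegral_share_pow_finLaw {p : Option ι → ℝ} (hp : ∀ k, 0 < p k) (hp1 : ∑ k, p k = 1)
    {b : ℝ} (hb : (Fintype.card ι : ℝ) / 2 < b) (k : Option ι) (r : ℕ) :
    ∫⁻ x, ENNReal.ofReal (share p k x ^ r) ∂finLaw p b =
      ENNReal.ofReal (∏ j ∈ Finset.range r, ((b - (Fintype.card ι : ℝ) / 2 + j) / (b + j))) *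
        (ENNReal.ofReal (p k ^ (2 * r)) *
          ∫⁻ x, ENNReal.ofReal ((full x k ^ r)⁻¹) ∂finLaw p (b + r)) := by
  have hb0 : 0 < b := lt_of_le_of_lt (by positivity) hb
  have hc := sub_pos.2 hb
  have hr : (Fintype.card ι : ℝ) / 2 < b + r := by
    have : (0 : ℝ) ≤ r := r.cast_nonneg
    linarith
  have hZ0 := normConst_ne_zero hp (b + r)
  have hZ1 := (normConst_lt_top hp hp1 hr).ne
  have hpk := hp k
  rw [lintegral_finLaw p b (by fun_prop), lintegral_finLaw p (b + r) (by fun_prop)]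
  have h1 : ∀ x, ENNReal.ofReal (share p k x ^ r) * ENNReal.ofReal (dens p b x) =
      ENNReal.ofReal (p k ^ (2 * r)) *
        (ENNReal.ofReal ((full x k ^ r)⁻¹) * ENNReal.ofReal (dens p (b + r) x)) := by
    intro x
    rw [← ENNReal.ofReal_mul' (dens_nonneg hp b x), share_pow_mul_dens hp,
      ENNReal.ofReal_mul (by positivity), ENNReal.ofReal_mul' (dens_nonneg hp _ x)]
  simp_rw [h1]
  rw [lintegral_const_mul _ (by fun_prop)]
  set I := ∫⁻ x, ENNReal.ofReal ((full x k ^ r)⁻¹) * ENNReal.ofReal (dens p (b + r) x)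
  set A := ENNReal.ofReal (p k ^ (2 * r))
  have hinv : (normConst p b)⁻¹ = ENNReal.ofReal (∏ j ∈ Finset.range r,
      ((b - (Fintype.card ι : ℝ) / 2 + j) / (b + j))) * (normConst p (b + r))⁻¹ := by
    rw [normConst_add_nat hp hp1 hb r]
    have hK : 0 < ∏ j ∈ Finset.range r, ((b - (Fintype.card ι : ℝ) / 2 + j) / (b + j)) :=
      Finset.prod_pos fun j _ => by positivity
    have hK' := (ENNReal.ofReal_pos.2 hK).ne'
    rw [ENNReal.mul_inv (Or.inl hK') (Or.inl ENNReal.ofReal_ne_top), ← mul_assoc,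
      ENNReal.mul_inv_cancel hK' ENNReal.ofReal_ne_top, one_mul]
  rw [hinv]
  ring

/-- The weighted inverse moment that governs the shares of the block `s`. -/
def inverseMoment (θ : ℝ) (ν₀ : ProbabilityMeasure ℕ) (r : ℕ) (s : Set ℕ) : ℝ≥0∞ :=
  ENNReal.ofReal ((ν₀ : Measure ℕ).real s ^ (2 * r)) *
    ∫⁻ μ, ENNReal.ofReal (((μ : Measure ℕ).real s ^ r)⁻¹) ∂law (θ + r) ν₀

/-- The prefactor depends on the partition only through the number of blocks, and `inverseMoment`
only through the block `k` itself. The inverse moment can therefore be estimated in any other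
partition that contains this block. -/
theorem lintegral_share_pow_law [DecidableEq ι] (κ : ℕ → Option ι) {θ : ℝ} (hθ : -1 / 2 < θ)
    (ν₀ : ProbabilityMeasure ℕ) (hp : ∀ k, 0 < blockProb κ ν₀ k) (k : Option ι) (r : ℕ) :
    ∫⁻ μ, ENNReal.ofReal (share (blockProb κ ν₀) k (blockVec κ μ) ^ r) ∂law θ ν₀ =
      ENNReal.ofReal (∏ j ∈ Finset.range r, ((θ + 1 / 2 + j) / (expo ι θ + j))) *
        inverseMoment θ ν₀ r (κ ⁻¹' {k}) := by
  have hθr : -1 / 2 < θ + r := by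
    have : (0 : ℝ) ≤ r := r.cast_nonneg
    linarith
  have h1 : ∫⁻ μ, ENNReal.ofReal (share (blockProb κ ν₀) k (blockVec κ μ) ^ r) ∂law θ ν₀ =
      ∫⁻ x, ENNReal.ofReal (share (blockProb κ ν₀) k x ^ r) ∂finLaw (blockProb κ ν₀) (expo ι θ) := by
    rw [← map_blockVec_law κ hθ ν₀ hp,
      lintegral_map (f := fun x => ENNReal.ofReal (share (blockProb κ ν₀) k x ^ r)) (by fun_prop)
        (measurable_blockVec κ)]
  have h2 : ∫⁻ μ, ENNReal.ofReal (((μ : Measure ℕ).real (κ ⁻¹' {k}) ^ r)⁻¹) ∂law (θ + r) ν₀ =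
      ∫⁻ x, ENNReal.ofReal ((full x k ^ r)⁻¹) ∂finLaw (blockProb κ ν₀) (expo ι θ + r) := by
    have e : expo ι θ + r = expo ι (θ + r) := by unfold expo; ring
    rw [e, ← map_blockVec_law κ hθr ν₀ hp,
      lintegral_map (f := fun x : ι → ℝ => ENNReal.ofReal ((full x k ^ r)⁻¹)) (by fun_prop)
        (measurable_blockVec κ)]
    simp_rw [full_blockVec]
  have e2 : expo ι θ - (Fintype.card ι : ℝ) / 2 = θ + 1 / 2 := by unfold expo; ring
  rw [h1, lintegral_share_pow_finLaw hp (sum_blockProb κ ν₀) (card_div_two_lt_expo hθ), e2,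
    inverseMoment, h2]
  rfl

theorem share_mem_Icc_of_mem {p : Option ι → ℝ} (hp : ∀ k, 0 < p k) {x : ι → ℝ}
    (hx : x ∈ simplex ι) (k : Option ι) : share p k x ∈ Set.Icc (0 : ℝ) 1 :=
  share_mem_Icc hp hx k

/-- In the partition into `s` and `sᶜ` the shares are at most `1`. Reading `lintegral_share_pow_law`
backwards there, where the exponent is `θ + 1`, bounds the inverse moment. -/
theorem inverseMoment_le {θ : ℝ} (hθ : -1 / 2 < θ) (ν₀ : ProbabilityMeasure ℕ) (r : ℕ)
    {s : Set ℕ} (hs : 0 < (ν₀ : Measure ℕ).real s) (hs' : 0 < (ν₀ : Measure ℕ).real sᶜ) :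
    inverseMoment θ ν₀ r s ≤
      ENNReal.ofReal (∏ j ∈ Finset.range r, ((θ + 1 + j) / (θ + 1 / 2 + j))) := by
  classical
  have hP := isProbabilityMeasure_law hθ ν₀
  set κ : ℕ → Option Unit := fun j => if j ∈ s then some () else none with hκ
  have hsome : κ ⁻¹' {some ()} = s := by ext j; simp [hκ]
  have hnone : κ ⁻¹' {none} = sᶜ := by ext j; simp [hκ]
  have hp : ∀ k, 0 < blockProb κ ν₀ k := by
    rintro (_ | ⟨⟩)
    · rwa [blockProb, hnone]
    · rwa [blockProb, hsome]
  have h := lintegral_share_pow_law κ hθ ν₀ hp (some ()) r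
  rw [hsome] at h
  have hle : ∫⁻ μ, ENNReal.ofReal (share (blockProb κ ν₀) (some ()) (blockVec κ μ) ^ r)
      ∂law θ ν₀ ≤ 1 := by
    calc _ ≤ ∫⁻ _, 1 ∂law θ ν₀ := by
          refine lintegral_mono_ae ?_
          filter_upwards [ae_blockVec_mem_simplex κ hθ ν₀ hp] with μ hμ
          have := share_mem_Icc_of_mem hp hμ (some ())
          rw [← ENNReal.ofReal_one]
          exact ENNReal.ofReal_le_ofReal (pow_le_one₀ this.1 this.2)
      _ = 1 := by simp
  rw [h] at hle
  have hc : 0 < θ + 1 / 2 := by linarith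
  have he : expo Unit θ = θ + 1 := by simp [expo]
  rw [he] at hle
  have h0 : 0 < θ + 1 := by linarith
  set K := ∏ j ∈ Finset.range r, ((θ + 1 / 2 + (j : ℝ)) / (θ + 1 + j)) with hK
  have hKpos : 0 < K := Finset.prod_pos fun j _ => by positivity
  have hinv : ∏ j ∈ Finset.range r, ((θ + 1 + (j : ℝ)) / (θ + 1 / 2 + j)) = K⁻¹ := by
    rw [hK, ← Finset.prod_inv_distrib]
    exact Finset.prod_congr rfl fun j _ => (inv_div _ _).symm
  rw [hinv, ENNReal.ofReal_inv_of_pos hKpos, ENNReal.le_inv_iff_mul_le, mul_comm]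
  exact hle

/-- The factors `θ + 1/2 + j` cancel against those in `inverseMoment_le`, and `expo / (expo + j) ≤
1` leaves a bound that does not involve the number of blocks. -/
theorem lintegral_share_pow_le [DecidableEq ι] [Nonempty ι] (κ : ℕ → Option ι) {θ : ℝ}
    (hθ : -1 / 2 < θ) (ν₀ : ProbabilityMeasure ℕ) (hp : ∀ k, 0 < blockProb κ ν₀ k) (k : Option ι)
    (r : ℕ) :
    ∫⁻ μ, ENNReal.ofReal ((expo ι θ * share (blockProb κ ν₀) k (blockVec κ μ)) ^ r) ∂law θ ν₀ ≤
      ENNReal.ofReal (∏ j ∈ Finset.range r, (θ + 1 + j)) := by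
  have hb := expo_pos (ι := ι) hθ
  have hc : 0 < θ + 1 / 2 := by linarith
  have h0 : 0 < θ + 1 := by linarith
  have hcompl : 0 < (ν₀ : Measure ℕ).real (κ ⁻¹' {k})ᶜ := by
    obtain ⟨k', hk'⟩ : ∃ k', k' ≠ k := exists_ne k
    refine lt_of_lt_of_le (hp k') (measureReal_mono ?_)
    intro j hj hj'
    simp only [Set.mem_preimage, Set.mem_singleton_iff] at hj hj'
    exact hk' (hj ▸ hj')
  simp_rw [mul_pow, ENNReal.ofReal_mul (pow_nonneg hb.le r)]
  rw [lintegral_const_mul, lintegral_share_pow_law κ hθ ν₀ hp]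
  · calc _ ≤ ENNReal.ofReal (expo ι θ ^ r) *
          (ENNReal.ofReal (∏ j ∈ Finset.range r, ((θ + 1 / 2 + j) / (expo ι θ + j))) *
          ENNReal.ofReal (∏ j ∈ Finset.range r, ((θ + 1 + j) / (θ + 1 / 2 + j)))) := by
          gcongr
          exact inverseMoment_le hθ ν₀ r (hp k) hcompl
      _ ≤ _ := by
          rw [← ENNReal.ofReal_mul (Finset.prod_nonneg fun j _ => by positivity),
            ← ENNReal.ofReal_mul (by positivity), ← Finset.prod_mul_distrib]
          refine ENNReal.ofReal_le_ofReal ?_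
          rw [← Finset.card_range r, ← Finset.prod_const, Finset.card_range,
            ← Finset.prod_mul_distrib]
          refine Finset.prod_le_prod (fun j _ => by positivity) fun j _ => ?_
          have hj : (0 : ℝ) ≤ j := j.cast_nonneg
          have e : ∀ c : ℝ, 0 < c → expo ι θ * ((c + j) / (expo ι θ + j) * ((θ + 1 + j) / (c + j))) =
              expo ι θ / (expo ι θ + j) * (θ + 1 + j) := by
            intro c hc
            field_simp
          rw [e _ hc]
          refine mul_le_of_le_one_left (by positivity) ((div_le_one (by positivity)).2 ?_)
          linarith
  · have := (measurable_share (blockProb κ ν₀) k).comp (measurable_blockVec κ)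
    simp only [Function.comp_def] at this
    fun_prop

theorem integral_share_pow_le [DecidableEq ι] [Nonempty ι] (κ : ℕ → Option ι) {θ : ℝ}
    (hθ : -1 / 2 < θ) (ν₀ : ProbabilityMeasure ℕ) (hp : ∀ k, 0 < blockProb κ ν₀ k) (k : Option ι)
    (r : ℕ) :
    ∫ μ, (expo ι θ * share (blockProb κ ν₀) k (blockVec κ μ)) ^ r ∂law θ ν₀ ≤
      ∏ j ∈ Finset.range r, (θ + 1 + j) := by
  have hb := expo_pos (ι := ι) hθ
  have h0 : 0 < θ + 1 := by linarith
  have hm := (measurable_share (blockProb κ ν₀) k).comp (measurable_blockVec κ)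
  simp only [Function.comp_def] at hm
  rw [integral_eq_lintegral_of_nonneg_ae]
  · exact ENNReal.toReal_le_of_le_ofReal (Finset.prod_nonneg fun j _ => by positivity)
      (lintegral_share_pow_le κ hθ ν₀ hp k r)
  · filter_upwards [ae_blockVec_mem_simplex κ hθ ν₀ hp] with μ hμ
    have := (share_mem_Icc_of_mem hp hμ k).1
    positivity
  · exact Measurable.aestronglyMeasurable (by fun_prop)

end LawIdentities

end

end TwoParam

namespace TwoParam

noncomputable section

/-! ### Conditioning on the first masses, and density of the cylinder functions -/

/-- The masses of the first `d` points. -/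
def headVec (d : ℕ) (μ : ProbabilityMeasure ℕ) : Fin d → ℝ := fun i => mass μ i

@[fun_prop]
theorem measurable_headVec (d : ℕ) : Measurable (headVec d) :=
  measurable_pi_iff.2 fun i => measurable_mass i

/-- The σ-algebras generated by the masses of the first points. -/
def headFiltration : Filtration ℕ (inferInstance : MeasurableSpace (ProbabilityMeasure ℕ)) where
  seq d := MeasurableSpace.comap (headVec d) inferInstance
  mono' d e hde := by
    have hm : Measurable fun (x : Fin e → ℝ) (i : Fin d) => x (Fin.castLE hde i) := by fun_prop
    have : headVec d = (fun x i => x (Fin.castLE hde i)) ∘ headVec e := rfl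
    simp only [this, ← MeasurableSpace.comap_comp]
    exact MeasurableSpace.comap_mono hm.comap_le
  le' d := (measurable_headVec d).comap_le

theorem measurable_of_measurable_mass {X : Type*} [MeasurableSpace X] {f : X → ProbabilityMeasure ℕ}
    (hf : ∀ i, Measurable fun x => mass (f x) i) : Measurable f := by
  have hcoe : Measurable fun x => (f x : Measure ℕ) := by
    refine Measure.measurable_of_measurable_coe _ fun s hs => ?_
    have : (fun x => (f x : Measure ℕ) s) = fun x =>
        ∑' i, s.indicator (fun i => ENNReal.ofReal (mass (f x) i)) i := by
      funext x
      have hm : ∀ i, ENNReal.ofReal (mass (f x) i) = (f x : Measure ℕ) {i} := fun i =>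
        ofReal_measureReal
      simp_rw [hm]
      exact (Measure.tsum_indicator_apply_singleton _ s hs).symm
    rw [this]
    refine Measurable.tsum fun i => ?_
    by_cases hi : i ∈ s
    · simp only [hi, Set.indicator_of_mem]
      exact (hf i).ennreal_ofReal
    · simp only [hi, not_false_eq_true, Set.indicator_of_notMem]
      exact measurable_const
  exact hcoe.subtype_mk (h := fun x => (f x).2)

theorem measurableSpace_le_iSup_headFiltration :
    (inferInstance : MeasurableSpace (ProbabilityMeasure ℕ)) ≤ ⨆ d, headFiltration d := by
  have hmass : ∀ i, Measurable[⨆ d, headFiltration d] fun μ : ProbabilityMeasure ℕ => mass μ i := by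
    intro i
    have h1 : Measurable[headFiltration (i + 1)] fun μ : ProbabilityMeasure ℕ => mass μ i :=
      (measurable_pi_apply (Fin.last i)).comp (comap_measurable (headVec (i + 1)))
    exact h1.mono (le_iSup (fun d => (headFiltration d : MeasurableSpace _)) (i + 1)) le_rfl
  intro s hs
  exact @measurable_of_measurable_mass _ (⨆ d, headFiltration d) id hmass s hs

/-- A function that is orthogonal to the smooth functions of the first masses has conditional
expectation zero given these masses. -/
theorem condExp_headFiltration_eq_zero (P : Measure (ProbabilityMeasure ℕ)) [IsFiniteMeasure P]
    {D : ℕ} {h : ProbabilityMeasure ℕ → ℝ} (hh : Integrable h P)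
    (H : ∀ g : (Fin D → ℝ) → ℝ, ContDiff ℝ ∞ g → HasCompactSupport g →
      ∫ μ, g (headVec D μ) * h μ ∂P = 0) :
    P[h | headFiltration D] =ᵐ[P] 0 := by
  have hle := headFiltration.le D
  -- The conditional expectation factors through `headVec D`; the hypothesis then says that `k`
  -- annihilates every test function under the image measure on `Fin D → ℝ`.
  obtain ⟨k, hk, hkeq⟩ := StronglyMeasurable.exists_eq_measurable_comp (f := headVec D)
    (stronglyMeasurable_condExp (μ := P) (m := headFiltration D) (f := h))
  have hmv := measurable_headVec D
  have hki : Integrable k (P.map (headVec D)) := by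
    rw [integrable_map_measure hk.aestronglyMeasurable hmv.aemeasurable, ← hkeq]
    exact integrable_condExp
  have hk0 : ∀ᵐ x ∂P.map (headVec D), k x = 0 := by
    refine ae_eq_zero_of_integral_contDiff_smul_eq_zero hki.locallyIntegrable fun g hg hgc => ?_
    obtain ⟨C, hC⟩ := hgc.exists_bound_of_continuous hg.continuous
    rw [integral_map (f := fun x => g x • k x) hmv.aemeasurable
      (hg.continuous.measurable.aestronglyMeasurable.smul hk.aestronglyMeasurable)]
    have hgm : StronglyMeasurable[headFiltration D] fun μ => g (headVec D μ) :=
      (hg.continuous.measurable.comp (comap_measurable (headVec D))).stronglyMeasurable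
    have h1 := condExp_stronglyMeasurable_mul_of_bound hle hgm hh C
      (Eventually.of_forall fun μ => hC (headVec D μ))
    rw [hkeq] at h1
    calc ∫ μ, g (headVec D μ) • k (headVec D μ) ∂P
        = ∫ μ, (P[(fun μ => g (headVec D μ)) * h | headFiltration D]) μ ∂P :=
          integral_congr_ae (h1.mono fun μ hμ => hμ.symm)
      _ = 0 := by
          rw [integral_condExp hle]
          exact H g hg hgc
  rw [hkeq]
  exact ae_of_ae_map hmv.aemeasurable hk0

/-- Lévy's upward theorem: the point masses generate the σ-algebra, so the conditional expectations,
all zero, converge almost everywhere to `h`. -/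
theorem ae_eq_zero_of_forall_integral_eq_zero (P : Measure (ProbabilityMeasure ℕ))
    [IsFiniteMeasure P] {h : ProbabilityMeasure ℕ → ℝ} (hh : Integrable h P)
    (H : ∀ (D : ℕ) (g : (Fin D → ℝ) → ℝ), ContDiff ℝ ∞ g →
      ∫ μ, g (headVec D μ) * h μ ∂P = 0) : h =ᵐ[P] 0 := by
  have h0 : h =ᵐ[P] hh.1.mk h := hh.1.ae_eq_mk
  have hmk : StronglyMeasurable[⨆ d, headFiltration d] (hh.1.mk h) :=
    hh.1.stronglyMeasurable_mk.mono measurableSpace_le_iSup_headFiltration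
  have h1 := Integrable.tendsto_ae_condExp (hh.congr h0) hmk
  have h2 : ∀ D, P[hh.1.mk h | headFiltration D] =ᵐ[P] 0 := fun D =>
    (condExp_congr_ae h0.symm).trans
      (condExp_headFiltration_eq_zero P hh fun g hg _ => H D g hg)
  filter_upwards [h0, h1, ae_all_iff.2 h2] with μ e1 e2 e3
  rw [e1]
  refine tendsto_nhds_unique e2 ?_
  simp_rw [e3]
  exact tendsto_const_nhds

/-! ### Density of the cylinder functions in `L²` -/

variable (θ : ℝ) (ν₀ : ProbabilityMeasure ℕ)

/-- `toL2` as a linear map. -/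
def toL2Linear : Cylinder →ₗ[ℝ] L2 θ ν₀ where
  toFun := toL2 θ ν₀
  map_add' _ _ := rfl
  map_smul' _ _ := rfl

theorem inner_toL2 (Φ : Cylinder) (h : L2 θ ν₀) :
    inner ℝ (toL2 θ ν₀ Φ) h = ∫ μ, Φ.1 (mass μ) * h μ ∂law θ ν₀ := by
  rw [L2.inner_def]
  refine integral_congr_ae ?_
  filter_upwards [(memLp_cylinder (law θ ν₀) Φ).coeFn_toLp] with μ hμ
  rw [toL2, hμ]
  simp [mul_comm]

theorem eq_zero_of_forall_inner_toL2 {h : L2 θ ν₀} (H : ∀ Φ, inner ℝ (toL2 θ ν₀ Φ) h = 0) :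
    h = 0 := by
  refine (Lp.eq_zero_iff_ae_eq_zero).2 ?_
  refine ae_eq_zero_of_forall_integral_eq_zero (law θ ν₀) ((Lp.memLp h).integrable (by norm_num))
    fun D g hg => ?_
  have := H ⟨cyl D g, cyl_mem hg⟩
  rwa [inner_toL2] at this

theorem denseRange_toL2 : DenseRange (toL2 θ ν₀) := by
  have h : (LinearMap.range (toL2Linear θ ν₀)).topologicalClosure = ⊤ := by
    rw [Submodule.topologicalClosure_eq_top_iff, Submodule.eq_bot_iff]
    intro h hh
    exact eq_zero_of_forall_inner_toL2 θ ν₀ fun Φ => hh _ ⟨Φ, rfl⟩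
  have h2 := congrArg (fun K : Submodule ℝ (L2 θ ν₀) => (K : Set (L2 θ ν₀))) h
  simp only [Submodule.topologicalClosure_coe, Submodule.top_coe] at h2
  exact dense_iff_closure_eq.2 h2

/-- Two elements of `L²` with the same inner products against cylinder functions agree. -/
theorem ext_inner_toL2 {h k : L2 θ ν₀}
    (H : ∀ Φ, inner ℝ (toL2 θ ν₀ Φ) h = inner ℝ (toL2 θ ν₀ Φ) k) : h = k := by
  rw [← sub_eq_zero]
  exact eq_zero_of_forall_inner_toL2 θ ν₀ fun Φ => by rw [inner_sub_right, H, sub_self]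

end

end TwoParam

namespace TwoParam

noncomputable section

/-! ### The martingale of the rescaled shares -/

/-- By Pythagoras the squared norms increase, hence converge, and their differences are the squared
distances. -/
theorem cauchySeq_of_orthogonal_increments {H : Type*} [NormedAddCommGroup H]
    [InnerProductSpace ℝ H] {x : ℕ → H} (hx : ∀ m n, m ≤ n → inner ℝ (x n - x m) (x m) = 0) {C : ℝ}
    (hC : ∀ n, ‖x n‖ ^ 2 ≤ C) : CauchySeq x := by
  have hsq : ∀ m n, m ≤ n → ‖x n - x m‖ ^ 2 = ‖x n‖ ^ 2 - ‖x m‖ ^ 2 := by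
    intro m n hmn
    have h := norm_add_sq_real (x n - x m) (x m)
    rw [hx m n hmn, sub_add_cancel] at h
    linarith
  have hmono : Monotone fun n => ‖x n‖ ^ 2 := fun m n hmn => by
    have := hsq m n hmn
    have := sq_nonneg ‖x n - x m‖
    simp only
    linarith
  have hlim := (tendsto_atTop_ciSup hmono ⟨C, by rintro _ ⟨n, rfl⟩; exact hC n⟩).cauchySeq
  rw [Metric.cauchySeq_iff'] at hlim ⊢
  intro ε hε
  obtain ⟨N, hN⟩ := hlim (ε ^ 2) (by positivity)
  refine ⟨N, fun n hn => ?_⟩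
  have h1 := (le_abs_self _).trans_lt (hN n hn)
  rw [← hsq N n hn] at h1
  rw [dist_eq_norm]
  exact lt_of_pow_lt_pow_left₀ 2 hε.le h1

/-- The blocks `{0}, …, {d - 1}` and `{d, d + 1, …}`. -/
def headBlocks (d : ℕ) (j : ℕ) : Option (Fin d) := if h : j < d then some ⟨j, h⟩ else none

theorem headBlocks_preimage_some {d : ℕ} (i : Fin d) : headBlocks d ⁻¹' {some i} = {(i : ℕ)} := by
  ext j
  simp only [Set.mem_preimage, Set.mem_singleton_iff, headBlocks]
  split_ifs with h
  · simp [Fin.ext_iff]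
  · simp only [false_iff]
    exact fun e => h (e ▸ i.2)

theorem blockVec_headBlocks (d : ℕ) (μ : ProbabilityMeasure ℕ) :
    blockVec (headBlocks d) μ = headVec d μ := by
  funext i
  rw [blockVec, headBlocks_preimage_some]
  rfl

/-- The base masses of the blocks `{0}, …, {d - 1}` and `{d, d + 1, …}`. -/
def headProb (ν₀ : ProbabilityMeasure ℕ) (d : ℕ) : Option (Fin d) → ℝ :=
  blockProb (headBlocks d) ν₀

theorem headProb_some (ν₀ : ProbabilityMeasure ℕ) {d : ℕ} (i : Fin d) :
    headProb ν₀ d (some i) = mass ν₀ i := by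
  rw [headProb, blockProb, headBlocks_preimage_some]
  rfl

theorem mass_le_headProb_none (ν₀ : ProbabilityMeasure ℕ) (d : ℕ) :
    mass ν₀ d ≤ headProb ν₀ d none := by
  refine measureReal_mono ?_
  simp [headBlocks]

theorem headProb_pos {ν₀ : ProbabilityMeasure ℕ} (hν₀ : ∀ i, 0 < mass ν₀ i) (d : ℕ)
    (k : Option (Fin d)) : 0 < headProb ν₀ d k := by
  cases k with
  | none => exact (hν₀ d).trans_le (mass_le_headProb_none ν₀ d)
  | some i => rw [headProb_some]; exact hν₀ i

variable {θ : ℝ} {ν₀ : ProbabilityMeasure ℕ}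

theorem ae_headVec_mem_simplex (hθ : -1 / 2 < θ) (hν₀ : ∀ i, 0 < mass ν₀ i) (d : ℕ) :
    ∀ᵐ μ ∂law θ ν₀, headVec d μ ∈ simplex (Fin d) := by
  have h := ae_blockVec_mem_simplex (headBlocks d) hθ ν₀ (headProb_pos hν₀ d)
  simpa only [blockVec_headBlocks] using h

variable (θ ν₀) in
/-- The rescaled share of the point `i` among the blocks `{0}, …, {d - 1}`, `{d, d + 1, …}`. -/
def scaledShare (i d : ℕ) (μ : ProbabilityMeasure ℕ) : ℝ :=
  if h : i < d then expo (Fin d) θ * share (headProb ν₀ d) (some ⟨i, h⟩) (headVec d μ) else 0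

theorem scaledShare_of_fin {d : ℕ} (i : Fin d) (μ : ProbabilityMeasure ℕ) :
    scaledShare θ ν₀ i d μ = expo (Fin d) θ * share (headProb ν₀ d) (some i) (headVec d μ) := by
  rw [scaledShare, dif_pos i.2]

theorem measurable_scaledShare_head (i d : ℕ) :
    Measurable[headFiltration d] (scaledShare θ ν₀ i d) := by
  unfold scaledShare
  split_ifs with h
  · exact ((measurable_share _ _).comp (comap_measurable (headVec d))).const_mul _
  · exact measurable_const

@[fun_prop]
theorem measurable_scaledShare (i d : ℕ) : Measurable (scaledShare θ ν₀ i d) :=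
  (measurable_scaledShare_head i d).mono (headFiltration.le d) le_rfl

theorem abs_scaledShare_le (hθ : -1 / 2 < θ) (hν₀ : ∀ i, 0 < mass ν₀ i) (i d : ℕ) :
    ∀ᵐ μ ∂law θ ν₀, ‖scaledShare θ ν₀ i d μ‖ ≤ expo (Fin d) θ := by
  filter_upwards [ae_headVec_mem_simplex hθ hν₀ d] with μ hμ
  have hb := expo_pos (ι := Fin d) hθ
  unfold scaledShare
  split_ifs with h
  · have hs := share_mem_Icc_of_mem (headProb_pos hν₀ d) hμ (some ⟨i, h⟩)
    rw [Real.norm_of_nonneg (mul_nonneg hb.le hs.1)]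
    exact mul_le_of_le_one_right hb.le hs.2
  · simpa using hb.le

theorem memLp_scaledShare (hθ : -1 / 2 < θ) (hν₀ : ∀ i, 0 < mass ν₀ i) (i d : ℕ) :
    MemLp (scaledShare θ ν₀ i d) 2 (law θ ν₀) :=
  MemLp.of_bound (measurable_scaledShare i d).aestronglyMeasurable _ (abs_scaledShare_le hθ hν₀ i d)

theorem integrable_scaledShare (hθ : -1 / 2 < θ) (hν₀ : ∀ i, 0 < mass ν₀ i) (i d : ℕ) :
    Integrable (scaledShare θ ν₀ i d) (law θ ν₀) :=
  (memLp_scaledShare hθ hν₀ i d).integrable (by norm_num)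

theorem headVec_mem_Icc (d : ℕ) (μ : ProbabilityMeasure ℕ) :
    headVec d μ ∈ Set.Icc (0 : Fin d → ℝ) 1 :=
  ⟨fun _ => measureReal_nonneg, fun _ => measureReal_le_one⟩

theorem exists_bound_comp_headVec {d : ℕ} {g : (Fin d → ℝ) → ℝ} (hg : Continuous g) :
    ∃ C, ∀ μ, ‖g (headVec d μ)‖ ≤ C := by
  obtain ⟨C, hC⟩ := (isCompact_Icc (a := (0 : Fin d → ℝ)) (b := 1)).exists_bound_of_continuousOn
    hg.continuousOn
  exact ⟨C, fun μ => hC _ (headVec_mem_Icc d μ)⟩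

theorem memLp_comp_headVec (p : ℝ≥0∞) {d : ℕ} {g : (Fin d → ℝ) → ℝ} (hg : Continuous g) :
    MemLp (fun μ => g (headVec d μ)) p (law θ ν₀) := by
  obtain ⟨C, hC⟩ := exists_bound_comp_headVec hg
  exact MemLp.of_bound (hg.measurable.comp (measurable_headVec d)).aestronglyMeasurable C
    (Eventually.of_forall hC)

/-- Integration by parts for a function of the first `D` masses, with the drift that comes from
the first `N ≥ D` masses. -/
theorem integral_parts_headVec (hθ : -1 / 2 < θ) (hν₀ : ∀ i, 0 < mass ν₀ i) {D N : ℕ}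
    (hDN : D ≤ N) (i : Fin D) {g : (Fin D → ℝ) → ℝ} (hg : ContDiff ℝ 1 g) :
    ∫ μ, fderiv ℝ g (headVec D μ) (diffRow i (headVec D μ)) ∂law θ ν₀ =
      -∫ μ, (-1 / 2 - θ * mass μ i + scaledShare θ ν₀ i N μ) * g (headVec D μ) ∂law θ ν₀ := by
  -- Regard `g` as a function of `N` masses. Since `π` carries `diffRow` to `diffRow`, only the
  -- drift term still sees `N`.
  set π : (Fin N → ℝ) →L[ℝ] (Fin D → ℝ) :=
    ContinuousLinearMap.pi fun j => ContinuousLinearMap.proj (Fin.castLE hDN j) with hπ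
  have hπh : ∀ μ, π (headVec N μ) = headVec D μ := fun μ => rfl
  have hrow : ∀ x, π (diffRow (Fin.castLE hDN i) x) = diffRow i (π x) := by
    intro x
    funext j
    simp [hπ, diffRow]
  have h := integral_law_parts (headBlocks N) hθ ν₀ (headProb_pos hν₀ N) (Fin.castLE hDN i)
    (g := fun x => g (π x)) (hg.comp π.contDiff)
  have hfd : ∀ x v, fderiv ℝ (fun x => g (π x)) x v = fderiv ℝ g (π x) (π v) := by
    intro x v
    have h1 : HasFDerivAt (fun x => g (π x)) ((fderiv ℝ g (π x)).comp π) x :=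
      ((hg.differentiable (by norm_num)) (π x)).hasFDerivAt.comp x π.hasFDerivAt
    rw [h1.fderiv]
    rfl
  have hdc : ∀ μ, driftCoeff (headProb ν₀ N) (expo (Fin N) θ) (Fin.castLE hDN i) (headVec N μ) =
      -1 / 2 - θ * mass μ i + scaledShare θ ν₀ i N μ := by
    intro μ
    have hs := scaledShare_of_fin (θ := θ) (ν₀ := ν₀) (Fin.castLE hDN i) μ
    simp only [Fin.val_castLE] at hs
    rw [hs, driftCoeff]
    simp only [share, full, headVec, expo, Fin.val_castLE]
    ring
  simp_rw [blockVec_headBlocks, hfd, hrow, hπh] at h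
  change ∫ μ, (_ + driftCoeff (headProb ν₀ N) _ _ _ * _) ∂_ = 0 at h
  simp_rw [hdc] at h
  have i1 : Integrable (fun μ => fderiv ℝ g (headVec D μ) (diffRow i (headVec D μ))) (law θ ν₀) :=
    (memLp_comp_headVec 1 (g := fun x => fderiv ℝ g x (diffRow i x))
      ((hg.continuous_fderiv (by norm_num)).clm_apply (continuous_diffRow i))).integrable le_rfl
  have i2 : Integrable (fun μ => (-1 / 2 - θ * mass μ i + scaledShare θ ν₀ i N μ) *
      g (headVec D μ)) (law θ ν₀) := by
    refine MemLp.integrable_mul (p := 2) (q := 2) ?_ (memLp_comp_headVec 2 hg.continuous)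
    exact (memLp_comp_headVec 2 (g := fun x : Fin D → ℝ => -1 / 2 - θ * x i) (by fun_prop)).add
      (memLp_scaledShare hθ hν₀ i N)
  rw [integral_add i1 i2] at h
  linarith

/-- The martingale property. In `integral_parts_headVec` the left-hand side is the same for `N` and
for `D`, so the two drifts have equal integrals against every smooth function of the first `D`
masses. -/
theorem condExp_scaledShare_sub (hθ : -1 / 2 < θ) (hν₀ : ∀ i, 0 < mass ν₀ i) {D N : ℕ}
    (hDN : D ≤ N) (i : Fin D) :
    (law θ ν₀)[scaledShare θ ν₀ i N - scaledShare θ ν₀ i D | headFiltration D] =ᵐ[law θ ν₀] 0 := by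
  refine condExp_headFiltration_eq_zero _
    ((integrable_scaledShare hθ hν₀ i N).sub (integrable_scaledShare hθ hν₀ i D)) fun g hg _ => ?_
  have hg1 : ContDiff ℝ 1 g := hg.of_le (by exact_mod_cast le_top)
  have h1 := integral_parts_headVec hθ hν₀ hDN i hg1
  have h2 := integral_parts_headVec hθ hν₀ le_rfl i hg1
  have hi : ∀ n, Integrable (fun μ => (-1 / 2 - θ * mass μ i + scaledShare θ ν₀ i n μ) *
      g (headVec D μ)) (law θ ν₀) := by
    intro n
    refine MemLp.integrable_mul (p := 2) (q := 2) ?_ (memLp_comp_headVec 2 hg.continuous)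
    exact (memLp_comp_headVec 2 (g := fun x : Fin D → ℝ => -1 / 2 - θ * x i) (by fun_prop)).add
      (memLp_scaledShare hθ hν₀ i n)
  have h3 : ∀ μ, g (headVec D μ) * (scaledShare θ ν₀ i N - scaledShare θ ν₀ i D) μ =
      (-1 / 2 - θ * mass μ i + scaledShare θ ν₀ i N μ) * g (headVec D μ) -
      (-1 / 2 - θ * mass μ i + scaledShare θ ν₀ i D μ) * g (headVec D μ) := by
    intro μ
    simp only [Pi.sub_apply]
    ring
  simp_rw [h3]
  rw [integral_sub (hi N) (hi D)]
  linarith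

theorem integral_scaledShare_orthogonal (hθ : -1 / 2 < θ) (hν₀ : ∀ i, 0 < mass ν₀ i) (i : ℕ)
    {D N : ℕ} (hDN : D ≤ N) :
    ∫ μ, scaledShare θ ν₀ i D μ * (scaledShare θ ν₀ i N μ - scaledShare θ ν₀ i D μ) ∂law θ ν₀ =
      0 := by
  by_cases hi : i < D
  · have h1 := condExp_stronglyMeasurable_mul_of_bound (headFiltration.le D)
      (measurable_scaledShare_head i D).stronglyMeasurable
      ((integrable_scaledShare hθ hν₀ i N).sub (integrable_scaledShare hθ hν₀ i D)) _
      (abs_scaledShare_le hθ hν₀ i D)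
    have h2 := condExp_scaledShare_sub hθ hν₀ hDN ⟨i, hi⟩
    have h3 := integral_condExp (μ := law θ ν₀) (f := scaledShare θ ν₀ i D *
      (scaledShare θ ν₀ i N - scaledShare θ ν₀ i D)) (headFiltration.le D)
    change _ = ∫ μ, scaledShare θ ν₀ i D μ *
      (scaledShare θ ν₀ i N μ - scaledShare θ ν₀ i D μ) ∂law θ ν₀ at h3
    rw [← h3]
    refine integral_eq_zero_of_ae ?_
    filter_upwards [h1, h2] with μ e1 e2
    rw [e1, Pi.mul_apply, e2]
    simp
  -- For `D ≤ i` the rescaled share at `D` is `0` by definition, so orthogonality holds there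
  -- without the martingale property.
  · simp [scaledShare, hi]

/-- The rescaled share as an element of `L²`. -/
def scaledShareL2 (hθ : -1 / 2 < θ) (hν₀ : ∀ i, 0 < mass ν₀ i) (i d : ℕ) : L2 θ ν₀ :=
  (memLp_scaledShare hθ hν₀ i d).toLp _

theorem cauchySeq_scaledShareL2 (hθ : -1 / 2 < θ) (hν₀ : ∀ i, 0 < mass ν₀ i) (i : ℕ) :
    CauchySeq (scaledShareL2 hθ hν₀ i) := by
  -- The constant is the bound of `integral_share_pow_le` for the second moment.
  refine cauchySeq_of_orthogonal_increments (C := (θ + 1) * (θ + 2)) (fun D N hDN => ?_)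
    fun d => ?_
  · rw [L2.inner_def, ← integral_scaledShare_orthogonal hθ hν₀ i hDN]
    refine integral_congr_ae ?_
    filter_upwards [Lp.coeFn_sub (scaledShareL2 hθ hν₀ i N) (scaledShareL2 hθ hν₀ i D),
      (memLp_scaledShare hθ hν₀ i N).coeFn_toLp, (memLp_scaledShare hθ hν₀ i D).coeFn_toLp]
      with μ e1 e2 e3
    rw [e1, Pi.sub_apply, scaledShareL2, scaledShareL2, e2, e3]
    simp
  · rw [← real_inner_self_eq_norm_sq, L2.inner_def]
    have h1 : ∫ μ, inner ℝ (scaledShareL2 hθ hν₀ i d μ) (scaledShareL2 hθ hν₀ i d μ) ∂law θ ν₀ =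
        ∫ μ, scaledShare θ ν₀ i d μ ^ 2 ∂law θ ν₀ := by
      refine integral_congr_ae ?_
      filter_upwards [(memLp_scaledShare hθ hν₀ i d).coeFn_toLp] with μ e
      rw [scaledShareL2, e]
      simp [sq]
    rw [h1]
    by_cases hi : i < d
    · have hne : Nonempty (Fin d) := ⟨⟨i, hi⟩⟩
      have h2 := integral_share_pow_le (headBlocks d) hθ ν₀ (headProb_pos hν₀ d) (some ⟨i, hi⟩) 2
      simp_rw [blockVec_headBlocks] at h2
      have h3 : ∀ μ, scaledShare θ ν₀ i d μ = expo (Fin d) θ *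
          share (blockProb (headBlocks d) ν₀) (some ⟨i, hi⟩) (headVec d μ) :=
        fun μ => scaledShare_of_fin (⟨i, hi⟩ : Fin d) μ
      simp_rw [h3]
      refine h2.trans (le_of_eq ?_)
      rw [Finset.prod_range_succ, Finset.prod_range_one]
      push_cast
      ring
    · simp only [scaledShare, hi, dite_false]
      have : 0 < θ + 1 := by linarith
      have : 0 < θ + 2 := by linarith
      simp only [ne_eq, OfNat.ofNat_ne_zero, not_false_eq_true, zero_pow, integral_zero]
      positivity

/-- The limit of the rescaled shares. -/
def limitShare (hθ : -1 / 2 < θ) (hν₀ : ∀ i, 0 < mass ν₀ i) (i : ℕ) : L2 θ ν₀ :=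
  (cauchySeq_tendsto_of_complete (cauchySeq_scaledShareL2 hθ hν₀ i)).choose

theorem tendsto_scaledShareL2 (hθ : -1 / 2 < θ) (hν₀ : ∀ i, 0 < mass ν₀ i) (i : ℕ) :
    Tendsto (scaledShareL2 hθ hν₀ i) atTop (𝓝 (limitShare hθ hν₀ i)) :=
  (cauchySeq_tendsto_of_complete (cauchySeq_scaledShareL2 hθ hν₀ i)).choose_spec

end

end TwoParam

namespace TwoParam

noncomputable section

/-! ### Convergence of the drift quotients -/

theorem abs_div_add_le_one {a s t : ℝ} (hs : 0 < s) (ha : 0 ≤ a) (has : a ≤ s) (ht : 0 ≤ t) :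
    |a / (s + t)| ≤ 1 := by
  rw [abs_of_nonneg (div_nonneg ha (add_nonneg hs.le ht))]
  exact (div_le_one (by positivity)).2 (by linarith)

/-- Put `q = a / (s + t)` and `w = t / (s + t)`. For `t ≤ s` the difference is at most `2 q w`; for
`t > s` it is at most `1`, while `w ≥ 1/2`. A bound quadratic in `q` and `w` is needed: these will
be shares of order `1/d`, and the error is multiplied by `d + 1`. -/
theorem abs_div_add_sub_div_add_le {a s t t' : ℝ} (hs : 0 < s) (ha : 0 ≤ a) (has : a ≤ s)
    (ht' : 0 ≤ t') (htt : t' ≤ t) :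
    |a / (s + t') - a / (s + t)| ≤ (a / (s + t)) ^ 2 + 5 * (t / (s + t)) ^ 2 := by
  have ht : 0 ≤ t := ht'.trans htt
  have h1 : a / (s + t) ≤ a / (s + t') := by gcongr
  have h2 : a / (s + t') ≤ 1 := (div_le_one (by positivity)).2 (by linarith)
  have h3 : a / (s + t') ≤ a / s := by
    gcongr
    linarith
  have hq : 0 ≤ a / (s + t) := by positivity
  have hw : 0 ≤ t / (s + t) := by positivity
  rw [abs_of_nonneg (sub_nonneg.2 h1)]
  by_cases h : t ≤ s
  · have h4 : a / s - a / (s + t) ≤ 2 * (a / (s + t)) * (t / (s + t)) := by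
      have e : a / s - a / (s + t) = (a / (s + t)) * (t / (s + t)) * ((s + t) / s) := by
        field_simp
        ring
      have h5 : (s + t) / s ≤ 2 := by
        rw [div_le_iff₀ hs]
        linarith
      rw [e]
      nlinarith [mul_nonneg hq hw]
    nlinarith [sq_nonneg (a / (s + t) - t / (s + t)), sq_nonneg (t / (s + t))]
  · have h5 : 1 / 2 ≤ t / (s + t) := by
      rw [le_div_iff₀ (by positivity)]
      linarith
    nlinarith [sq_nonneg (a / (s + t))]

variable {θ : ℝ} {ν₀ : ProbabilityMeasure ℕ}

theorem measurable_driftRatio (i d : ℕ) : Measurable (driftRatio ν₀ i d) := by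
  have := measurable_mass
  unfold driftRatio
  fun_prop

/-- The drift quotient against the share of the point `i`, the blocks being `{0}, …, {d - 1}` and
`{d, d + 1, …}`. -/
theorem driftRatio_estimate (hν₀ : ∀ i, 0 < mass ν₀ i) {d : ℕ} (i : Fin d)
    {μ : ProbabilityMeasure ℕ} (hμ : headVec d μ ∈ simplex (Fin d)) :
    |driftRatio ν₀ i d μ| ≤ d + 1 ∧
    |driftRatio ν₀ i d μ - (d + 1) * share (headProb ν₀ d) (some i) (headVec d μ)| ≤
      (d + 1) * (share (headProb ν₀ d) (some i) (headVec d μ) ^ 2 +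
        5 * share (headProb ν₀ d) none (headVec d μ) ^ 2) := by
  have hm : ∀ j : Fin d, 0 < mass μ j := fun j => hμ (some j)
  have hr : 0 < 1 - ∑ j : Fin d, mass μ j := hμ none
  set s := ∑ j : Fin d, mass ν₀ j ^ 2 / mass μ j with hs
  set r := 1 - ∑ j : Fin d, mass μ j with hrdef
  set a := mass ν₀ i ^ 2 / mass μ i with ha
  have hnn : ∀ j : Fin d, 0 ≤ mass ν₀ j ^ 2 / mass μ j := fun j =>
    div_nonneg (sq_nonneg _) (hm j).le
  have ha0 : 0 < a := div_pos (pow_pos (hν₀ i) 2) (hm i)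
  have has : a ≤ s := Finset.single_le_sum (f := fun j : Fin d => mass ν₀ j ^ 2 / mass μ j)
    (fun j _ => hnn j) (Finset.mem_univ i)
  have hs0 : 0 < s := ha0.trans_le has
  set t := headProb ν₀ d none ^ 2 / r with ht
  -- The drift quotient has the base mass of the single point `d` where the share has that of the
  -- whole tail. Only `0 ≤ t' ≤ t` matters.
  set t' := mass ν₀ d ^ 2 / r with ht'
  have ht'0 : 0 ≤ t' := div_nonneg (sq_nonneg _) hr.le
  have htt : t' ≤ t := by
    have := mass_le_headProb_none ν₀ d
    have := (hν₀ d).le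
    rw [ht, ht']
    gcongr
  have hsig : sig (headProb ν₀ d) (headVec d μ) = s + t := by
    rw [sig, Fintype.sum_option, add_comm]
    simp only [headProb_some, full, headVec]
    rfl
  have hQ : share (headProb ν₀ d) (some i) (headVec d μ) = a / (s + t) := by
    rw [share, hsig, headProb_some]
    rfl
  have hW : share (headProb ν₀ d) none (headVec d μ) = t / (s + t) := by
    rw [share, hsig]
    rfl
  have hR : driftRatio ν₀ i d μ = (d + 1) * (a / (s + t')) := by
    rw [driftRatio, ← Fin.sum_univ_eq_sum_range (fun j => mass ν₀ j ^ 2 / mass μ j),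
      ← Fin.sum_univ_eq_sum_range (fun j => mass μ j), mul_div_assoc]
  have hd : (0 : ℝ) < d + 1 := by positivity
  rw [hQ, hW, hR, ← mul_sub, abs_mul, abs_of_pos hd, abs_mul, abs_of_pos hd]
  refine ⟨?_, ?_⟩
  · exact mul_le_of_le_one_right hd.le (abs_div_add_le_one hs0 ha0.le has ht'0)
  · exact mul_le_mul_of_nonneg_left (abs_div_add_sub_div_add_le hs0 ha0.le has ht'0 htt) hd.le

theorem memLp_driftRatio (hθ : -1 / 2 < θ) (hν₀ : ∀ i, 0 < mass ν₀ i) {i d : ℕ} (hi : i < d) :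
    MemLp (driftRatio ν₀ i d) 2 (law θ ν₀) := by
  refine MemLp.of_bound (measurable_driftRatio i d).aestronglyMeasurable (d + 1) ?_
  filter_upwards [ae_headVec_mem_simplex hθ hν₀ d] with μ hμ
  exact (driftRatio_estimate hν₀ ⟨i, hi⟩ hμ).1

/-- The drift quotient minus twice the rescaled share is small in mean square. -/
theorem integral_driftRatio_sub_sq_le (hθ : -1 / 2 < θ) (hν₀ : ∀ i, 0 < mass ν₀ i) {i d : ℕ}
    (hi : i < d) :
    ∫ μ, (driftRatio ν₀ i d μ - 2 * scaledShare θ ν₀ i d μ) ^ 2 ∂law θ ν₀ ≤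
      (6656 * ∏ j ∈ Finset.range 4, (θ + 1 + j) +
        32 * θ ^ 2 * ∏ j ∈ Finset.range 2, (θ + 1 + j)) / (d : ℝ) ^ 2 := by
  have hne : Nonempty (Fin d) := ⟨⟨i, hi⟩⟩
  have hd1 : (1 : ℝ) ≤ d := by exact_mod_cast (Nat.zero_lt_of_lt hi)
  set b := expo (Fin d) θ with hb
  have hbd : (d : ℝ) / 2 < b := by
    simpa using card_div_two_lt_expo (ι := Fin d) hθ
  -- Replacing `d + 1` by `2 b` costs only `2 θ` times a share, whose mean square is of order
  -- `1/d²`.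
  have hbe : (d : ℝ) + 1 = 2 * b - 2 * θ := by
    rw [hb, expo, Fintype.card_fin]
    ring
  have hb0 : 0 < b := by linarith
  set q : ProbabilityMeasure ℕ → Option (Fin d) → ℝ :=
    fun μ k => b * share (headProb ν₀ d) k (headVec d μ) with hq
  have hmom : ∀ k r, ∫ μ, q μ k ^ r ∂law θ ν₀ ≤ ∏ j ∈ Finset.range r, (θ + 1 + j) := by
    intro k r
    have := integral_share_pow_le (headBlocks d) hθ ν₀ (headProb_pos hν₀ d) k r
    simp_rw [blockVec_headBlocks] at this
    exact this
  have hint : ∀ k r, Integrable (fun μ => q μ k ^ r) (law θ ν₀) := by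
    intro k r
    refine Integrable.of_bound (C := b ^ r) (Measurable.aestronglyMeasurable
      ((((measurable_share _ k).comp (measurable_headVec d)).const_mul b).pow_const r)) ?_
    filter_upwards [ae_headVec_mem_simplex hθ hν₀ d] with μ hμ
    have hs := share_mem_Icc_of_mem (headProb_pos hν₀ d) hμ k
    have h0 : 0 ≤ q μ k := mul_nonneg hb0.le hs.1
    rw [Real.norm_of_nonneg (by positivity)]
    exact pow_le_pow_left₀ h0 (mul_le_of_le_one_right hb0.le hs.2) r
  set K4 := ∏ j ∈ Finset.range 4, (θ + 1 + (j : ℝ))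
  set K2 := ∏ j ∈ Finset.range 2, (θ + 1 + (j : ℝ))
  -- Since `d ≤ 2 b`, each power of `d` in front of a share is absorbed into the rescaled shares
  -- `q`, whose moments are bounded uniformly in `d`. Integration then yields `256 * (1 + 25) =
  -- 6656`.
  have hpt : ∀ᵐ μ ∂law θ ν₀, (driftRatio ν₀ i d μ - 2 * scaledShare θ ν₀ i d μ) ^ 2 ≤
      1 / (d : ℝ) ^ 2 * (256 * (q μ (some ⟨i, hi⟩) ^ 4 + 25 * q μ none ^ 4) +
        32 * θ ^ 2 * q μ (some ⟨i, hi⟩) ^ 2) := by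
    filter_upwards [ae_headVec_mem_simplex hθ hν₀ d] with μ hμ
    have h1 := (driftRatio_estimate hν₀ ⟨i, hi⟩ hμ).2
    have h2 : scaledShare θ ν₀ i d μ = q μ (some ⟨i, hi⟩) :=
      scaledShare_of_fin (⟨i, hi⟩ : Fin d) μ
    simp only at h1
    rw [h2]
    simp only [hq]
    set Q := share (headProb ν₀ d) (some ⟨i, hi⟩) (headVec d μ)
    set W := share (headProb ν₀ d) none (headVec d μ)
    set ρ := driftRatio ν₀ i d μ
    have e1 : ρ - 2 * (b * Q) = (ρ - (d + 1) * Q) + (-2 * θ * Q) := by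
      rw [hbe]
      ring
    have h3 : (ρ - (d + 1) * Q) ^ 2 ≤ ((d + 1) * (Q ^ 2 + 5 * W ^ 2)) ^ 2 :=
      sq_le_sq' (by linarith [neg_abs_le (ρ - (d + 1) * Q)]) ((le_abs_self _).trans h1)
    have hdd : ((d : ℝ) + 1) ^ 2 ≤ 4 * (d : ℝ) ^ 2 := by nlinarith
    have h4 : (Q ^ 2 + 5 * W ^ 2) ^ 2 ≤ 2 * (Q ^ 4 + 25 * W ^ 4) := by
      nlinarith [sq_nonneg (Q ^ 2 - 5 * W ^ 2)]
    have h5 : (ρ - 2 * (b * Q)) ^ 2 ≤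
        16 * (d : ℝ) ^ 2 * (Q ^ 4 + 25 * W ^ 4) + 8 * θ ^ 2 * Q ^ 2 := by
      rw [e1]
      have h6 : ((d + 1) * (Q ^ 2 + 5 * W ^ 2)) ^ 2 ≤
          4 * (d : ℝ) ^ 2 * (2 * (Q ^ 4 + 25 * W ^ 4)) := by
        rw [mul_pow]
        exact mul_le_mul hdd h4 (by positivity) (by positivity)
      nlinarith [sq_nonneg ((ρ - (d + 1) * Q) - (-2 * θ * Q))]
    have hd2 : (d : ℝ) ^ 2 / 4 ≤ b ^ 2 := by nlinarith
    have hd4 : (d : ℝ) ^ 4 / 16 ≤ b ^ 4 := by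
      have := mul_le_mul hd2 hd2 (by positivity) (by positivity)
      nlinarith
    rw [one_div_mul_eq_div, le_div_iff₀ (by positivity)]
    have h7 : (d : ℝ) ^ 4 * Q ^ 4 ≤ 16 * (b * Q) ^ 4 := by
      rw [mul_pow]
      nlinarith [mul_le_mul_of_nonneg_right hd4 (show 0 ≤ Q ^ 4 by positivity)]
    have h8 : (d : ℝ) ^ 4 * W ^ 4 ≤ 16 * (b * W) ^ 4 := by
      rw [mul_pow]
      nlinarith [mul_le_mul_of_nonneg_right hd4 (show 0 ≤ W ^ 4 by positivity)]
    have h9 : (d : ℝ) ^ 2 * (θ ^ 2 * Q ^ 2) ≤ 4 * (θ ^ 2 * (b * Q) ^ 2) := by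
      rw [mul_pow]
      nlinarith [mul_le_mul_of_nonneg_right hd2 (show 0 ≤ θ ^ 2 * Q ^ 2 by positivity)]
    calc _ ≤ (16 * (d : ℝ) ^ 2 * (Q ^ 4 + 25 * W ^ 4) + 8 * θ ^ 2 * Q ^ 2) * (d : ℝ) ^ 2 :=
          mul_le_mul_of_nonneg_right h5 (by positivity)
      _ = 16 * ((d : ℝ) ^ 4 * Q ^ 4 + 25 * ((d : ℝ) ^ 4 * W ^ 4)) +
          8 * ((d : ℝ) ^ 2 * (θ ^ 2 * Q ^ 2)) := by ring
      _ ≤ _ := by linarith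
  have i1 : Integrable (fun μ => q μ (some ⟨i, hi⟩) ^ 4 + 25 * q μ none ^ 4) (law θ ν₀) :=
    (hint _ 4).add ((hint none 4).const_mul 25)
  have i2 : Integrable (fun μ => 32 * θ ^ 2 * q μ (some ⟨i, hi⟩) ^ 2) (law θ ν₀) :=
    (hint _ 2).const_mul (32 * θ ^ 2)
  have hI := integral_mono_ae
    ((memLp_driftRatio hθ hν₀ hi).sub ((memLp_scaledShare hθ hν₀ i d).const_mul 2)).integrable_sq
    (((i1.const_mul 256).add i2).const_mul (1 / (d : ℝ) ^ 2)) hpt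
  refine hI.trans ?_
  rw [integral_const_mul, integral_add' (i1.const_mul 256) i2, integral_const_mul,
    integral_add (hint (some ⟨i, hi⟩) 4) ((hint none 4).const_mul 25), integral_const_mul,
    integral_const_mul, one_div_mul_eq_div]
  have m1 := hmom (some ⟨i, hi⟩) 4
  have m2 := hmom none 4
  have m3 := mul_le_mul_of_nonneg_left (hmom (some ⟨i, hi⟩) 2)
    (show 0 ≤ 32 * θ ^ 2 by positivity)
  gcongr ?_ / _
  linarith

theorem norm_toLp_sq {Ω : Type*} [MeasurableSpace Ω] {P : Measure Ω} {f : Ω → ℝ}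
    (hf : MemLp f 2 P) : ‖hf.toLp f‖ ^ 2 = ∫ x, f x ^ 2 ∂P := by
  rw [← real_inner_self_eq_norm_sq, L2.inner_def]
  refine integral_congr_ae ?_
  filter_upwards [hf.coeFn_toLp] with x e
  rw [e]
  simp [sq]

/-- The factor `2` appears because the shares were rescaled by `expo (Fin d) θ`, which grows like `d
/ 2`, whereas the quotient carries `d + 1`. -/
theorem isL2Limit_driftRatio (hθ : -1 / 2 < θ) (hν₀ : ∀ i, 0 < mass ν₀ i) (i : ℕ) :
    IsL2Limit (law θ ν₀) (driftRatio ν₀ i) ((2 : ℝ) • limitShare hθ hν₀ i) := by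
  have hmem : ∀ d, i < d → MemLp (driftRatio ν₀ i d) 2 (law θ ν₀) := fun d hd =>
    memLp_driftRatio hθ hν₀ hd
  refine ⟨(eventually_gt_atTop i).mono hmem, ?_⟩
  set C := 6656 * ∏ j ∈ Finset.range 4, (θ + 1 + (j : ℝ)) +
        32 * θ ^ 2 * ∏ j ∈ Finset.range 2, (θ + 1 + (j : ℝ))
  have hlim : Tendsto (fun d : ℕ => √(C / (d : ℝ) ^ 2) +
      2 * ‖scaledShareL2 hθ hν₀ i d - limitShare hθ hν₀ i‖) atTop (𝓝 0) := by
    have h1 : Tendsto (fun d : ℕ => C / (d : ℝ) ^ 2) atTop (𝓝 0) :=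
      tendsto_const_nhds.div_atTop
        ((tendsto_pow_atTop two_ne_zero).comp tendsto_natCast_atTop_atTop)
    have h2 := (tendsto_iff_norm_sub_tendsto_zero.1 (tendsto_scaledShareL2 hθ hν₀ i)).const_mul 2
    simpa using h1.sqrt.add h2
  have hlim2 := (ENNReal.continuous_ofReal.tendsto 0).comp hlim
  rw [ENNReal.ofReal_zero] at hlim2
  refine tendsto_of_tendsto_of_tendsto_of_le_of_le' tendsto_const_nhds hlim2
    (Eventually.of_forall fun _ => zero_le) ?_
  filter_upwards [eventually_gt_atTop i] with d hd
  have hd' := hmem d hd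
  have hS := memLp_scaledShare hθ hν₀ i d
  have hsub := hd'.sub (hS.const_mul 2)
  have e1 : (fun μ => driftRatio ν₀ i d μ - ((2 : ℝ) • limitShare hθ hν₀ i : L2 θ ν₀) μ) =ᵐ[law θ ν₀]
      (hsub.toLp _ + (2 : ℝ) • (scaledShareL2 hθ hν₀ i d - limitShare hθ hν₀ i) : L2 θ ν₀) := by
    filter_upwards [Lp.coeFn_add (hsub.toLp _)
      ((2 : ℝ) • (scaledShareL2 hθ hν₀ i d - limitShare hθ hν₀ i)), hsub.coeFn_toLp,
      Lp.coeFn_smul (2 : ℝ) (limitShare hθ hν₀ i),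
      Lp.coeFn_smul (2 : ℝ) (scaledShareL2 hθ hν₀ i d - limitShare hθ hν₀ i),
      Lp.coeFn_sub (scaledShareL2 hθ hν₀ i d) (limitShare hθ hν₀ i), hS.coeFn_toLp]
      with μ a1 a2 a3 a4 a5 a6
    rw [a1, a3, Pi.add_apply, a2, a4]
    simp only [Pi.smul_apply, Pi.sub_apply, smul_eq_mul]
    rw [a5, Pi.sub_apply, scaledShareL2, a6]
    ring
  rw [Function.comp_apply, eLpNorm_congr_ae e1, ← Lp.enorm_def, ← ofReal_norm]
  refine ENNReal.ofReal_le_ofReal ((norm_add_le _ _).trans (add_le_add ?_ ?_))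
  · refine Real.le_sqrt_of_sq_le ?_
    rw [norm_toLp_sq]
    exact integral_driftRatio_sub_sq_le hθ hν₀ hd
  · rw [norm_smul]
    simp

theorem IsL2Limit.unique {X : Type*} [MeasurableSpace X] {P : Measure X} {Y : ℕ → X → ℝ}
    {B B' : Lp ℝ 2 P} (h : IsL2Limit P Y B) (h' : IsL2Limit P Y B') : B = B' := by
  have hsum := h.2.add h'.2
  rw [add_zero] at hsum
  have hle : ∀ᶠ d in atTop, eLpNorm (fun x => B x - B' x) 2 P ≤
      eLpNorm (fun x => Y d x - B x) 2 P + eLpNorm (fun x => Y d x - B' x) 2 P := by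
    filter_upwards [h.1] with d hd
    have e : (fun x => B x - B' x) = (fun x => Y d x - B' x) - fun x => Y d x - B x := by
      funext x
      simp
    rw [e, add_comm]
    exact eLpNorm_sub_le (hd.sub (Lp.memLp B')).1 (hd.sub (Lp.memLp B)).1 (by norm_num)
  have h0 : eLpNorm (fun x => B x - B' x) 2 P = 0 :=
    le_antisymm (ge_of_tendsto hsum hle) zero_le
  rw [eLpNorm_eq_zero_iff (f := fun x => B x - B' x) ((Lp.memLp B).sub (Lp.memLp B')).1 (by norm_num)] at h0
  refine Lp.ext (h0.mono fun x hx => ?_)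
  exact sub_eq_zero.1 hx

end

end TwoParam

namespace TwoParam

noncomputable section

/-! ### The form on cylinder functions -/

variable {θ : ℝ} {ν₀ : ProbabilityMeasure ℕ}

theorem pderiv_contDiff {d : ℕ} {f : (Fin d → ℝ) → ℝ} (hf : ContDiff ℝ ∞ f) (i : Fin d) :
    ContDiff ℝ ∞ (pderiv i f) :=
  (hf.fderiv_right (m := ∞) (by simp)).clm_apply contDiff_const

theorem fderiv_apply_eq_sum {d : ℕ} (f : (Fin d → ℝ) → ℝ) (x v : Fin d → ℝ) :
    fderiv ℝ f x v = ∑ j, v j * pderiv j f x := by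
  conv_lhs => rw [← Finset.univ_sum_single v]
  rw [map_sum]
  refine Finset.sum_congr rfl fun j _ => ?_
  rw [pderiv, ← smul_eq_mul, ← map_smul, ← Pi.single_smul, smul_eq_mul, mul_one]

theorem fderiv_diffRow {d : ℕ} (f : (Fin d → ℝ) → ℝ) (i : Fin d) (x : Fin d → ℝ) :
    fderiv ℝ f x (diffRow i x) = x i * (pderiv i f x - ∑ j, x j * pderiv j f x) := by
  rw [fderiv_apply_eq_sum, mul_sub, Finset.mul_sum]
  simp only [diffRow, mul_sub, sub_mul, Finset.sum_sub_distrib]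
  congr 1
  · simp
  · exact Finset.sum_congr rfl fun j _ => by ring

theorem grad_cyl {d : ℕ} {f : (Fin d → ℝ) → ℝ} (hf : Differentiable ℝ f) (y : ℕ → ℝ) (x : ℕ) :
    grad (cyl d f) y x = if h : x < d then pderiv ⟨x, h⟩ f (fun i => y i) else 0 := by
  have h1 : (fun s : ℝ => cyl d f (y + s • Pi.single x (1 : ℝ))) = fun s : ℝ =>
      f ((fun i : Fin d => y i) + s • fun i : Fin d => (Pi.single x (1 : ℝ) : ℕ → ℝ) i) := rfl
  set v : Fin d → ℝ := fun i => (Pi.single x (1 : ℝ) : ℕ → ℝ) i with hv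
  set z : Fin d → ℝ := fun i => y i with hz
  have h2 : HasDerivAt (fun s : ℝ => z + s • v) v 0 := by
    simpa using ((hasDerivAt_id (0 : ℝ)).smul_const v).const_add z
  have h3 : HasFDerivAt f (fderiv ℝ f z) (z + (0 : ℝ) • v) := by
    simpa using (hf z).hasFDerivAt
  have h4 : deriv (fun s : ℝ => f (z + s • v)) 0 = fderiv ℝ f z v :=
    (h3.comp_hasDerivAt (0 : ℝ) h2).deriv
  rw [grad, h1, h4]
  split_ifs with h
  · have : v = Pi.single ⟨x, h⟩ 1 := by
      funext i
      simp [hv, Pi.single_apply, Fin.ext_iff]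
    rw [this, pderiv]
  · have : v = 0 := by
      funext i
      have : (i : ℕ) ≠ x := fun e => h (e ▸ i.2)
      simp [hv, this]
    rw [this, map_zero]

theorem integral_of_eq_zero (μ : ProbabilityMeasure ℕ) {d : ℕ} {φ : ℕ → ℝ}
    (hφ : ∀ x, d ≤ x → φ x = 0) : ∫ x, φ x ∂(μ : Measure ℕ) = ∑ i : Fin d, mass μ i * φ i := by
  have h : ∀ x, φ x = ∑ i : Fin d, ({(i : ℕ)} : Set ℕ).indicator (fun _ => φ i) x := by
    intro x
    by_cases hx : x < d
    · rw [Finset.sum_eq_single ⟨x, hx⟩]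
      · simp
      · intro j _ hj
        have : x ≠ j := fun e => hj (Fin.ext e.symm)
        simp [this]
      · simp
    · rw [hφ x (not_lt.1 hx), Finset.sum_eq_zero]
      intro j _
      have : x ≠ j := fun e => hx (e ▸ j.2)
      simp [this]
  rw [integral_congr_ae (Eventually.of_forall h), integral_finsetSum _
    (f := fun (i : Fin d) x => ({(i : ℕ)} : Set ℕ).indicator (fun _ => φ i) x) fun i _ =>
      (integrable_const (φ i)).indicator (measurableSet_singleton (i : ℕ))]
  exact Finset.sum_congr rfl fun i _ => by
    rw [integral_indicator_const _ (measurableSet_singleton _)]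
    rfl

theorem covar_comm (μ : ProbabilityMeasure ℕ) (φ ψ : ℕ → ℝ) : covar μ φ ψ = covar μ ψ φ := by
  simp only [covar, mul_comm]

theorem covar_self_nonneg (μ : ProbabilityMeasure ℕ) {d : ℕ} {φ : ℕ → ℝ}
    (hφ : ∀ x, d ≤ x → φ x = 0) : 0 ≤ covar μ φ φ := by
  have hL : MemLp φ 2 (μ : Measure ℕ) := by
    refine MemLp.of_bound (measurable_of_countable φ).aestronglyMeasurable
      (∑ i ∈ Finset.range d, |φ i|) (Eventually.of_forall fun x => ?_)
    by_cases hx : x < d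
    · exact Finset.single_le_sum (f := fun i => |φ i|) (fun i _ => abs_nonneg _)
        (Finset.mem_range.2 hx)
    · rw [hφ x (not_lt.1 hx), norm_zero]
      exact Finset.sum_nonneg fun i _ => abs_nonneg _
  have h := variance_nonneg φ (μ : Measure ℕ)
  rw [variance_eq_sub hL] at h
  simpa only [covar, sq, Pi.mul_apply] using h

/-- Turns the integrand of the form into derivatives of `g` along the fields `diffRow`, the shape in
which integration by parts applies. -/
theorem covar_grad_cyl {d e : ℕ} (hde : d ≤ e) {f : (Fin d → ℝ) → ℝ} {g : (Fin e → ℝ) → ℝ}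
    (hf : Differentiable ℝ f) (hg : Differentiable ℝ g) (μ : ProbabilityMeasure ℕ) :
    covar μ (grad (cyl d f) (mass μ)) (grad (cyl e g) (mass μ)) =
      ∑ i : Fin d, pderiv i f (headVec d μ) *
        fderiv ℝ g (headVec e μ) (diffRow (Fin.castLE hde i) (headVec e μ)) := by
  have h0 : ∀ x, d ≤ x → grad (cyl d f) (mass μ) x = 0 := fun x hx => by
    rw [grad_cyl hf, dif_neg hx.not_gt]
  have h1 : ∀ x, e ≤ x → grad (cyl e g) (mass μ) x = 0 := fun x hx => by
    rw [grad_cyl hg, dif_neg hx.not_gt]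
  have hF : ∀ i : Fin d, grad (cyl d f) (mass μ) i = pderiv i f (headVec d μ) := fun i => by
    rw [grad_cyl hf, dif_pos i.2]
    rfl
  have hG : ∀ i : Fin e, grad (cyl e g) (mass μ) i = pderiv i g (headVec e μ) := fun i => by
    rw [grad_cyl hg, dif_pos i.2]
    rfl
  rw [covar, integral_of_eq_zero μ h0, integral_of_eq_zero μ h1,
    integral_of_eq_zero μ (d := d) fun x hx => by rw [h0 x hx, zero_mul], Finset.sum_mul,
    ← Finset.sum_sub_distrib]
  refine Finset.sum_congr rfl fun i _ => ?_
  have hGi := hG (Fin.castLE hde i)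
  simp only [Fin.val_castLE] at hGi
  simp_rw [hF, hG, hGi, fderiv_diffRow]
  simp only [headVec, Fin.val_castLE]
  ring

theorem form_comm (Φ Ψ : Cylinder) : form θ ν₀ Φ Ψ = form θ ν₀ Ψ Φ := by
  simp only [form, covar_comm]

theorem form_self_nonneg (Φ : Cylinder) : 0 ≤ form θ ν₀ Φ Φ := by
  obtain ⟨d, f, hf, h⟩ := Φ.2
  refine mul_nonneg (by norm_num) (integral_nonneg fun μ => ?_)
  rw [h]
  refine covar_self_nonneg μ (d := d) fun x hx => ?_
  rw [grad_cyl (hf.differentiable (by simp)), dif_neg hx.not_gt]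

/-! ### Integration by parts with the limiting drift -/

theorem memLp_limitDrift (hθ : -1 / 2 < θ) (hν₀ : ∀ i, 0 < mass ν₀ i) (i : ℕ) :
    MemLp (fun μ => -1 / 2 - θ * mass μ i + limitShare hθ hν₀ i μ) 2 (law θ ν₀) := by
  refine MemLp.add ?_ (Lp.memLp _)
  exact memLp_comp_headVec 2 (d := i + 1)
    (g := fun x : Fin (i + 1) → ℝ => -1 / 2 - θ * x (Fin.last i)) (by fun_prop)

/-- In `integral_parts_headVec` the left side does not depend on `N`, and the right side is
continuous in the share for the `L²` norm, so `N → ∞` is harmless. -/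
theorem integral_parts_limit (hθ : -1 / 2 < θ) (hν₀ : ∀ i, 0 < mass ν₀ i) {D : ℕ}
    (i : Fin D) {g : (Fin D → ℝ) → ℝ} (hg : ContDiff ℝ 1 g) :
    ∫ μ, fderiv ℝ g (headVec D μ) (diffRow i (headVec D μ)) ∂law θ ν₀ =
      -∫ μ, (-1 / 2 - θ * mass μ i + limitShare hθ hν₀ i μ) * g (headVec D μ) ∂law θ ν₀ := by
  have hgL := memLp_comp_headVec (θ := θ) (ν₀ := ν₀) 2 hg.continuous
  have hiS : ∀ u : L2 θ ν₀, ∫ μ, (-1 / 2 - θ * mass μ i + u μ) * g (headVec D μ) ∂law θ ν₀ =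
      (∫ μ, (-1 / 2 - θ * mass μ i) * g (headVec D μ) ∂law θ ν₀) + inner ℝ (hgL.toLp _) u := by
    intro u
    have e1 : inner ℝ (hgL.toLp _) u = ∫ μ, u μ * g (headVec D μ) ∂law θ ν₀ := by
      rw [L2.inner_def]
      refine integral_congr_ae ?_
      filter_upwards [hgL.coeFn_toLp] with μ e
      rw [e]
      simp
    rw [e1, ← integral_add]
    · simp only [add_mul]
    · exact (memLp_comp_headVec 1 (g := fun x : Fin D → ℝ => (-1 / 2 - θ * x i) * g x)
        ((by fun_prop : Continuous fun x : Fin D → ℝ => -1 / 2 - θ * x i).mul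
          hg.continuous)).integrable le_rfl
    · exact (Lp.memLp u).integrable_mul (p := 2) (q := 2) hgL
  have hlim := ((tendsto_const_nhds (x := hgL.toLp _)).inner (𝕜 := ℝ)
    (tendsto_scaledShareL2 hθ hν₀ i)).const_add
      (∫ μ, (-1 / 2 - θ * mass μ i) * g (headVec D μ) ∂law θ ν₀)
  rw [← hiS] at hlim
  refine tendsto_nhds_unique ?_ hlim.neg
  refine tendsto_const_nhds.congr' ?_
  filter_upwards [eventually_ge_atTop D] with N hN
  rw [integral_parts_headVec hθ hν₀ hN i hg, ← hiS]
  congr 1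
  refine integral_congr_ae ?_
  filter_upwards [(memLp_scaledShare hθ hν₀ i N).coeFn_toLp] with μ e
  rw [scaledShareL2, e]

/-- The generator applied to the cylinder function `f`. -/
def generatorFun (hθ : -1 / 2 < θ) (hν₀ : ∀ i, 0 < mass ν₀ i) {d : ℕ} (f : (Fin d → ℝ) → ℝ)
    (μ : ProbabilityMeasure ℕ) : ℝ :=
  ∑ i : Fin d, 1 / 2 * (fderiv ℝ (pderiv i f) (headVec d μ) (diffRow i (headVec d μ)) +
    (-1 / 2 - θ * mass μ i + limitShare hθ hν₀ i μ) * pderiv i f (headVec d μ))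

theorem memLp_mul_comp_headVec {u : ProbabilityMeasure ℕ → ℝ} (hu : MemLp u 2 (law θ ν₀)) {d : ℕ}
    {g : (Fin d → ℝ) → ℝ} (hg : Continuous g) :
    MemLp (fun μ => u μ * g (headVec d μ)) 2 (law θ ν₀) :=
  (memLp_comp_headVec ⊤ hg).mul hu

theorem memLp_generatorFun (hθ : -1 / 2 < θ) (hν₀ : ∀ i, 0 < mass ν₀ i) {d : ℕ}
    {f : (Fin d → ℝ) → ℝ} (hf : ContDiff ℝ ∞ f) :
    MemLp (generatorFun hθ hν₀ f) 2 (law θ ν₀) := by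
  have h : ∀ i : Fin d, MemLp (fun μ => 1 / 2 *
      (fderiv ℝ (pderiv i f) (headVec d μ) (diffRow i (headVec d μ)) +
        (-1 / 2 - θ * mass μ i + limitShare hθ hν₀ i μ) * pderiv i f (headVec d μ))) 2
      (law θ ν₀) := by
    intro i
    have h1 := memLp_comp_headVec (θ := θ) (ν₀ := ν₀) 2
      (((pderiv_contDiff hf i).continuous_fderiv (by simp)).clm_apply (continuous_diffRow i))
    have h2 := memLp_mul_comp_headVec (memLp_limitDrift hθ hν₀ i)
      (pderiv_contDiff hf i).continuous
    exact (h1.add h2).const_mul (1 / 2)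
  exact memLp_finsetSum _ fun i _ => h i

/-- Integration by parts applied to the products `∂_i f * g`: the derivative of `g` gives the form,
that of `∂_i f` the second-order part of the generator. -/
theorem form_cyl_eq (hθ : -1 / 2 < θ) (hν₀ : ∀ i, 0 < mass ν₀ i) {d : ℕ}
    {f : (Fin d → ℝ) → ℝ} (hf : ContDiff ℝ ∞ f) (Ψ : Cylinder) :
    form θ ν₀ ⟨cyl d f, cyl_mem hf⟩ Ψ =
      -∫ μ, Ψ.1 (mass μ) * generatorFun hθ hν₀ f μ ∂law θ ν₀ := by
  obtain ⟨d', g', hg', hΨ⟩ := Ψ.2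
  -- Dummy variables are added to the second function so that it has at least `d` of them.
  obtain ⟨e, hde, g, hg, hΨ⟩ : ∃ e, ∃ _ : d ≤ e, ∃ g : (Fin e → ℝ) → ℝ, ContDiff ℝ ∞ g ∧
      Ψ.1 = cyl e g :=
    ⟨max d d', le_max_left _ _, fun x => g' fun i => x (Fin.castLE (le_max_right d d') i),
      hg'.comp (contDiff_pi.2 fun i => contDiff_apply ℝ ℝ _), hΨ⟩
  have hfd : Differentiable ℝ f := hf.differentiable (by simp)
  have hgd : Differentiable ℝ g := hg.differentiable (by simp)
  set π : (Fin e → ℝ) →L[ℝ] (Fin d → ℝ) :=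
    ContinuousLinearMap.pi fun j => ContinuousLinearMap.proj (Fin.castLE hde j) with hπ
  have hπh : ∀ μ, π (headVec e μ) = headVec d μ := fun μ => rfl
  have hrow : ∀ i x, π (diffRow (Fin.castLE hde i) x) = diffRow i (π x) := by
    intro i x
    funext j
    simp [hπ, diffRow]
  have hG : ∀ μ, Ψ.1 (mass μ) = g (headVec e μ) := fun μ => by rw [hΨ]; rfl
  have c1 : ∀ i, Continuous fun x => fderiv ℝ (pderiv i f) x (diffRow i x) := fun i =>
    ((pderiv_contDiff hf i).continuous_fderiv (by simp)).clm_apply (continuous_diffRow i)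
  have c2 : ∀ i, Continuous fun x : Fin e → ℝ => pderiv i f (π x) *
      fderiv ℝ g x (diffRow (Fin.castLE hde i) x) := fun i =>
    ((pderiv_contDiff hf i).continuous.comp π.continuous).mul
      ((hg.continuous_fderiv (by simp)).clm_apply (continuous_diffRow _))
  have hprod : ∀ i x, fderiv ℝ (fun x => pderiv i f (π x) * g x) x
        (diffRow (Fin.castLE hde i) x) =
      pderiv i f (π x) * fderiv ℝ g x (diffRow (Fin.castLE hde i) x) +
        g x * fderiv ℝ (pderiv i f) (π x) (diffRow i (π x)) := by
    intro i x
    have h1 : HasFDerivAt (fun x => pderiv i f (π x)) ((fderiv ℝ (pderiv i f) (π x)).comp π) x :=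
      (((pderiv_contDiff hf i).differentiable (by simp)) (π x)).hasFDerivAt.comp x π.hasFDerivAt
    have h2 : fderiv ℝ (fun x => pderiv i f (π x) * g x) x = _ :=
      (h1.mul (hgd x).hasFDerivAt).fderiv
    rw [h2]
    simp [hrow]
  have hi1 : ∀ i, Integrable (fun μ => pderiv i f (headVec d μ) *
      fderiv ℝ g (headVec e μ) (diffRow (Fin.castLE hde i) (headVec e μ))) (law θ ν₀) := fun i =>
    (memLp_comp_headVec 1 (c2 i)).integrable le_rfl
  have hi2 : ∀ i, Integrable (fun μ => g (headVec e μ) *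
      fderiv ℝ (pderiv i f) (headVec d μ) (diffRow i (headVec d μ))) (law θ ν₀) := fun i =>
    (memLp_comp_headVec 1 (g := fun x => g x * fderiv ℝ (pderiv i f) (π x) (diffRow i (π x)))
      (hg.continuous.mul ((c1 i).comp π.continuous))).integrable le_rfl
  have hi3 : ∀ i : Fin d, Integrable (fun μ => (-1 / 2 - θ * mass μ i + limitShare hθ hν₀ i μ) *
      (pderiv i f (headVec d μ) * g (headVec e μ))) (law θ ν₀) := fun i =>
    (memLp_mul_comp_headVec (memLp_limitDrift hθ hν₀ i) (g := fun x => pderiv i f (π x) * g x)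
      (((pderiv_contDiff hf i).continuous.comp π.continuous).mul hg.continuous)).integrable
        (by norm_num)
  have hkey : ∀ i : Fin d, ∫ μ, pderiv i f (headVec d μ) *
      fderiv ℝ g (headVec e μ) (diffRow (Fin.castLE hde i) (headVec e μ)) ∂law θ ν₀ =
      -∫ μ, g (headVec e μ) * (fderiv ℝ (pderiv i f) (headVec d μ) (diffRow i (headVec d μ)) +
        (-1 / 2 - θ * mass μ i + limitShare hθ hν₀ i μ) * pderiv i f (headVec d μ))
        ∂law θ ν₀ := by
    intro i
    have h := integral_parts_limit hθ hν₀ (Fin.castLE hde i) (g := fun x => pderiv i f (π x) * g x)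
      ((((pderiv_contDiff hf i).comp π.contDiff).mul hg).of_le (by exact_mod_cast le_top))
    simp_rw [hprod, hπh, Fin.val_castLE] at h
    rw [integral_add (hi1 i) (hi2 i)] at h
    have h2 : ∀ μ, g (headVec e μ) *
        (fderiv ℝ (pderiv i f) (headVec d μ) (diffRow i (headVec d μ)) +
        (-1 / 2 - θ * mass μ i + limitShare hθ hν₀ i μ) * pderiv i f (headVec d μ)) =
        g (headVec e μ) * fderiv ℝ (pderiv i f) (headVec d μ) (diffRow i (headVec d μ)) +
        (-1 / 2 - θ * mass μ i + limitShare hθ hν₀ i μ) *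
          (pderiv i f (headVec d μ) * g (headVec e μ)) := fun μ => by ring
    simp_rw [h2]
    rw [integral_add (hi2 i) (hi3 i)]
    linarith
  have hi4 : ∀ i : Fin d, Integrable (fun μ => g (headVec e μ) * (1 / 2 *
      (fderiv ℝ (pderiv i f) (headVec d μ) (diffRow i (headVec d μ)) +
        (-1 / 2 - θ * mass μ i + limitShare hθ hν₀ i μ) * pderiv i f (headVec d μ))))
      (law θ ν₀) := by
    intro i
    refine (((hi2 i).add (hi3 i)).const_mul (1 / 2)).congr (Eventually.of_forall fun μ => ?_)
    simp only [Pi.add_apply]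
    ring
  simp_rw [form, hΨ, covar_grad_cyl hde hfd hgd]
  rw [integral_finsetSum _ fun i _ => hi1 i, Finset.sum_congr rfl fun i _ => hkey i]
  simp_rw [← hΨ, hG, generatorFun, Finset.mul_sum]
  rw [integral_finsetSum _ fun i _ => hi4 i, ← Finset.sum_neg_distrib]
  refine Finset.sum_congr rfl fun i _ => ?_
  simp_rw [mul_left_comm (g _) (1 / 2 : ℝ)]
  rw [integral_const_mul, mul_neg]

end

end TwoParam

namespace TwoParam

noncomputable section

/-! ### The closure of the form and its generator -/

variable {θ : ℝ} {ν₀ : ProbabilityMeasure ℕ}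

theorem form_cyl_eq_neg_inner (hθ : -1 / 2 < θ) (hν₀ : ∀ i, 0 < mass ν₀ i) {d : ℕ}
    {f : (Fin d → ℝ) → ℝ} (hf : ContDiff ℝ ∞ f) (Ψ : Cylinder) :
    form θ ν₀ ⟨cyl d f, cyl_mem hf⟩ Ψ =
      inner ℝ (-(memLp_generatorFun hθ hν₀ hf).toLp _) (toL2 θ ν₀ Ψ) := by
  rw [form_cyl_eq hθ hν₀ hf, inner_neg_left, real_inner_comm, inner_toL2]
  congr 1
  refine integral_congr_ae ?_
  filter_upwards [(memLp_generatorFun hθ hν₀ hf).coeFn_toLp] with μ e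
  rw [e]

/-- With one argument fixed, the form is `L²`-continuous in the other. Bilinearity and closability
are deduced from this alone, together with symmetry and nonnegativity. -/
theorem exists_form_eq_neg_inner (hθ : -1 / 2 < θ) (hν₀ : ∀ i, 0 < mass ν₀ i) (Φ : Cylinder) :
    ∃ k : L2 θ ν₀, ∀ Ψ, form θ ν₀ Φ Ψ = inner ℝ (-k) (toL2 θ ν₀ Ψ) := by
  obtain ⟨Φ, d, f, hf, rfl⟩ := Φ
  exact ⟨_, form_cyl_eq_neg_inner hθ hν₀ hf⟩

/-- The form as a bilinear map. -/
def formBilin (hθ : -1 / 2 < θ) (hν₀ : ∀ i, 0 < mass ν₀ i) : LinearMap.BilinForm ℝ Cylinder :=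
  have add_right : ∀ Φ Ψ Ψ', form θ ν₀ Φ (Ψ + Ψ') = form θ ν₀ Φ Ψ + form θ ν₀ Φ Ψ' := by
    intro Φ Ψ Ψ'
    obtain ⟨k, hk⟩ := exists_form_eq_neg_inner hθ hν₀ Φ
    have : toL2 θ ν₀ (Ψ + Ψ') = toL2 θ ν₀ Ψ + toL2 θ ν₀ Ψ' := (toL2Linear θ ν₀).map_add Ψ Ψ'
    rw [hk, hk, hk, this, inner_add_right]
  have smul_right : ∀ Φ (c : ℝ) Ψ, form θ ν₀ Φ (c • Ψ) = c • form θ ν₀ Φ Ψ := by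
    intro Φ c Ψ
    obtain ⟨k, hk⟩ := exists_form_eq_neg_inner hθ hν₀ Φ
    have : toL2 θ ν₀ (c • Ψ) = c • toL2 θ ν₀ Ψ := (toL2Linear θ ν₀).map_smul c Ψ
    rw [hk, hk, this, inner_smul_right, smul_eq_mul]
  LinearMap.mk₂ ℝ (form θ ν₀)
    (fun Φ Φ' Ψ => by rw [form_comm, add_right, form_comm Ψ, form_comm Ψ])
    (fun c Φ Ψ => by rw [form_comm, smul_right, form_comm Ψ])
    add_right (fun c Φ Ψ => smul_right Φ c Ψ)

theorem formBilin_apply (hθ : -1 / 2 < θ) (hν₀ : ∀ i, 0 < mass ν₀ i) (Φ Ψ : Cylinder) :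
    formBilin hθ hν₀ Φ Ψ = form θ ν₀ Φ Ψ := rfl

theorem form_sq_le (hθ : -1 / 2 < θ) (hν₀ : ∀ i, 0 < mass ν₀ i) (Φ Ψ : Cylinder) :
    form θ ν₀ Φ Ψ ^ 2 ≤ form θ ν₀ Φ Φ * form θ ν₀ Ψ Ψ :=
  (formBilin hθ hν₀).apply_sq_le_of_symm form_self_nonneg ⟨fun Φ Ψ => form_comm Φ Ψ⟩ Φ Ψ

theorem form_sub_self (hθ : -1 / 2 < θ) (hν₀ : ∀ i, 0 < mass ν₀ i) (Φ Ψ : Cylinder) :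
    form θ ν₀ (Φ - Ψ) (Φ - Ψ) = form θ ν₀ Φ Φ - 2 * form θ ν₀ Φ Ψ + form θ ν₀ Ψ Ψ := by
  simp only [← formBilin_apply hθ hν₀, map_sub, LinearMap.sub_apply]
  rw [formBilin_apply hθ hν₀ Ψ Φ, form_comm, formBilin_apply hθ hν₀ Φ Ψ]
  ring

theorem FormCauchy.exists_le {F : ℕ → Cylinder} (hF : FormCauchy θ ν₀ F) {ε : ℝ} (hε : 0 < ε) :
    ∃ N, ∀ m ≥ N, ∀ n ≥ N, form θ ν₀ (F m - F n) (F m - F n) ≤ ε := by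
  have h := (tendsto_order.1 hF).2 ε hε
  obtain ⟨⟨a, b⟩, hab⟩ := eventually_atTop.1 h
  exact ⟨max a b, fun m hm n hn =>
    (hab (m, n) ⟨(le_max_left _ _).trans hm, (le_max_right _ _).trans hn⟩).le⟩

/-- For a fixed large `N`, `𝓔(F_n, F_n) ≤ 𝓔(F_n - F_N, F_n - F_N) + 2 𝓔(F_N, F_n)`. The first term
is small by the Cauchy property and the second tends to `0` by `exists_form_eq_neg_inner`. -/
theorem closable (hθ : -1 / 2 < θ) (hν₀ : ∀ i, 0 < mass ν₀ i) : Closable θ ν₀ := by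
  intro F hF hF0
  refine tendsto_order.2 ⟨fun a ha => Eventually.of_forall fun n => ha.trans_le
    (form_self_nonneg _), fun ε hε => ?_⟩
  obtain ⟨N, hN⟩ := hF.exists_le (half_pos hε)
  obtain ⟨k, hk⟩ := exists_form_eq_neg_inner hθ hν₀ (F N)
  have h1 : Tendsto (fun n => form θ ν₀ (F N) (F n)) atTop (𝓝 0) := by
    simp_rw [hk]
    simpa using (tendsto_const_nhds (x := -k)).inner (𝕜 := ℝ) hF0
  filter_upwards [eventually_ge_atTop N, (tendsto_order.1 h1).2 (ε / 4) (by positivity)]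
    with n hn h2
  have h3 := hN n hn N le_rfl
  rw [form_sub_self hθ hν₀, form_comm (F n) (F N)] at h3
  have h4 := form_self_nonneg (θ := θ) (ν₀ := ν₀) (F N)
  linarith

theorem FormCauchy.exists_bound (hθ : -1 / 2 < θ) (hν₀ : ∀ i, 0 < mass ν₀ i) {F : ℕ → Cylinder}
    (hF : FormCauchy θ ν₀ F) : ∃ C, ∀ᶠ n in atTop, form θ ν₀ (F n) (F n) ≤ C := by
  obtain ⟨N, hN⟩ := hF.exists_le one_pos
  refine ⟨2 + 2 * form θ ν₀ (F N) (F N), ?_⟩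
  filter_upwards [eventually_ge_atTop N] with n hn
  have h1 := hN n hn N le_rfl
  -- Nonnegativity at `F n - 2 F N` is the inequality `𝓔(F_n) ≤ 2 𝓔(F_n - F_N) + 2 𝓔(F_N)` for the
  -- diagonal values.
  have h2 := form_self_nonneg (θ := θ) (ν₀ := ν₀) (F n - (2 : ℝ) • F N)
  rw [form_sub_self hθ hν₀] at h1 h2
  simp only [← formBilin_apply hθ hν₀, map_smul, LinearMap.smul_apply, smul_eq_mul] at h1 h2 ⊢
  linarith

theorem approximates_approxSeq {u : L2 θ ν₀} (hu : u ∈ formDomain θ ν₀) :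
    Approximates θ ν₀ (approxSeq θ ν₀ u) u := by
  rw [approxSeq, dif_pos hu]
  exact Exists.choose_spec hu

theorem approximates_const (hθ : -1 / 2 < θ) (hν₀ : ∀ i, 0 < mass ν₀ i) (Φ : Cylinder) :
    Approximates θ ν₀ (fun _ => Φ) (toL2 θ ν₀ Φ) := by
  refine ⟨?_, tendsto_const_nhds⟩
  have h0 : form θ ν₀ (Φ - Φ) (Φ - Φ) = 0 := by
    rw [sub_self, ← formBilin_apply hθ hν₀, map_zero]
  unfold FormCauchy
  simp only [h0]
  exact tendsto_const_nhds

theorem toL2_mem_formDomain (hθ : -1 / 2 < θ) (hν₀ : ∀ i, 0 < mass ν₀ i) (Φ : Cylinder) :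
    toL2 θ ν₀ Φ ∈ formDomain θ ν₀ :=
  ⟨_, approximates_const hθ hν₀ Φ⟩

/-- `closedForm` is computed with the unspecified sequence `approxSeq`, not with the constant
sequence `Φ`. The difference of the two is null in `L²` and `𝓔`-Cauchy, so its energy tends to `0`
by closability. Cauchy–Schwarz and the bounded energies of `G n` then remove it from the limit. -/
theorem isGeneratorValue_of_form_eq (hθ : -1 / 2 < θ) (hν₀ : ∀ i, 0 < mass ν₀ i) {Φ : Cylinder}
    {k : L2 θ ν₀} (hk : ∀ Ψ, form θ ν₀ Φ Ψ = inner ℝ (-k) (toL2 θ ν₀ Ψ)) :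
    IsGeneratorValue θ ν₀ (toL2 θ ν₀ Φ) k := by
  have hu := toL2_mem_formDomain hθ hν₀ Φ
  refine ⟨hu, fun v hv => Tendsto.limUnder_eq ?_⟩
  obtain ⟨hF, hFu⟩ := approximates_approxSeq hu
  obtain ⟨hG, hGv⟩ := approximates_approxSeq hv
  set F := approxSeq θ ν₀ (toL2 θ ν₀ Φ)
  set G := approxSeq θ ν₀ v
  have h1 : Tendsto (fun n => form θ ν₀ Φ (G n)) atTop (𝓝 (inner ℝ (-k) v)) := by
    simp_rw [hk]
    exact (tendsto_const_nhds (x := -k)).inner (𝕜 := ℝ) hGv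
  have hH : FormCauchy θ ν₀ fun n => F n - Φ := by
    simpa only [FormCauchy, sub_sub_sub_cancel_right] using hF
  have hH0 : Tendsto (fun n => toL2 θ ν₀ (F n - Φ)) atTop (𝓝 0) := by
    have := hFu.sub_const (toL2 θ ν₀ Φ)
    rw [sub_self] at this
    exact this.congr fun n => ((toL2Linear θ ν₀).map_sub (F n) Φ).symm
  have hHf := closable hθ hν₀ _ hH hH0
  obtain ⟨C, hC⟩ := hG.exists_bound hθ hν₀
  have h2 : Tendsto (fun n => form θ ν₀ (F n - Φ) (G n)) atTop (𝓝 0) := by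
    have h3 : Tendsto (fun n => form θ ν₀ (F n - Φ) (G n) ^ 2) atTop (𝓝 0) := by
      refine tendsto_of_tendsto_of_tendsto_of_le_of_le' tendsto_const_nhds
        (by simpa using hHf.mul_const C) (Eventually.of_forall fun n => sq_nonneg _) ?_
      filter_upwards [hC] with n hn
      exact (form_sq_le hθ hν₀ _ _).trans (mul_le_mul_of_nonneg_left hn (form_self_nonneg _))
    have h4 := h3.sqrt
    simp only [Real.sqrt_sq_eq_abs, Real.sqrt_zero] at h4
    exact (tendsto_zero_iff_abs_tendsto_zero _).2 h4
  have h5 := h1.add h2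
  rw [add_zero] at h5
  refine h5.congr fun n => ?_
  simp only [← formBilin_apply hθ hν₀, map_sub, LinearMap.sub_apply]
  ring

theorem IsGeneratorValue.unique (hθ : -1 / 2 < θ) (hν₀ : ∀ i, 0 < mass ν₀ i) {u h k : L2 θ ν₀}
    (hh : IsGeneratorValue θ ν₀ u h) (hk : IsGeneratorValue θ ν₀ u k) : h = k := by
  refine ext_inner_toL2 θ ν₀ fun Φ => ?_
  have hΦ := toL2_mem_formDomain hθ hν₀ Φ
  have e := (hh.2 _ hΦ).symm.trans (hk.2 _ hΦ)
  rw [inner_neg_left, inner_neg_left, neg_inj] at e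
  rw [real_inner_comm, e, real_inner_comm]

theorem toL2_mem_generatorDomain (hθ : -1 / 2 < θ) (hν₀ : ∀ i, 0 < mass ν₀ i) (Φ : Cylinder) :
    toL2 θ ν₀ Φ ∈ generatorDomain θ ν₀ := by
  obtain ⟨k, hk⟩ := exists_form_eq_neg_inner hθ hν₀ Φ
  exact ⟨k, isGeneratorValue_of_form_eq hθ hν₀ hk⟩

theorem generator_cyl (hθ : -1 / 2 < θ) (hν₀ : ∀ i, 0 < mass ν₀ i) {d : ℕ}
    {f : (Fin d → ℝ) → ℝ} (hf : ContDiff ℝ ∞ f) :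
    generator θ ν₀ (toL2 θ ν₀ ⟨cyl d f, cyl_mem hf⟩) =ᵐ[law θ ν₀] generatorFun hθ hν₀ f := by
  have hmem := toL2_mem_generatorDomain hθ hν₀ ⟨cyl d f, cyl_mem hf⟩
  have hG : IsGeneratorValue θ ν₀ (toL2 θ ν₀ ⟨cyl d f, cyl_mem hf⟩)
      (generator θ ν₀ (toL2 θ ν₀ ⟨cyl d f, cyl_mem hf⟩)) := by
    rw [generator, dif_pos hmem]
    exact Exists.choose_spec hmem
  have hk : IsGeneratorValue θ ν₀ (toL2 θ ν₀ ⟨cyl d f, cyl_mem hf⟩)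
      ((memLp_generatorFun hθ hν₀ hf).toLp _) :=
    isGeneratorValue_of_form_eq hθ hν₀ (form_cyl_eq_neg_inner hθ hν₀ hf)
  rw [hG.unique hθ hν₀ hk]
  exact (memLp_generatorFun hθ hν₀ hf).coeFn_toLp

theorem generatorFun_eq (hθ : -1 / 2 < θ) (hν₀ : ∀ i, 0 < mass ν₀ i) {d : ℕ}
    (f : (Fin d → ℝ) → ℝ) (μ : ProbabilityMeasure ℕ) :
    generatorFun hθ hν₀ f μ =
      1 / 2 * ∑ i : Fin d, mass μ i * pderiv i (pderiv i f) (headVec d μ)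
        - 1 / 2 * ∑ i : Fin d, ∑ j : Fin d,
          mass μ i * mass μ j * pderiv i (pderiv j f) (headVec d μ)
        + 1 / 2 * ∑ i : Fin d,
          (-1 / 2 - θ * mass μ i + limitShare hθ hν₀ i μ) * pderiv i f (headVec d μ) := by
  -- Interchanging the two summation indices already matches the order of differentiation, so the
  -- symmetry of second derivatives is not needed.
  rw [Finset.sum_comm (f := fun i j : Fin d => mass μ i * mass μ j *
    pderiv i (pderiv j f) (headVec d μ)), ← mul_sub, ← mul_add, ← Finset.sum_sub_distrib,
    ← Finset.sum_add_distrib, Finset.mul_sum, generatorFun]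
  refine Finset.sum_congr rfl fun i _ => ?_
  rw [fderiv_diffRow, mul_sub, Finset.mul_sum]
  simp only [headVec]
  congr 4
  funext j
  ring

end

end TwoParam
open TwoParam in
theorem theorem2p2 (θ : ℝ) (hθ : -1 / 2 < θ) (ν₀ : ProbabilityMeasure ℕ)
    (hν₀ : ∀ i, 0 < mass ν₀ i) :
    -- the generator is well defined
    (DenseRange (toL2 θ ν₀) ∧ Closable θ ν₀) ∧
    -- (i)
    (∀ Φ : Cylinder, toL2 θ ν₀ Φ ∈ generatorDomain θ ν₀) ∧
    -- (ii)
    (∀ i, ∃ B : L2 θ ν₀, IsL2Limit (law θ ν₀) (driftRatio ν₀ i) B) ∧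
    -- (iii)
    (∀ B : ℕ → L2 θ ν₀, (∀ i, IsL2Limit (law θ ν₀) (driftRatio ν₀ i) (B i)) →
      ∀ (d : ℕ) (f : (Fin d → ℝ) → ℝ) (hf : ContDiff ℝ ∞ f),
        generator θ ν₀ (toL2 θ ν₀ ⟨cyl d f, cyl_mem hf⟩) =ᵐ[law θ ν₀] fun μ =>
          let x : Fin d → ℝ := fun i => mass μ i
          1 / 2 * ∑ i, x i * pderiv i (pderiv i f) x
            - 1 / 2 * ∑ i, ∑ j, x i * x j * pderiv i (pderiv j f) x
            + 1 / 2 * ∑ i, (-1 / 2 - θ * x i + 1 / 2 * B i μ) * pderiv i f x) := by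
  refine ⟨⟨denseRange_toL2 θ ν₀, closable hθ hν₀⟩, toL2_mem_generatorDomain hθ hν₀,
    fun i => ⟨_, isL2Limit_driftRatio hθ hν₀ i⟩, fun B hB d f hf => ?_⟩
  -- The given `B i` is an arbitrary `L²` limit; uniqueness identifies it with twice `limitShare`,
  -- and one null set serves all `i`.
  have hBi : ∀ᵐ μ ∂law θ ν₀, ∀ i, 1 / 2 * B i μ = limitShare hθ hν₀ i μ := by
    refine ae_all_iff.2 fun i => ?_
    rw [(hB i).unique (isL2Limit_driftRatio hθ hν₀ i)]
    filter_upwards [Lp.coeFn_smul (2 : ℝ) (limitShare hθ hν₀ i)] with μ e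
    rw [e, Pi.smul_apply, smul_eq_mul]
    ring
  filter_upwards [generator_cyl hθ hν₀ hf, hBi] with μ e1 e2
  rw [e1, generatorFun_eq]
  simp only [e2]
  rfl
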